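/- Let $M$ be a smooth manifold of dimension $2n+1$ (Hausdorff, second countable, without boundary) with a contact form $\alpha$, i.e. a smooth one-form that vanishes nowhere and whose differential $d\alpha$ is nondegenerate on $\xi=\ker\alpha$. Let $R_\alpha$ be its Reeb vector field ($\alpha(R_\alpha)=1$, $\iota_{R_\alpha}d\alpha=0$), and assume that the Reeb flow $\psi_R^t$ is defined for all $t\in\mathbb R$ (automatic if $M$ is compact). For a smooth function $h$ on $M$ let $X_h$ be the contact vector field determined by $\alpha(X_h)=h$ and $\iota_{X_h}d\alpha=dh(R_\alpha)\,\alpha-dh$. Let $L$ be a closed smooth manifold of dimension $n$ and let $j_t\colon L\to M$, $t\in[0,1]$, be a positive Legendrian isotopy: a smooth family of smooth embeddings with $j_t^*\alpha=0$ and $\alpha(\frac{d}{dt}j_t(x))>0$ for all $t\in[0,1]$ and $x\in L$. Write $L_t=j_t(L)$. Suppose that the isotopy is periodic, $L_0=L_1$, and that it is the restriction of the Reeb flow for $t$ near $0$ and $1$: $L_t=\psi_R^t(L_0)$ for all $t\geq 0$ near $0$, and $L_t=\psi_R^{t-1}(L_1)$ for all $t\leq 1$ near $1$. Then there are a contact isotopy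 $\varphi^t$, $t\in\mathbb R$, of $(M,\xi)$ (a smooth family of diffeomorphisms with $\varphi^0=\mathrm{id}$ and $(\varphi^t)^*\alpha=\rho_t\alpha$ with $\rho_t>0$) and a smooth function $h\colon\mathbb R\times M\to\mathbb R$, $h^t=h(t,\cdot)$, that generates it, $\frac{d}{dt}\varphi^t=X_{h^t}\circ\varphi^t$, such that 1. $\varphi^t$ is twisted periodic: $\varphi^t=\varphi^{t-k}\circ\varphi^k$ for all $t\in\mathbb R$ and $k\in\mathbb Z$; and $h^{t+1}=h^t$ for all $t$; 2. $\varphi^t$ is positive: $h^t>0$ on $M$ for all $t$; 3. $h^t\equiv 1$ on $M$ for all $t$ near $0$ (hence, by periodicity, for all $t$ near $1$); 4. $\varphi^t(L_0)=L_t$ for all $t\in[0,1]$, and $\varphi^k(L_0)=L_0$ for all $k\in\mathbb Z$; 5. $\dot h^t=0$ along $L_t$: for every $t\in[0,1]$ and every $p\in L_t$, $\frac{\partial}{\partial s}h(s,p)\big|_{s=t}=0$. -/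

import Mathlib

open scoped Manifold ContDiff Topology

noncomputable section

namespace ContactGeom

variable {m : ℕ} {M : Type*} [TopologicalSpace M]
  [ChartedSpace (EuclideanSpace ℝ (Fin m)) M]

/-- A (not necessarily continuous) differential one-form on the `m`-dimensional manifold `M`. -/
abbrev OneForm (m : ℕ) (M : Type*) [TopologicalSpace M]
    [ChartedSpace (EuclideanSpace ℝ (Fin m)) M] :=
  ∀ p : M, TangentSpace (𝓡 m) p →L[ℝ] ℝ

/-- The one-form `α` is smooth, as a section of the cotangent bundle. -/
def OneForm.IsSmooth [IsManifold (𝓡 m) ∞ M] (α : OneForm m M) : Prop :=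
  ContMDiff (𝓡 m) ((𝓡 m).prod 𝓘(ℝ, EuclideanSpace ℝ (Fin m) →L[ℝ] ℝ)) ∞
    (fun p => Bundle.TotalSpace.mk' (EuclideanSpace ℝ (Fin m) →L[ℝ] ℝ)
      (E := fun q : M => TangentSpace (𝓡 m) q →L[ℝ] Bundle.Trivial M ℝ q) p (α p))

/-- The pull-back of `α` under the inverse of the preferred chart at `p`, a one-form on
(the target of the chart in) `ℝᵐ`. -/
def OneForm.inChart (α : OneForm m M) (p : M) (y : EuclideanSpace ℝ (Fin m)) :
    EuclideanSpace ℝ (Fin m) →L[ℝ] ℝ :=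
  (α ((extChartAt (𝓡 m) p).symm y)).comp
    (mfderiv 𝓘(ℝ, EuclideanSpace ℝ (Fin m)) (𝓡 m) (extChartAt (𝓡 m) p).symm y)

/-- The differential at `p` of the preferred chart at `p`. -/
def chartDeriv (p : M) : TangentSpace (𝓡 m) p →L[ℝ] EuclideanSpace ℝ (Fin m) :=
  mfderiv (𝓡 m) 𝓘(ℝ, EuclideanSpace ℝ (Fin m)) (extChartAt (𝓡 m) p) p

/-- The exterior derivative of a one-form, `(dα)ₚ(u, v)`, computed in the preferred chart at `p`
by `dβ(u, v) = (D_u β)(v) - (D_v β)(u)`. -/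
def OneForm.d (α : OneForm m M) (p : M) (u v : TangentSpace (𝓡 m) p) : ℝ :=
  fderiv ℝ (α.inChart p) (extChartAt (𝓡 m) p p) (chartDeriv p u) (chartDeriv p v) -
    fderiv ℝ (α.inChart p) (extChartAt (𝓡 m) p p) (chartDeriv p v) (chartDeriv p u)

/-- `α` is a contact form: a smooth one-form, nowhere zero, whose exterior derivative is
nondegenerate on the hyperplane field `ξ = ker α`. -/
structure IsContactForm [IsManifold (𝓡 m) ∞ M] (α : OneForm m M) : Prop where
  smooth : α.IsSmooth
  ne_zero : ∀ p, α p ≠ 0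
  nondegenerate : ∀ (p : M) (u : TangentSpace (𝓡 m) p), α p u = 0 →
    (∀ v : TangentSpace (𝓡 m) p, α p v = 0 → α.d p u v = 0) → u = 0

/-- The defining equations of the value at `p` of the Reeb vector field. -/
def IsReebVector (α : OneForm m M) (p : M) (r : TangentSpace (𝓡 m) p) : Prop :=
  α p r = 1 ∧ ∀ v : TangentSpace (𝓡 m) p, α.d p r v = 0

open Classical in
/-- The Reeb vector field `R_α` of a contact form `α`: `α(R_α) = 1`, `ι_{R_α} dα = 0`. -/
def reebField (α : OneForm m M) (p : M) : TangentSpace (𝓡 m) p :=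
  if hr : ∃ r : TangentSpace (𝓡 m) p, IsReebVector α p r then hr.choose else 0

/-- The differential `dh` of a function at the point `p`. -/
def differential (h : M → ℝ) (p : M) : TangentSpace (𝓡 m) p →L[ℝ] ℝ :=
  mfderiv (𝓡 m) 𝓘(ℝ, ℝ) h p

/-- The equations `α(X) = h`, `ι_X dα = dh(R_α) α - dh` at the point `p`. -/
def IsContactHamiltonianVector (α : OneForm m M) (h : M → ℝ) (p : M)
    (X : TangentSpace (𝓡 m) p) : Prop :=
  α p X = h p ∧ ∀ v : TangentSpace (𝓡 m) p,
    α.d p X v = differential h p (reebField α p) * α p v - differential h p v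

open Classical in
/-- The contact vector field `X_h` of the contact Hamiltonian `h`. -/
def contactHamiltonianField (α : OneForm m M) (h : M → ℝ) (p : M) : TangentSpace (𝓡 m) p :=
  if hX : ∃ X : TangentSpace (𝓡 m) p, IsContactHamiltonianVector α h p X then hX.choose else 0

/-- `dα` as a bilinear map on the tangent space. -/
theorem OneForm.d_bilin (α : OneForm m M) (p : M) :
    ∃ B : TangentSpace (𝓡 m) p →ₗ[ℝ] TangentSpace (𝓡 m) p →ₗ[ℝ] ℝ,
      (∀ u v, B u v = α.d p u v) ∧ ∀ u, B u u = 0 := by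
  refine ⟨LinearMap.mk₂ ℝ (α.d p) ?_ ?_ ?_ ?_, fun _ _ => rfl, fun u => ?_⟩
  · intro u u' v; simp [OneForm.d]; ring
  · intro c u v; simp [OneForm.d]; ring
  · intro u v v'; simp [OneForm.d]; ring
  · intro c u v; simp [OneForm.d]; ring
  · simp [OneForm.d]

/-- Along the contact hyperplane every covector is of the form `ι_u dα` with `u ∈ ξ`. -/
theorem IsContactForm.exists_kernel_vector [IsManifold (𝓡 m) ∞ M] {α : OneForm m M}
    (hα : IsContactForm α) (p : M) (f : TangentSpace (𝓡 m) p →ₗ[ℝ] ℝ) :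
    ∃ u : TangentSpace (𝓡 m) p, α p u = 0 ∧
      ∀ v : TangentSpace (𝓡 m) p, α p v = 0 → α.d p u v = f v := by
  obtain ⟨B, hB, -⟩ := α.d_bilin p
  have : FiniteDimensional ℝ (TangentSpace (𝓡 m) p) :=
    inferInstanceAs (FiniteDimensional ℝ (EuclideanSpace ℝ (Fin m)))
  let K : Submodule ℝ (TangentSpace (𝓡 m) p) := LinearMap.ker (α p).toLinearMap
  let C : K →ₗ[ℝ] Module.Dual ℝ K := (B.domRestrict₁₂ K K)
  have hC : Function.Injective C := by
    rw [injective_iff_map_eq_zero]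
    intro u hu
    apply Subtype.ext
    refine hα.nondegenerate p u u.2 fun v hv => ?_
    have := LinearMap.congr_fun hu ⟨v, hv⟩
    rw [← hB]
    exact this
  have hS : Function.Surjective C :=
    (LinearMap.injective_iff_surjective_of_finrank_eq_finrank
      (Subspace.dual_finrank_eq (K := ℝ) (V := K)).symm).1 hC
  obtain ⟨u, hu⟩ := hS (f.comp K.subtype)
  refine ⟨u, u.2, fun v hv => ?_⟩
  have := LinearMap.congr_fun hu ⟨v, hv⟩
  rw [← hB]
  exact this

/-- A contact form has a unique Reeb vector at each point. -/
theorem IsContactForm.existsUnique_reebVector [IsManifold (𝓡 m) ∞ M] {α : OneForm m M}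
    (hα : IsContactForm α) (p : M) :
    ∃! r : TangentSpace (𝓡 m) p, IsReebVector α p r := by
  obtain ⟨B, hB, hB0⟩ := α.d_bilin p
  obtain ⟨w, hw⟩ : ∃ w, α p w ≠ 0 := by
    by_contra! hcon
    exact hα.ne_zero p (ContinuousLinearMap.ext hcon)
  obtain ⟨u, hu0, hu⟩ := hα.exists_kernel_vector p (B ((α p w)⁻¹ • w))
  have h1 : α p ((α p w)⁻¹ • w - u) = 1 := by simp [hu0, hw]
  have hker : ∀ v : TangentSpace (𝓡 m) p, α p v = 0 →
      B ((α p w)⁻¹ • w - u) v = 0 := fun v hv => by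
    rw [map_sub, LinearMap.sub_apply, hB u, hu v hv, sub_self]
  refine ⟨(α p w)⁻¹ • w - u, ⟨h1, fun v => ?_⟩, fun r hr => ?_⟩
  · have h2 := hker (v - α p v • ((α p w)⁻¹ • w - u)) (by rw [map_sub, map_smul, h1]; simp)
    rw [map_sub, map_smul, hB0, smul_zero, sub_zero, hB] at h2
    exact h2
  · refine sub_eq_zero.1 (hα.nondegenerate p _ (by rw [map_sub, hr.1, h1, sub_self]) ?_)
    intro v hv
    rw [← hB, map_sub, LinearMap.sub_apply, hker v hv, hB, hr.2 v, sub_zero]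

theorem IsContactForm.isReebVector_reebField [IsManifold (𝓡 m) ∞ M] {α : OneForm m M}
    (hα : IsContactForm α) (p : M) : IsReebVector α p (reebField α p) := by
  have hr := (hα.existsUnique_reebVector p).exists
  rw [reebField, dif_pos hr]
  exact hr.choose_spec

/-- For a contact form the equations of the contact vector field have a unique solution. -/
theorem IsContactForm.existsUnique_contactHamiltonianVector [IsManifold (𝓡 m) ∞ M]
    {α : OneForm m M} (hα : IsContactForm α) (h : M → ℝ) (p : M) :
    ∃! X : TangentSpace (𝓡 m) p, IsContactHamiltonianVector α h p X := by
  obtain ⟨B, hB, hB0⟩ := α.d_bilin p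
  obtain ⟨hR1, hR⟩ := hα.isReebVector_reebField p
  obtain ⟨u, hu0, hu⟩ := hα.exists_kernel_vector p (-(differential h p).toLinearMap)
  have hflip : ∀ v, B v (reebField α p) = 0 := fun v => by
    have h3 := hB0 (v + reebField α p)
    simp only [map_add, LinearMap.add_apply, hB0, hB (reebField α p), hR] at h3
    simpa using h3
  refine ⟨h p • reebField α p + u, ⟨by simp [hR1, hu0], fun v => ?_⟩, fun X hX => ?_⟩
  · have h2 := hu (v - α p v • reebField α p) (by simp [hR1])
    rw [← hB, map_sub, map_smul, hflip, smul_zero, sub_zero, hB] at h2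
    rw [← hB, map_add, map_smul, LinearMap.add_apply, LinearMap.smul_apply, hB, hR, hB, h2]
    simp
    ring
  · refine sub_eq_zero.1 (hα.nondegenerate p _ (by simp [hX.1, hR1, hu0]) ?_)
    intro v hv
    rw [← hB, map_sub, map_add, map_smul, LinearMap.sub_apply, LinearMap.add_apply,
      LinearMap.smul_apply, hB, hB, hB, hX.2, hR, hu v hv, hv]
    simp

theorem IsContactForm.isContactHamiltonianVector_field [IsManifold (𝓡 m) ∞ M]
    {α : OneForm m M} (hα : IsContactForm α) (h : M → ℝ) (p : M) :
    IsContactHamiltonianVector α h p (contactHamiltonianField α h p) := by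
  have hX := (hα.existsUnique_contactHamiltonianVector h p).exists
  rw [contactHamiltonianField, dif_pos hX]
  exact hX.choose_spec

/-- `ψ` is the Reeb flow of `α`, defined for all times. -/
structure IsReebFlow (α : OneForm m M) (ψ : ℝ → M → M) : Prop where
  zero : ∀ p, ψ 0 p = p
  integralCurve : ∀ p, IsMIntegralCurve (I := 𝓡 m) (fun t => ψ t p) (reebField α)

/-- `φ` is a contact isotopy of `(M, ker α)` parametrized by `t ∈ ℝ`: a smooth family of
diffeomorphisms that starts at the identity and preserves the cooriented contact structure. -/
structure IsContactIsotopy (α : OneForm m M) (φ : ℝ → M → M) : Prop where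
  smooth : ContMDiff (𝓘(ℝ, ℝ).prod (𝓡 m)) (𝓡 m) ∞ (fun q : ℝ × M => φ q.1 q.2)
  zero : ∀ p, φ 0 p = p
  diffeomorph : ∀ t, ∃ Φ : Diffeomorph (𝓡 m) (𝓡 m) M M ∞, ∀ p, Φ p = φ t p
  contact : ∀ t p, ∃ ρ : ℝ, 0 < ρ ∧ ∀ v : TangentSpace (𝓡 m) p,
    α (φ t p) (mfderiv (𝓡 m) (𝓡 m) (φ t) p v) = ρ * α p v

/-- The time-dependent contact Hamiltonian `h` generates `φ`: the velocity of `t ↦ φ t p` at time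
`t` is the value of the contact vector field `X_{h t}` at `φ t p`. -/
def Generates (α : OneForm m M) (h : ℝ → M → ℝ) (φ : ℝ → M → M) : Prop :=
  ∀ (t : ℝ) (p : M), HasMFDerivAt 𝓘(ℝ, ℝ) (𝓡 m) (fun s => φ s p) t
    ((1 : ℝ →L[ℝ] ℝ).smulRight (contactHamiltonianField α (h t) (φ t p)))

/-- `φ` is twisted periodic: `φ^t = φ^{t-k} ∘ φ^k` for all `t ∈ ℝ` and `k ∈ ℤ`. -/
def IsTwistedPeriodic (φ : ℝ → M → M) : Prop :=
  ∀ (t : ℝ) (k : ℤ) (p : M), φ t p = φ (t - k) (φ k p)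

/-- `j t`, `t ∈ [0,1]`, is a positive Legendrian isotopy in the `(2n+1)`-dimensional contact
manifold `(M, ker α)`: a smooth family of embeddings of the `n`-manifold `L`, tangent to `ker α`,
whose velocity is positively transverse to `ker α`. Values of `j` outside `[0,1]` are irrelevant. -/
structure IsPositiveLegendrianIsotopy {n : ℕ} {M : Type*} [TopologicalSpace M]
    [ChartedSpace (EuclideanSpace ℝ (Fin (2 * n + 1))) M] (α : OneForm (2 * n + 1) M)
    {L : Type*} [TopologicalSpace L] [ChartedSpace (EuclideanSpace ℝ (Fin n)) L]
    (j : ℝ → L → M) : Prop where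
  smooth : ContMDiffOn (𝓘(ℝ, ℝ).prod (𝓡 n)) (𝓡 (2 * n + 1)) ∞
    (fun q : ℝ × L => j q.1 q.2) (Set.Icc (0 : ℝ) 1 ×ˢ Set.univ)
  embedding : ∀ t ∈ Set.Icc (0 : ℝ) 1,
    Manifold.IsSmoothEmbedding (𝓡 n) (𝓡 (2 * n + 1)) ∞ (j t)
  legendrian : ∀ t ∈ Set.Icc (0 : ℝ) 1, ∀ (x : L) (v : TangentSpace (𝓡 n) x),
    α (j t x) (mfderiv (𝓡 n) (𝓡 (2 * n + 1)) (j t) x v) = 0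
  positive : ∀ t ∈ Set.Icc (0 : ℝ) 1, ∀ x : L,
    0 < α (j t x)
      (mfderivWithin 𝓘(ℝ, ℝ) (𝓡 (2 * n + 1)) (fun s => j s x) (Set.Icc 0 1) t (1 : ℝ))

end ContactGeom

end

/-!
Write `L_t` for the image of `j t`. The contact Hamiltonian `h` is prescribed along the trace of
the isotopy and extended to `ℝ × M`; the contact isotopy is then its flow, and what has to be shown
is that this flow carries `L_0` to `L_t`.

*The prescribed values.* Let `f t x = α (∂ₜ j)` (`isotopySpeed`), a positive function. Any `h` with
`h t (j t x) = f t x` has the following property: the difference `w = ∂ₜ j - X_h` lies in `ker α`,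
and since `j` pulls `α` back to `f dt`, naturality of the exterior derivative
(`OneForm.IsSmooth.fderiv_pull_antisymm`) shows that `dα (w, ·)` vanishes on the tangent space of
`L_t`. A Legendrian subspace is its own `dα`-complement in `ker α`
(`IsContactForm.mem_range_of_orthogonal`), so `w` is tangent to `L_t`
(`exists_contactHamiltonianField_eq`). Hence `X_h` lifts to a vector field on the parameter space
`ℝ × L` with time component one, and solutions of `X_h` that start on `L_s` run in the `L_t`
(`eventually_mem_range`, `mem_range_of_mem_range`).

*The extension.* As `∂ₜ j` is transverse to `ker α`, the map `(t, x) ↦ j t x` is an immersion into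
`M` itself, so near a point of its trace `f` is the restriction of a smooth function on `M` that
does not depend on time (`exists_local_extension_isotopySpeed`). By compactness, Legendrians at
different times less than some `δ` apart are disjoint (`exists_separation`). This makes the
condition `h s (j t x) = f t x` for `|s - t| < δ` consistent; it is a convex condition on the values
of `h`, so the local extensions can be glued by a partition of unity
(`exists_extension_isotopySpeed`), and it makes `h` locally constant in time along the trace. Near
the ends, where the isotopy follows the Reeb flow, `f = 1` (`isotopySpeed_eq_one`), so `h` can be
taken equal to one there and off a compact set, and continued periodically
(`exists_contactHamiltonian`).

*The flow.* Off a compact set `X_h` is the Reeb field, whose flow is complete, and `h` is periodic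
in time; so `X_h` has solutions for a uniform time and generates a global evolution, which depends
smoothly on time and on the initial point (`exists_evolution`,
`exists_uniform_time_of_eq_off_compact`). It preserves `ker α` because `g t = α (Dφᵗ v)` satisfies
the linear equation `g' = dh(R) g` (`Generates.contact`). Smooth dependence on initial conditions
is obtained from the implicit function theorem applied to the integral equation in a space of
curves (`exists_contDiffAt_rescaled_integralCurve`), and smoothness of `X_h` from the expression of
its defining equations in charts by an invertible operator (`contactOperator`).
-/

noncomputable section

namespace ContactGeom

/-! ### Smooth dependence of integral curves in a vector space -/

section ODE

open Set

universe u

/-- Pointwise evaluation of a continuous family of operators, as a bounded bilinear map on spaces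
of continuous maps. -/
def pointwiseApply (K : Type*) [TopologicalSpace K] [CompactSpace K]
    (E F : Type*) [NormedAddCommGroup E] [NormedSpace ℝ E] [NormedAddCommGroup F]
    [NormedSpace ℝ F] : C(K, E →L[ℝ] F) →L[ℝ] C(K, E) →L[ℝ] C(K, F) :=
  LinearMap.mkContinuous₂
    (LinearMap.mk₂ ℝ (fun (A : C(K, E →L[ℝ] F)) (γ : C(K, E)) =>
        (⟨fun k => A k (γ k), A.continuous.clm_apply γ.continuous⟩ : C(K, F)))
      (fun A B γ => by ext k; simp) (fun c A γ => by ext k; simp)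
      (fun A γ η => by ext k; simp) (fun c A γ => by ext k; simp)) 1
    (fun A γ => by
      rw [one_mul]
      refine (ContinuousMap.norm_le _ (by positivity)).2 fun k => ?_
      exact ((A k).le_opNorm _).trans
        (mul_le_mul (A.norm_coe_le_norm k) (γ.norm_coe_le_norm k) (norm_nonneg _) (by positivity)))

@[simp] theorem pointwiseApply_apply {K : Type*} [TopologicalSpace K] [CompactSpace K]
    {E F : Type*} [NormedAddCommGroup E] [NormedSpace ℝ E] [NormedAddCommGroup F]
    [NormedSpace ℝ F] (A : C(K, E →L[ℝ] F)) (γ : C(K, E)) (k : K) :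
    pointwiseApply K E F A γ k = A k (γ k) := rfl

theorem hasFDerivAt_comp_continuousMap {K : Type*} [TopologicalSpace K] [CompactSpace K]
    {E F : Type*} [NormedAddCommGroup E] [NormedSpace ℝ E] [NormedAddCommGroup F]
    [NormedSpace ℝ F] (f : C(E, F)) (f' : C(E, E →L[ℝ] F)) (hf : ∀ x, HasFDerivAt f (f' x) x)
    (γ : C(K, E)) :
    HasFDerivAt (fun η : C(K, E) => f.comp η) (pointwiseApply K E F (f'.comp γ)) γ := by
  rw [hasFDerivAt_iff_isLittleO, Asymptotics.isLittleO_iff]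
  intro ε hε
  have hu := (isCompact_range γ.continuous).uniformContinuousAt_of_continuousAt f'
    (fun a _ => f'.continuous.continuousAt) (Metric.dist_mem_uniformity hε)
  obtain ⟨δ, hδ, h⟩ := Metric.mem_uniformity_dist.1 hu
  filter_upwards [Metric.ball_mem_nhds γ hδ] with η hη
  refine (ContinuousMap.norm_le _ (by positivity)).2 fun k => ?_
  have hk : dist (η k) (γ k) < δ := (ContinuousMap.dist_apply_le_dist k).trans_lt hη
  have hmv := (convex_ball (γ k) δ).norm_image_sub_le_of_norm_hasFDerivWithin_le' (C := ε)
    (f := f) (f' := f') (φ := f' (γ k)) (x := γ k) (y := η k)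
    (fun x _ => (hf x).hasFDerivWithinAt)
    (fun x hx => by
      have := h (a := γ k) (b := x) (by rw [dist_comm]; exact hx) (mem_range_self k)
      rw [← dist_eq_norm, dist_comm]
      exact le_of_lt this)
    (Metric.mem_ball_self hδ) hk
  refine le_trans (le_of_eq ?_) (hmv.trans (mul_le_mul_of_nonneg_left ?_ hε.le))
  · simp
  · exact (η - γ).norm_coe_le_norm k

/-- Composition with a smooth map is a smooth operator on continuous maps. -/
theorem contDiff_comp_continuousMap {K : Type} [TopologicalSpace K] [CompactSpace K]
    {E : Type u} [NormedAddCommGroup E] [NormedSpace ℝ E] (n : ℕ) :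
    ∀ {F : Type u} [NormedAddCommGroup F] [NormedSpace ℝ F] (f : C(E, F)),
      ContDiff ℝ ∞ f → ContDiff ℝ n (fun η : C(K, E) => f.comp η) := by
  induction n with
  | zero =>
    intro F _ _ f hf
    exact contDiff_zero.2 (ContinuousMap.continuous_postcomp f)
  | succ n ih =>
    intro F _ _ f hf
    have hfd := contDiff_infty_iff_fderiv.1 hf
    let f' : C(E, E →L[ℝ] F) := ⟨fderiv ℝ f, hfd.2.continuous⟩
    have hd : ∀ γ : C(K, E), HasFDerivAt (fun η : C(K, E) => f.comp η)
        (pointwiseApply K E F (f'.comp γ)) γ :=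
      hasFDerivAt_comp_continuousMap f f' fun x => (hfd.1 x).hasFDerivAt
    rw [Nat.cast_succ, contDiff_succ_iff_fderiv]
    refine ⟨fun γ => (hd γ).differentiableAt, fun h => by simp at h, ?_⟩
    have : fderiv ℝ (fun η : C(K, E) => f.comp η) =
        fun γ => pointwiseApply K E F (f'.comp γ) := funext fun γ => (hd γ).fderiv
    rw [this]
    exact (pointwiseApply K E F).contDiff.comp (ih f' hfd.2)

/-- The parameter interval of the rescaled integral curves. -/
abbrev curveInterval : Set ℝ := Icc (-2 : ℝ) 2

/-- Integration from `0`, as a bounded operator on continuous curves. -/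
def volterra (E : Type*) [NormedAddCommGroup E] [NormedSpace ℝ E] :
    C(curveInterval, E) →L[ℝ] C(curveInterval, E) :=
  LinearMap.mkContinuous
    { toFun := fun γ => ⟨fun s => ∫ σ in (0 : ℝ)..s, IccExtend (by norm_num) γ σ, by
        have hc : Continuous (IccExtend (a := (-2 : ℝ)) (b := 2) (by norm_num) γ) :=
          γ.continuous.Icc_extend'
        exact (intervalIntegral.continuous_primitive (fun a b => hc.intervalIntegrable a b) 0).comp
          continuous_subtype_val⟩
      map_add' := fun γ η => by
        have hc : ∀ γ : C(curveInterval, E),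
            Continuous (IccExtend (a := (-2 : ℝ)) (b := 2) (by norm_num) γ) :=
          fun γ => γ.continuous.Icc_extend'
        ext s
        exact intervalIntegral.integral_add ((hc γ).intervalIntegrable _ _)
          ((hc η).intervalIntegrable _ _)
      map_smul' := fun c γ => by
        ext s
        exact intervalIntegral.integral_smul c _ } 2
    (fun γ => by
      refine (ContinuousMap.norm_le _ (by positivity)).2 fun s => ?_
      have h1 := intervalIntegral.norm_integral_le_of_norm_le_const (a := (0 : ℝ)) (b := s)
        (f := IccExtend (a := (-2 : ℝ)) (b := 2) (by norm_num) γ) (C := ‖γ‖)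
        (fun x _ => γ.norm_coe_le_norm _)
      refine h1.trans ?_
      rw [mul_comm, sub_zero]
      exact mul_le_mul_of_nonneg_right (abs_le.2 s.2) (norm_nonneg _))

theorem volterra_apply {E : Type*} [NormedAddCommGroup E] [NormedSpace ℝ E]
    (γ : C(curveInterval, E)) (s : curveInterval) :
    volterra E γ s = ∫ σ in (0 : ℝ)..s, IccExtend (by norm_num) γ σ := rfl

/-- Smooth dependence of integral curves on time and on the initial point, with time rescaled:
`Γ (t, x)` is the integral curve of `t • f` that starts at `x`. At `t = 0` the linearization of the
integral equation is the identity, so the implicit function theorem applies. -/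
theorem exists_contDiffAt_rescaled_integralCurve {E : Type*} [NormedAddCommGroup E]
    [NormedSpace ℝ E] [CompleteSpace E] (f : C(E, E)) (hf : ContDiff ℝ ∞ f) (x₀ : E) (n : ℕ) :
    ∃ Γ : ℝ × E → C(curveInterval, E), ContDiffAt ℝ n Γ (0, x₀) ∧
      Γ (0, x₀) = ContinuousMap.const _ x₀ ∧
      ∀ᶠ q in 𝓝 ((0 : ℝ), x₀), ∀ s : curveInterval,
        Γ q s = q.2 + q.1 • ∫ σ in (0 : ℝ)..s, f (IccExtend (by norm_num) (Γ q) σ) := by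
  let c₀ : C(curveInterval, E) := ContinuousMap.const _ x₀
  let cst : E →L[ℝ] C(curveInterval, E) :=
    LinearMap.mkContinuous
      { toFun := fun x => ContinuousMap.const _ x
        map_add' := fun _ _ => rfl
        map_smul' := fun _ _ => rfl } 1
      (fun x => by
        rw [one_mul]
        exact (ContinuousMap.norm_le _ (norm_nonneg _)).2 fun _ => le_rfl)
  let G : (ℝ × E) × C(curveInterval, E) → C(curveInterval, E) := fun q =>
    q.2 - cst q.1.2 - q.1.1 • volterra E (f.comp q.2)
  have hG : ContDiff ℝ (n + 1 : ℕ) G := by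
    have h1 : ContDiff ℝ (n + 1 : ℕ) (fun η : C(curveInterval, E) => f.comp η) :=
      contDiff_comp_continuousMap _ f hf
    have h2 : ContDiff ℝ (n + 1 : ℕ) (fun q : (ℝ × E) × C(curveInterval, E) =>
        volterra E (f.comp q.2)) := (volterra E).contDiff.comp (h1.comp contDiff_snd)
    exact (contDiff_snd.sub (cst.contDiff.comp (contDiff_snd.comp contDiff_fst))).sub
      ((contDiff_fst.comp contDiff_fst).smul h2)
  have hG0 : G ((0, x₀), c₀) = 0 := by
    ext s
    have : cst x₀ s = x₀ := rfl
    simp [G, c₀, this]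
  have hne : ((n + 1 : ℕ) : WithTop ℕ∞) ≠ 0 := by
    exact_mod_cast Nat.succ_ne_zero n
  have hat := hG.contDiffAt (x := ((0, x₀), c₀))
  have hfd : fderiv ℝ G ((0, x₀), c₀) ∘L .inr ℝ (ℝ × E) C(curveInterval, E) =
      ContinuousLinearMap.id ℝ _ := by
    have h1 : HasFDerivAt (G ∘ fun γ => ((0, x₀), γ))
        (fderiv ℝ G ((0, x₀), c₀) ∘L .inr ℝ (ℝ × E) C(curveInterval, E)) c₀ :=
      (hat.differentiableAt hne).hasFDerivAt.comp c₀ (hasFDerivAt_prodMk_right _ _)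
    have h2 : (G ∘ fun γ => ((0, x₀), γ)) = fun γ => γ - cst x₀ := by
      ext γ s; simp [G]
    rw [h2] at h1
    exact h1.unique ((hasFDerivAt_id c₀).sub_const _)
  have hinv : (fderiv ℝ G ((0, x₀), c₀) ∘L
      .inr ℝ (ℝ × E) C(curveInterval, E)).IsInvertible := by
    rw [hfd]; exact ContinuousLinearMap.isInvertible_equiv (f := ContinuousLinearEquiv.refl ℝ _)
  refine ⟨hat.implicitFunction hne hinv, (hat.contDiffAt_implicitFunction hne hinv).of_le
    (by exact_mod_cast Nat.le_succ n), hat.implicitFunction_apply_self hne hinv, ?_⟩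
  filter_upwards [hat.eventually_apply_implicitFunction hne hinv] with q hq s
  rw [hG0] at hq
  have := congrArg (fun γ : C(curveInterval, E) => γ s) hq
  simp only [G, ContinuousMap.sub_apply, ContinuousMap.smul_apply, volterra_apply,
    ContinuousMap.zero_apply] at this
  rw [sub_sub, sub_eq_zero] at this
  exact this

end ODE

/-! ### Vector fields in charts -/

section Charts

open Set

variable {E : Type*} [NormedAddCommGroup E] [NormedSpace ℝ E]
  {H : Type*} [TopologicalSpace H] {I : ModelWithCorners ℝ E H} [I.Boundaryless]
  {Q : Type*} [TopologicalSpace Q] [ChartedSpace H Q]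

theorem contMDiffAt_extChartAt_symm [IsManifold I ∞ Q] {q₀ : Q} {y : E}
    (hy : y ∈ (extChartAt I q₀).target) :
    ContMDiffAt 𝓘(ℝ, E) I ∞ (extChartAt I q₀).symm y :=
  (contMDiffOn_extChartAt_symm q₀).contMDiffAt (extChartAt_target_mem_nhds' hy)

theorem mdifferentiableAt_extChartAt_symm [IsManifold I 1 Q] {q₀ : Q} {y : E}
    (hy : y ∈ (extChartAt I q₀).target) :
    MDifferentiableAt 𝓘(ℝ, E) I (extChartAt I q₀).symm y :=
  (mdifferentiableOn_extChartAt_symm y hy).mdifferentiableAt (extChartAt_target_mem_nhds' hy)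

theorem mfderiv_extChartAt_mfderiv_symm [IsManifold I 1 Q] {q₀ : Q} {y : E}
    (hy : y ∈ (extChartAt I q₀).target) (v : E) :
    (mfderiv I 𝓘(ℝ, E) (extChartAt I q₀) ((extChartAt I q₀).symm y)
      (mfderiv 𝓘(ℝ, E) I (extChartAt I q₀).symm y v) : E) = v := by
  have h := mfderiv_extChartAt_comp_mfderivWithin_extChartAt_symm (I := I) hy
  rw [I.range_eq_univ, mfderivWithin_univ] at h
  exact DFunLike.congr_fun h v

theorem mfderiv_symm_mfderiv_extChartAt [IsManifold I 1 Q] {q₀ q : Q}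
    (hq : q ∈ (extChartAt I q₀).source) (v : TangentSpace I q) :
    mfderiv 𝓘(ℝ, E) I (extChartAt I q₀).symm (extChartAt I q₀ q)
      (mfderiv I 𝓘(ℝ, E) (extChartAt I q₀) q v) = v := by
  have h := mfderivWithin_extChartAt_symm_comp_mfderiv_extChartAt' (I := I) hq
  rw [I.range_eq_univ, mfderivWithin_univ] at h
  exact DFunLike.congr_fun h v

omit [I.Boundaryless] in
/-- The fibre coordinate of a tangent vector is its image under the differential of the chart. -/
theorem trivializationAt_tangent_apply [IsManifold I 1 Q] {q₀ q : Q}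
    (hq : q ∈ (extChartAt I q₀).source) (v : TangentSpace I q) :
    (trivializationAt E (TangentSpace I) q₀ ⟨q, v⟩).2 =
      (mfderiv I 𝓘(ℝ, E) (extChartAt I q₀) q v : E) := by
  rw [extChartAt_source] at hq
  have h1 : (trivializationAt E (TangentSpace I) q₀).continuousLinearMapAt ℝ q v =
      (trivializationAt E (TangentSpace I) q₀ ⟨q, v⟩).2 := by
    rw [Bundle.Trivialization.continuousLinearMapAt_apply,
      Bundle.Trivialization.coe_linearMapAt_of_mem _ (by simpa using hq)]
  exact h1.symm.trans
    (DFunLike.congr_fun (TangentBundle.continuousLinearMapAt_trivializationAt hq) v)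

/-- The vector field `X` read in the preferred chart at `q₀`. -/
def fieldInChart (X : ∀ q : Q, TangentSpace I q) (q₀ : Q) (y : E) : E :=
  mfderiv I 𝓘(ℝ, E) (extChartAt I q₀) ((extChartAt I q₀).symm y) (X ((extChartAt I q₀).symm y))

omit [I.Boundaryless] in
theorem contDiffOn_fieldInChart [IsManifold I ∞ Q] {X : ∀ q : Q, TangentSpace I q}
    (hX : ContMDiff I I.tangent ∞ (fun q => (⟨q, X q⟩ : TangentBundle I Q))) (q₀ : Q) :
    ContDiffOn ℝ ∞ (fieldInChart X q₀) (extChartAt I q₀).target := by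
  have h1 := ((trivializationAt E (TangentSpace I) q₀).contMDiffOn_section_baseSet_iff
    (IB := I) (n := ∞) (s := X)).1 hX.contMDiffOn
  have h2 : ContMDiffOn 𝓘(ℝ, E) 𝓘(ℝ, E) ∞
      (fun y => (trivializationAt E (TangentSpace I) q₀
        ⟨(extChartAt I q₀).symm y, X ((extChartAt I q₀).symm y)⟩).2)
      (extChartAt I q₀).target :=
    h1.comp (contMDiffOn_extChartAt_symm q₀) fun y hy => by
      simpa using (extChartAt I q₀).map_target hy
  refine (contMDiffOn_iff_contDiffOn.1 h2).congr fun y hy => ?_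
  exact (trivializationAt_tangent_apply ((extChartAt I q₀).map_target hy) _).symm

/-- A curve in the chart that solves the ODE of `c • X` gives an integral curve of `c • X`. -/
theorem hasMFDerivAt_symm_comp_of_hasDerivAt [IsManifold I ∞ Q] {X : ∀ q : Q, TangentSpace I q}
    {q₀ : Q} {u : ℝ → E} {s c : ℝ} (hu : u s ∈ (extChartAt I q₀).target)
    (h : HasDerivAt u (c • fieldInChart X q₀ (u s)) s) :
    HasMFDerivAt 𝓘(ℝ, ℝ) I (fun τ => (extChartAt I q₀).symm (u τ)) s
      ((1 : ℝ →L[ℝ] ℝ).smulRight (c • X ((extChartAt I q₀).symm (u s)))) := by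
  have := IsManifold.of_le (I := I) (M := Q) (n := ∞) (m := 1) (by simp)
  have h1 := (mdifferentiableAt_extChartAt_symm (I := I) hu).hasMFDerivAt
  have h2 := h1.comp s h.hasFDerivAt.hasMFDerivAt
  refine h2.congr_mfderiv ?_
  ext
  have h3 := mfderiv_symm_mfderiv_extChartAt (I := I) ((extChartAt I q₀).map_target hu)
    (X ((extChartAt I q₀).symm (u s)))
  rw [(extChartAt I q₀).right_inv hu] at h3
  have h4 : mfderiv 𝓘(ℝ, E) I (extChartAt I q₀).symm (u s) (c • fieldInChart X q₀ (u s)) =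
      c • X ((extChartAt I q₀).symm (u s)) := by
    refine ((mfderiv 𝓘(ℝ, E) I (extChartAt I q₀).symm (u s)).map_smul c _).trans ?_
    exact congrArg (c • ·) h3
  change mfderiv 𝓘(ℝ, E) I (extChartAt I q₀).symm (u s)
    ((1 : ℝ) • (c • fieldInChart X q₀ (u s))) = (1 : ℝ) • (c • X ((extChartAt I q₀).symm (u s)))
  exact ((mfderiv 𝓘(ℝ, E) I (extChartAt I q₀).symm (u s)).map_smul (1 : ℝ) _).trans
    (congrArg ((1 : ℝ) • ·) h4)

/-- A germ of a smooth map extends to the whole space, by a cut-off. -/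
theorem exists_contDiff_eventuallyEq {E F : Type*} [NormedAddCommGroup E] [NormedSpace ℝ E]
    [FiniteDimensional ℝ E] [NormedAddCommGroup F] [NormedSpace ℝ F] {g : E → F} {U : Set E}
    (hU : IsOpen U) (hg : ContDiffOn ℝ ∞ g U) {x₀ : E} (hx : x₀ ∈ U) :
    ∃ f : E → F, ContDiff ℝ ∞ f ∧ f =ᶠ[𝓝 x₀] g := by
  obtain ⟨r, hr, hrU⟩ := Metric.nhds_basis_closedBall.mem_iff.1 (hU.mem_nhds hx)
  let χ : ContDiffBump x₀ := ⟨r / 2, r, by positivity, by linarith⟩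
  refine ⟨fun x => χ x • g x, contDiff_iff_contDiffAt.2 fun x => ?_, ?_⟩
  · by_cases hxU : x ∈ U
    · exact χ.contDiff.contDiffAt.smul (hg.contDiffAt (hU.mem_nhds hxU))
    · have : x ∉ tsupport χ := fun h => hxU (hrU (χ.tsupport_eq ▸ h))
      refine (contDiffAt_const (c := (0 : F))).congr_of_eventuallyEq ?_
      filter_upwards [notMem_tsupport_iff_eventuallyEq.1 this] with z hz
      simp [hz]
  · filter_upwards [χ.eventuallyEq_one] with z hz
    simp [hz]

end Charts

/-! ### The flow of a complete vector field -/

section Flows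

open Set

variable {E : Type*} [NormedAddCommGroup E] [NormedSpace ℝ E] [FiniteDimensional ℝ E]
  {H : Type*} [TopologicalSpace H] {I : ModelWithCorners ℝ E H} [I.Boundaryless]
  {Q : Type*} [TopologicalSpace Q] [ChartedSpace H Q] [IsManifold I ∞ Q]
  {X : ∀ q : Q, TangentSpace I q}

/-- The local flow of a smooth vector field, with time rescaled: for `(t, q)` near `(0, q₀)`, the
curve `Γ (t, q)` is the integral curve of `t • X` through `q`, so that `Γ (t, q) 1` is the flow. -/
theorem exists_local_flow (hX : ContMDiff I I.tangent ∞ (fun q => (⟨q, X q⟩ : TangentBundle I Q)))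
    (q₀ : Q) (n : ℕ) :
    ∃ Γ : ℝ × Q → ℝ → Q,
      ContMDiffAt (𝓘(ℝ, ℝ).prod I) I n (fun z : ℝ × Q => Γ z 1) (0, q₀) ∧
      ∀ᶠ z in 𝓝 ((0 : ℝ), q₀), Γ z 0 = z.2 ∧ ∀ s ∈ Ioo (-2 : ℝ) 2,
        HasMFDerivAt 𝓘(ℝ, ℝ) I (Γ z) s ((1 : ℝ →L[ℝ] ℝ).smulRight (z.1 • X (Γ z s))) := by
  set κ := extChartAt I q₀ with hκ
  obtain ⟨f, hf, hfeq⟩ := exists_contDiff_eventuallyEq (isOpen_extChartAt_target q₀)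
    (contDiffOn_fieldInChart hX q₀) (mem_extChartAt_target (I := I) q₀)
  obtain ⟨G, hG, hG0, hGe⟩ := exists_contDiffAt_rescaled_integralCurve ⟨f, hf.continuous⟩ hf
    (κ q₀) n
  have hmem : κ q₀ ∈ κ.target := mem_extChartAt_target (I := I) q₀
  obtain ⟨r, hr, hball⟩ := Metric.eventually_nhds_iff_ball.1
    (hfeq.and ((isOpen_extChartAt_target (I := I) q₀).mem_nhds hmem))
  let ρ : ℝ × Q → ℝ × E := fun z => (z.1, κ z.2)
  have hρ : ContMDiffAt (𝓘(ℝ, ℝ).prod I) 𝓘(ℝ, ℝ × E) n ρ (0, q₀) :=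
    contMDiffAt_fst.prodMk_space
      ((contMDiffAt_extChartAt (n := n) (x := q₀)).comp ((0 : ℝ), q₀) contMDiffAt_snd)
  let one' : curveInterval := ⟨1, by norm_num⟩
  let u : ℝ × Q → ℝ → E := fun z s => IccExtend (by norm_num) (G (ρ z)) s
  have hu : ∀ z (s : curveInterval), u z s = G (ρ z) s := fun z s => IccExtend_val _ _ s
  refine ⟨fun z s => κ.symm (u z s), ?_, ?_⟩
  · have h1 : ContMDiffAt (𝓘(ℝ, ℝ).prod I) 𝓘(ℝ, E) n (fun z => u z 1) (0, q₀) := by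
      have h2 : ContDiffAt ℝ n (fun q => G q one') (0, κ q₀) :=
        (ContinuousMap.evalCLM ℝ one' : C(curveInterval, E) →L[ℝ] E).contDiff.contDiffAt.comp _ hG
      have h3 := h2.contMDiffAt.comp ((0 : ℝ), q₀) hρ
      exact h3.congr_of_eventuallyEq (Filter.Eventually.of_forall fun z => hu z one')
    have h2 : u (0, q₀) 1 = κ q₀ := by
      rw [show (1 : ℝ) = (one' : ℝ) from rfl, hu]
      change G (0, κ q₀) one' = κ q₀
      rw [hG0]; rfl
    have h3 : ContMDiffAt 𝓘(ℝ, E) I n κ.symm (u (0, q₀) 1) := by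
      rw [h2]
      exact (contMDiffAt_extChartAt_symm hmem).of_le (by exact_mod_cast le_top)
    exact h3.comp ((0 : ℝ), q₀) h1
  · have hsrc : ∀ᶠ z : ℝ × Q in 𝓝 (0, q₀), z.2 ∈ κ.source :=
      continuousAt_snd (extChartAt_source_mem_nhds (I := I) q₀)
    have hρc : Filter.Tendsto ρ (𝓝 (0, q₀)) (𝓝 (0, κ q₀)) := hρ.continuousAt
    have hclose : ∀ᶠ q in 𝓝 ((0 : ℝ), κ q₀), dist (G q) (ContinuousMap.const _ (κ q₀)) < r := by
      have := hG.continuousAt (Metric.ball_mem_nhds _ hr)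
      rw [hG0] at this
      exact this
    filter_upwards [hsrc, hρc.eventually hGe, hρc.eventually hclose] with z hz hint hdist
    have hin : ∀ s : ℝ, u z s ∈ Metric.ball (κ q₀) r := fun s =>
      (ContinuousMap.dist_apply_le_dist _).trans_lt hdist
    have hc : Continuous (u z) := (G (ρ z)).continuous.Icc_extend'
    have hint' : ∀ s ∈ Icc (-2 : ℝ) 2, u z s = κ z.2 + z.1 • ∫ σ in (0 : ℝ)..s, f (u z σ) :=
      fun s hs => by rw [show s = ((⟨s, hs⟩ : curveInterval) : ℝ) from rfl, hu]; exact hint ⟨s, hs⟩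
    refine ⟨?_, fun s hs => ?_⟩
    · rw [hint' 0 (by norm_num), intervalIntegral.integral_same, smul_zero, add_zero]
      exact κ.left_inv hz
    · obtain ⟨hfs, hts⟩ := hball _ (hin s)
      refine hasMFDerivAt_symm_comp_of_hasDerivAt hts ?_
      rw [← hfs]
      have hfc : Continuous fun σ => f (u z σ) := hf.continuous.comp hc
      have h1 : HasDerivAt (fun s => κ z.2 + z.1 • ∫ σ in (0 : ℝ)..s, f (u z σ))
          (z.1 • f (u z s)) s :=
        ((intervalIntegral.integral_hasDerivAt_right (hfc.intervalIntegrable _ _)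
          (hfc.stronglyMeasurableAtFilter _ _) hfc.continuousAt).const_smul z.1).const_add _
      refine h1.congr_of_eventuallyEq ?_
      filter_upwards [Ioo_mem_nhds hs.1 hs.2] with τ hτ
      exact hint' τ ⟨hτ.1.le, hτ.2.le⟩

omit [FiniteDimensional ℝ E] [I.Boundaryless] in
theorem contMDiff_one_of_infty
    (hX : ContMDiff I I.tangent ∞ (fun q => (⟨q, X q⟩ : TangentBundle I Q))) :
    ContMDiff I I.tangent 1 (fun q => (⟨q, X q⟩ : TangentBundle I Q)) := hX.of_le (by simp)

omit [FiniteDimensional ℝ E] [I.Boundaryless] [IsManifold I ∞ Q] in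
theorem hasMFDerivAt_comp_mul {γ : ℝ → Q} {c s : ℝ} {v : TangentSpace I (γ (c * s))}
    (h : HasMFDerivAt 𝓘(ℝ, ℝ) I γ (c * s) ((1 : ℝ →L[ℝ] ℝ).smulRight v)) :
    HasMFDerivAt 𝓘(ℝ, ℝ) I (fun τ => γ (c * τ)) s ((1 : ℝ →L[ℝ] ℝ).smulRight (c • v)) := by
  have h1 : HasDerivAt (fun τ : ℝ => c * τ) c s := by
    simpa using (hasDerivAt_id s).const_mul c
  refine (h.comp s h1.hasFDerivAt.hasMFDerivAt).congr_mfderiv ?_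
  ext
  change ((1 : ℝ) * c) • v = (1 : ℝ) • (c • v)
  rw [one_mul, one_smul]

/-- Integral curves exist for a uniform time near each point. -/
theorem exists_uniform_time
    (hX : ContMDiff I I.tangent ∞ (fun q => (⟨q, X q⟩ : TangentBundle I Q))) (q₀ : Q) :
    ∃ ε > 0, ∀ᶠ q in 𝓝 q₀, ∃ γ : ℝ → Q, γ 0 = q ∧ ∀ s ∈ Ioo (-ε) ε,
      HasMFDerivAt 𝓘(ℝ, ℝ) I γ s ((1 : ℝ →L[ℝ] ℝ).smulRight (X (γ s))) := by
  obtain ⟨Γ, -, hΓ⟩ := exists_local_flow hX q₀ 0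
  rw [nhds_prod_eq] at hΓ
  obtain ⟨pa, hpa, pb, hpb, hab⟩ := Filter.eventually_prod_iff.1 hΓ
  obtain ⟨δ, hδ, hball⟩ := Metric.eventually_nhds_iff.1 hpa
  have ht : pa (δ / 2) := hball (by rw [dist_zero_right, Real.norm_eq_abs, abs_of_pos] <;> linarith)
  refine ⟨δ, hδ, hpb.mono fun q hq => ?_⟩
  obtain ⟨h0, h1⟩ := hab ht hq
  refine ⟨fun τ => Γ (δ / 2, q) ((δ / 2)⁻¹ * τ), by simpa using h0, fun s hs => ?_⟩
  have h2 : (δ / 2)⁻¹ * s ∈ Ioo (-2 : ℝ) 2 := by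
    have hp : (0 : ℝ) < δ / 2 := by positivity
    constructor
    · rw [inv_mul_eq_div, lt_div_iff₀ hp]; linarith [hs.1]
    · rw [inv_mul_eq_div, div_lt_iff₀ hp]; linarith [hs.2]
  have h3 := hasMFDerivAt_comp_mul (c := (δ / 2)⁻¹) (h1 _ h2)
  have hd : (δ / 2) ≠ 0 := by positivity
  rw [smul_smul, inv_mul_cancel₀ hd, one_smul] at h3
  exact h3

variable [T2Space Q]

omit [FiniteDimensional ℝ E] in
/-- The group law of a global flow. -/
theorem flow_add (hX : ContMDiff I I.tangent ∞ (fun q => (⟨q, X q⟩ : TangentBundle I Q)))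
    {Φ : ℝ → Q → Q} (h0 : ∀ q, Φ 0 q = q)
    (hΦ : ∀ q, IsMIntegralCurve (I := I) (fun t => Φ t q) X) (s t : ℝ) (q : Q) :
    Φ (t + s) q = Φ t (Φ s q) := by
  have : IsManifold I 1 Q := IsManifold.of_le (n := ∞) (by simp)
  have h := isMIntegralCurve_Ioo_eq_of_contMDiff_boundaryless (t₀ := 0)
    (contMDiff_one_of_infty hX) ((hΦ q).comp_add s) (hΦ (Φ s q)) (by simp [h0])
  exact congrFun h t

/-- The flow of a complete smooth vector field is jointly smooth in time and initial point. -/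
theorem contMDiff_flow (hX : ContMDiff I I.tangent ∞ (fun q => (⟨q, X q⟩ : TangentBundle I Q)))
    {Φ : ℝ → Q → Q} (h0 : ∀ q, Φ 0 q = q)
    (hΦ : ∀ q, IsMIntegralCurve (I := I) (fun t => Φ t q) X) :
    ContMDiff (𝓘(ℝ, ℝ).prod I) I ∞ (fun z : ℝ × Q => Φ z.1 z.2) := by
  have : IsManifold I 1 Q := IsManifold.of_le (n := ∞) (by simp)
  rw [contMDiff_infty]
  intro n
  -- near time zero the flow is the rescaled local flow
  have hloc : ∀ q, ContMDiffAt (𝓘(ℝ, ℝ).prod I) I n (fun z : ℝ × Q => Φ z.1 z.2) (0, q) := by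
    intro q
    obtain ⟨Γ, hΓ, hΓe⟩ := exists_local_flow hX q n
    refine hΓ.congr_of_eventuallyEq (hΓe.mono fun z hz => ?_)
    have hX' : ContMDiff I I.tangent 1 (fun q => (⟨q, z.1 • X q⟩ : TangentBundle I Q)) :=
      (contMDiff_one_of_infty hX).const_smul_section
    have := isMIntegralCurveOn_Ioo_eqOn_of_contMDiff_boundaryless (I := I) (a := -2) (b := 2)
      (t₀ := 0) (by norm_num) hX' (γ := fun s => Φ (z.1 * s) z.2) (γ' := Γ z)
      (fun s _ => (hasMFDerivAt_comp_mul (hΦ z.2 (z.1 * s))).hasMFDerivWithinAt)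
      (fun s hs => (hz.2 s hs).hasMFDerivWithinAt) (by simp [h0, hz.1])
    simpa using this (show (1 : ℝ) ∈ Ioo (-2 : ℝ) 2 by norm_num)
  have hloc' : ∀ q, ∀ᶠ z in 𝓝 ((0 : ℝ), q),
      ContMDiffAt (𝓘(ℝ, ℝ).prod I) I n (fun z : ℝ × Q => Φ z.1 z.2) z := fun q =>
    (contMDiffAt_iff_contMDiffAt_nhds (by exact_mod_cast WithTop.coe_ne_top)).1 (hloc q)
  rintro ⟨T, q⟩
  -- the set of good times is locally constant along the orbit of `q`
  have hstep : ∀ t₀ : ℝ, ∃ U ∈ 𝓝 t₀, ∀ t ∈ U, ∀ s ∈ U,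
      ContMDiffAt (𝓘(ℝ, ℝ).prod I) I n (fun z : ℝ × Q => Φ z.1 z.2) (s, q) →
      ContMDiffAt (𝓘(ℝ, ℝ).prod I) I n (fun z : ℝ × Q => Φ z.1 z.2) (t, q) := by
    intro t₀
    have hcont : Filter.Tendsto (fun p : ℝ × ℝ => (p.1 - p.2, Φ p.2 q)) (𝓝 (t₀, t₀))
        (𝓝 ((0 : ℝ), Φ t₀ q)) := by
      have hc := ((hΦ q).continuous.continuousAt (x := t₀))
      have h1 : Filter.Tendsto (fun p : ℝ × ℝ => p.1 - p.2) (𝓝 (t₀, t₀)) (𝓝 (0 : ℝ)) := by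
        have : ContinuousAt (fun p : ℝ × ℝ => p.1 - p.2) (t₀, t₀) := by fun_prop
        simpa [ContinuousAt] using this
      exact h1.prodMk_nhds (hc.tendsto.comp (continuousAt_snd (p := (t₀, t₀))))
    have h2 := (hcont.eventually (hloc' (Φ t₀ q)))
    rw [nhds_prod_eq] at h2
    obtain ⟨U, hU, h3⟩ := (Filter.eventually_prod_self_iff (r := fun t s => ContMDiffAt (𝓘(ℝ, ℝ).prod I) I n
      (fun z : ℝ × Q => Φ z.1 z.2) (t - s, Φ s q))).1 h2
    refine ⟨U, hU, fun t ht s hs' hgood => ?_⟩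
    have hs := h3 t ht s hs'
    have hslice : ContMDiffAt (𝓘(ℝ, ℝ).prod I) I n (fun z : ℝ × Q => Φ s z.2) (t, q) :=
      hgood.comp (t, q) (f := fun z : ℝ × Q => (s, z.2)) (contMDiffAt_const.prodMk contMDiffAt_snd)
    have hpair : ContMDiffAt (𝓘(ℝ, ℝ).prod I) (𝓘(ℝ, ℝ).prod I) n
        (fun z : ℝ × Q => (z.1 - s, Φ s z.2)) (t, q) :=
      (contMDiffAt_fst.sub contMDiffAt_const).prodMk hslice
    refine (ContMDiffAt.comp (t, q) (g := fun z : ℝ × Q => Φ z.1 z.2) hs hpair).congr_of_eventuallyEq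
      (Filter.Eventually.of_forall fun z => ?_)
    simp only [Function.comp]
    rw [← flow_add hX h0 hΦ, sub_add_cancel]
  have hopen : IsClopen {t : ℝ |
      ContMDiffAt (𝓘(ℝ, ℝ).prod I) I n (fun z : ℝ × Q => Φ z.1 z.2) (t, q)} := by
    refine ⟨⟨isOpen_iff_mem_nhds.2 fun t₀ ht₀ => ?_⟩, isOpen_iff_mem_nhds.2 fun t₀ ht₀ => ?_⟩
    · obtain ⟨U, hU, h⟩ := hstep t₀
      filter_upwards [hU] with t ht hgood
      exact ht₀ (h t₀ (mem_of_mem_nhds hU) t ht hgood)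
    · obtain ⟨U, hU, h⟩ := hstep t₀
      filter_upwards [hU] with t ht
      exact h t ht t₀ (mem_of_mem_nhds hU) ht₀
  have := hopen.eq_univ ⟨0, hloc q⟩
  exact (Set.ext_iff.1 this T).2 (mem_univ T)

end Flows

/-! ### Time-dependent vector fields -/

section TimeDependent

open Set

variable {E : Type*} [NormedAddCommGroup E] [NormedSpace ℝ E]
  {H : Type*} [TopologicalSpace H] {I : ModelWithCorners ℝ E H}
  {M : Type*} [TopologicalSpace M] [ChartedSpace H M]

/-- `c` solves the non-autonomous equation `c' t = X t (c t)` at the times `t ∈ s`. -/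
def IsTimeCurveOn (X : ℝ → ∀ p : M, TangentSpace I p) (c : ℝ → M) (s : Set ℝ) : Prop :=
  ∀ t ∈ s, HasMFDerivAt 𝓘(ℝ, ℝ) I c t ((1 : ℝ →L[ℝ] ℝ).smulRight (X t (c t)))

theorem IsTimeCurveOn.mono {X : ℝ → ∀ p : M, TangentSpace I p} {c : ℝ → M} {s s' : Set ℝ}
    (h : IsTimeCurveOn X c s) (hs : s' ⊆ s) : IsTimeCurveOn X c s' := fun t ht => h t (hs ht)

/-- The autonomous vector field `(∂ₜ, X)` on `ℝ × M`. -/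
def suspension (X : ℝ → ∀ p : M, TangentSpace I p) (q : ℝ × M) :
    TangentSpace (𝓘(ℝ, ℝ).prod I) q := ((1 : ℝ), X q.1 q.2)

theorem contMDiff_suspension [IsManifold I ∞ M] {X : ℝ → ∀ p : M, TangentSpace I p}
    (hX : ContMDiff (𝓘(ℝ, ℝ).prod I) I.tangent ∞
      (fun q : ℝ × M => (⟨q.2, X q.1 q.2⟩ : TangentBundle I M))) :
    ContMDiff (𝓘(ℝ, ℝ).prod I) (𝓘(ℝ, ℝ).prod I).tangent ∞
      (fun q => (⟨q, suspension X q⟩ : TangentBundle (𝓘(ℝ, ℝ).prod I) (ℝ × M))) := by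
  have : IsManifold I 1 M := IsManifold.of_le (n := ∞) (by simp)
  have h1 : ContMDiff 𝓘(ℝ, ℝ) 𝓘(ℝ, ℝ).tangent ∞
      (fun t : ℝ => (⟨t, (1 : ℝ)⟩ : TangentBundle 𝓘(ℝ, ℝ) ℝ)) := by
    intro t
    refine (Bundle.contMDiffAt_section (IB := 𝓘(ℝ, ℝ)) (F := ℝ) (E := TangentSpace 𝓘(ℝ, ℝ))
      (s := fun _ => (1 : ℝ)) t).2 ?_
    exact (contMDiffAt_const (c := (1 : ℝ))).congr_of_eventuallyEq
      (Filter.Eventually.of_forall fun x =>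
        congrArg Prod.snd (trivializationAt_model_space_apply (I := 𝓘(ℝ, ℝ)) ⟨x, (1 : ℝ)⟩ t))
  exact (contMDiff_equivTangentBundleProd_symm (I := 𝓘(ℝ, ℝ)) (M := ℝ) (I' := I) (M' := M)).comp
    ((h1.comp contMDiff_fst).prodMk hX)

theorem hasMFDerivAt_shift {c : ℝ → M} {t a : ℝ} {v : TangentSpace I (c (t + a))}
    (h : HasMFDerivAt 𝓘(ℝ, ℝ) I c (t + a) ((1 : ℝ →L[ℝ] ℝ).smulRight v)) :
    HasMFDerivAt 𝓘(ℝ, ℝ) I (fun τ => c (τ + a)) t ((1 : ℝ →L[ℝ] ℝ).smulRight v) := by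
  have h1 : HasDerivAt (fun τ : ℝ => τ + a) 1 t := (hasDerivAt_id t).add_const a
  refine (h.comp t h1.hasFDerivAt.hasMFDerivAt).congr_mfderiv ?_
  ext
  change ((1 : ℝ) * 1) • v = (1 : ℝ) • v
  rw [one_mul]

theorem hasMFDerivAt_graph {X : ℝ → ∀ p : M, TangentSpace I p} {c : ℝ → M} {t : ℝ}
    (h : HasMFDerivAt 𝓘(ℝ, ℝ) I c t ((1 : ℝ →L[ℝ] ℝ).smulRight (X t (c t)))) :
    HasMFDerivAt 𝓘(ℝ, ℝ) (𝓘(ℝ, ℝ).prod I) (fun τ => (τ, c τ)) t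
      ((1 : ℝ →L[ℝ] ℝ).smulRight (suspension X (t, c t))) := by
  refine ((hasMFDerivAt_id t).prodMk h).congr_mfderiv ?_
  refine ContinuousLinearMap.ext_ring ?_
  change (((1 : ℝ), (1 : ℝ) • (X t (c t) : E)) : ℝ × E) =
    (1 : ℝ) • (((1 : ℝ), (X t (c t) : E)) : ℝ × E)
  rw [one_smul, one_smul]

/-- An integral curve of the suspension has constant speed one in the time direction. -/
theorem suspension_curve {X : ℝ → ∀ p : M, TangentSpace I p} {γ : ℝ → ℝ × M} {a : ℝ} (ha : 0 < a)
    (h : ∀ t ∈ Ioo (-a) a, HasMFDerivAt 𝓘(ℝ, ℝ) (𝓘(ℝ, ℝ).prod I) γ t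
      ((1 : ℝ →L[ℝ] ℝ).smulRight (suspension X (γ t)))) :
    (∀ t ∈ Ioo (-a) a, (γ t).1 = (γ 0).1 + t) ∧
    IsTimeCurveOn X (fun t => (γ (t - (γ 0).1)).2) (Ioo ((γ 0).1 - a) ((γ 0).1 + a)) := by
  have h1 : ∀ t ∈ Ioo (-a) a, HasDerivAt (fun t => (γ t).1) 1 t := by
    intro t ht
    have := (hasMFDerivAt_fst (I := 𝓘(ℝ, ℝ)) (I' := I) (γ t)).comp t (h t ht)
    have h2 : HasFDerivAt (fun t => (γ t).1) ((1 : ℝ →L[ℝ] ℝ).smulRight (1 : ℝ)) t :=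
      (this.congr_mfderiv (by
        ext
        change (1 : ℝ) * (1 : ℝ) = (1 : ℝ) * 1
        rfl)).hasFDerivAt
    simpa using h2.hasDerivAt
  have h2 : ∀ t ∈ Ioo (-a) a, (γ t).1 = (γ 0).1 + t := by
    have := isOpen_Ioo.eqOn_of_deriv_eq (s := Ioo (-a) a) (f := fun t => (γ t).1)
      (g := fun t => (γ 0).1 + t) (x := 0) isPreconnected_Ioo
      (fun t ht => (h1 t ht).differentiableAt.differentiableWithinAt)
      (fun t _ => by fun_prop)
      (fun t ht => by
        rw [(h1 t ht).deriv]
        simp) ⟨by linarith, ha⟩ (by simp)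
    exact this
  refine ⟨h2, fun t ht => ?_⟩
  have ht' : t - (γ 0).1 ∈ Ioo (-a) a := ⟨by linarith [ht.1], by linarith [ht.2]⟩
  have h3 := (hasMFDerivAt_snd (I := 𝓘(ℝ, ℝ)) (I' := I) (γ (t - (γ 0).1))).comp _ (h _ ht')
  have h5 : (γ (t - (γ 0).1)).1 = t := by rw [h2 _ ht']; ring
  have h4 : HasMFDerivAt 𝓘(ℝ, ℝ) I (fun τ => (γ τ).2) (t - (γ 0).1)
      ((1 : ℝ →L[ℝ] ℝ).smulRight (X t (γ (t - (γ 0).1)).2)) := by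
    refine h3.congr_mfderiv ?_
    ext
    change (1 : ℝ) • (X (γ (t - (γ 0).1)).1 (γ (t - (γ 0).1)).2) =
      (1 : ℝ) • (X t (γ (t - (γ 0).1)).2)
    rw [h5]
  exact hasMFDerivAt_shift (c := fun τ => (γ τ).2) (a := -(γ 0).1) h4

variable [FiniteDimensional ℝ E] [I.Boundaryless] [IsManifold I ∞ M]
  {X : ℝ → ∀ p : M, TangentSpace I p}
  (hX : ContMDiff (𝓘(ℝ, ℝ).prod I) I.tangent ∞
      (fun q : ℝ × M => (⟨q.2, X q.1 q.2⟩ : TangentBundle I M)))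

include hX

theorem IsTimeCurveOn.eventuallyEq {c c' : ℝ → M} {s : Set ℝ} {t₀ : ℝ} (hs : s ∈ 𝓝 t₀)
    (hc : IsTimeCurveOn X c s) (hc' : IsTimeCurveOn X c' s) (h : c t₀ = c' t₀) :
    c =ᶠ[𝓝 t₀] c' := by
  have : IsManifold (𝓘(ℝ, ℝ).prod I) 1 (ℝ × M) := IsManifold.of_le (n := ∞) (by simp)
  have := isMIntegralCurveAt_eventuallyEq_of_contMDiffAt_boundaryless
    (γ := fun τ => (τ, c τ)) (γ' := fun τ => (τ, c' τ)) (t₀ := t₀)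
    (contMDiff_one_of_infty (contMDiff_suspension hX)).contMDiffAt
    (Filter.eventually_of_mem hs fun t ht => hasMFDerivAt_graph (hc t ht))
    (Filter.eventually_of_mem hs fun t ht => hasMFDerivAt_graph (hc' t ht)) (by rw [h])
  exact this.mono fun t ht => congrArg Prod.snd ht

variable [T2Space M]

theorem IsTimeCurveOn.eqOn_Ioo {c c' : ℝ → M} {a b t₀ : ℝ} (ht₀ : t₀ ∈ Ioo a b)
    (hc : IsTimeCurveOn X c (Ioo a b)) (hc' : IsTimeCurveOn X c' (Ioo a b)) (h : c t₀ = c' t₀) :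
    EqOn c c' (Ioo a b) := by
  have : IsManifold (𝓘(ℝ, ℝ).prod I) 1 (ℝ × M) := IsManifold.of_le (n := ∞) (by simp)
  have := isMIntegralCurveOn_Ioo_eqOn_of_contMDiff_boundaryless
    (γ := fun τ => (τ, c τ)) (γ' := fun τ => (τ, c' τ)) ht₀
    (contMDiff_one_of_infty (contMDiff_suspension hX))
    (fun t ht => (hasMFDerivAt_graph (hc t ht)).hasMFDerivWithinAt)
    (fun t ht => (hasMFDerivAt_graph (hc' t ht)).hasMFDerivWithinAt) (by rw [h])
  exact fun t ht => congrArg Prod.snd (this ht)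

theorem IsTimeCurveOn.eq_univ {c c' : ℝ → M} {t₀ : ℝ}
    (hc : IsTimeCurveOn X c univ) (hc' : IsTimeCurveOn X c' univ) (h : c t₀ = c' t₀) : c = c' := by
  ext t
  exact IsTimeCurveOn.eqOn_Ioo hX (a := min t t₀ - 1) (b := max t t₀ + 1) (t₀ := t₀)
    ⟨by linarith [min_le_right t t₀], by linarith [le_max_right t t₀]⟩ (hc.mono (subset_univ _))
    (hc'.mono (subset_univ _)) h
    ⟨by linarith [min_le_left t t₀], by linarith [le_max_left t t₀]⟩

/-- A smooth time-dependent vector field whose solutions exist for a uniform time has a smooth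
evolution family: `Θ s t p` is the value at time `t` of the solution that is at `p` at time `s`. -/
theorem exists_evolution {ε : ℝ} (hε : 0 < ε)
    (hex : ∀ s p, ∃ c : ℝ → M, c s = p ∧ IsTimeCurveOn X c (Ioo (s - ε) (s + ε))) :
    ∃ Θ : ℝ → ℝ → M → M,
      ContMDiff (𝓘(ℝ, ℝ).prod (𝓘(ℝ, ℝ).prod I)) I ∞
        (fun z : ℝ × ℝ × M => Θ z.1 z.2.1 z.2.2) ∧
      (∀ s p, Θ s s p = p) ∧ ∀ s p, IsTimeCurveOn X (fun t => Θ s t p) univ := by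
  have hman : IsManifold (𝓘(ℝ, ℝ).prod I) 1 (ℝ × M) := IsManifold.of_le (n := ∞) (by simp)
  have hY := contMDiff_suspension hX
  have hglob := exists_isMIntegralCurve_of_isMIntegralCurveOn (contMDiff_one_of_infty hY) hε
    (fun q => by
      obtain ⟨c, hc, hcurve⟩ := hex q.1 q.2
      refine ⟨fun t => (t + q.1, c (t + q.1)), by simp [hc], fun t ht => ?_⟩
      have h1 := hasMFDerivAt_graph (hcurve (t + q.1) ⟨by linarith [ht.1], by linarith [ht.2]⟩)
      exact (hasMFDerivAt_shift (c := fun τ => (τ, c τ)) h1).hasMFDerivWithinAt)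
  choose Ψ hΨ0 hΨ using hglob
  have hsm := contMDiff_flow (Φ := fun t q => Ψ q t) hY hΨ0 hΨ
  refine ⟨fun s t p => (Ψ (s, p) (t - s)).2, ?_, fun s p => ?_, fun s p t _ => ?_⟩
  · have h1 : ContMDiff (𝓘(ℝ, ℝ).prod (𝓘(ℝ, ℝ).prod I)) (𝓘(ℝ, ℝ).prod (𝓘(ℝ, ℝ).prod I)) ∞
        (fun z : ℝ × ℝ × M => (z.2.1 - z.1, (z.1, z.2.2))) :=
      ((contMDiff_fst.comp contMDiff_snd).sub contMDiff_fst).prodMk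
        (contMDiff_fst.prodMk (contMDiff_snd.comp contMDiff_snd))
    exact contMDiff_snd.comp (hsm.comp h1)
  · simp [hΨ0]
  · have h2 := (suspension_curve (X := X) (γ := Ψ (s, p)) (a := |t - s| + 1) (by positivity)
      (fun τ _ => hΨ (s, p) τ)).2
    rw [hΨ0] at h2
    refine h2 t ⟨?_, ?_⟩
    · linarith [neg_abs_le (t - s)]
    · linarith [le_abs_self (t - s)]

/-- A time-periodic field that agrees with a complete autonomous field `R` outside a compact set
has solutions for a uniform time: a solution of `R` that starts outside the orbit `ψ_[-1,1](K)`
does not meet `K` within time one. -/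
theorem exists_uniform_time_of_eq_off_compact
    (hper : ∀ t p, X (t + 1) p = X t p) {R : ∀ p : M, TangentSpace I p} {ψ : ℝ → M → M}
    (hR : ContMDiff I I.tangent ∞ (fun p => (⟨p, R p⟩ : TangentBundle I M)))
    (hψ0 : ∀ p, ψ 0 p = p) (hψ : ∀ p, IsMIntegralCurve (I := I) (fun t => ψ t p) R)
    {K : Set M} (hK : IsCompact K) (hXR : ∀ t, ∀ p ∉ K, X t p = R p) :
    ∃ ε > 0, ∀ s p, ∃ c : ℝ → M, c s = p ∧ IsTimeCurveOn X c (Ioo (s - ε) (s + ε)) := by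
  have hψc : Continuous (fun z : ℝ × M => ψ z.1 z.2) := (contMDiff_flow hR hψ0 hψ).continuous
  have hgroup := flow_add hR hψ0 hψ
  set K' : Set M := (fun z : ℝ × M => ψ z.1 z.2) '' (Icc (-1) 1 ×ˢ K) with hK'
  have hK'c : IsCompact K' := (isCompact_Icc.prod hK).image hψc
  have hY := contMDiff_suspension hX
  obtain ⟨ε₀, hε₀, hu⟩ : ∃ ε > 0, ∀ q ∈ Icc (0 : ℝ) 1 ×ˢ K', ∃ γ : ℝ → ℝ × M, γ 0 = q ∧
      ∀ s ∈ Ioo (-ε) ε, HasMFDerivAt 𝓘(ℝ, ℝ) (𝓘(ℝ, ℝ).prod I) γ s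
        ((1 : ℝ →L[ℝ] ℝ).smulRight (suspension X (γ s))) := by
    refine (isCompact_Icc.prod hK'c).induction_on (p := fun S => ∃ ε > 0, ∀ q ∈ S,
      ∃ γ : ℝ → ℝ × M, γ 0 = q ∧ ∀ s ∈ Ioo (-ε) ε, HasMFDerivAt 𝓘(ℝ, ℝ) (𝓘(ℝ, ℝ).prod I) γ s
        ((1 : ℝ →L[ℝ] ℝ).smulRight (suspension X (γ s)))) ⟨1, one_pos, by simp⟩ ?_ ?_ ?_
    · rintro S T hST ⟨ε, hε, h⟩
      exact ⟨ε, hε, fun q hq => h q (hST hq)⟩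
    · rintro S T ⟨ε, hε, h⟩ ⟨ε', hε', h'⟩
      refine ⟨min ε ε', lt_min hε hε', fun q hq => ?_⟩
      rcases hq with hq | hq
      · obtain ⟨γ, h0, h1⟩ := h q hq
        exact ⟨γ, h0, fun s hs => h1 s
          ⟨by linarith [hs.1, min_le_left ε ε'], by linarith [hs.2, min_le_left ε ε']⟩⟩
      · obtain ⟨γ, h0, h1⟩ := h' q hq
        exact ⟨γ, h0, fun s hs => h1 s
          ⟨by linarith [hs.1, min_le_right ε ε'], by linarith [hs.2, min_le_right ε ε']⟩⟩
    · intro q _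
      obtain ⟨ε, hε, h⟩ := exists_uniform_time hY q
      exact ⟨_, mem_nhdsWithin_of_mem_nhds h, ε, hε, fun q hq => hq⟩
  have hperZ : ∀ (k : ℤ) t p, X (t + k) p = X t p := by
    intro k
    induction k using Int.induction_on with
    | zero => simp
    | succ k ih => intro t p; push_cast; rw [← add_assoc, hper]; exact_mod_cast ih t p
    | pred k ih =>
      intro t p
      rw [← hper]; push_cast
      rw [show t + (-(k : ℝ) - 1) + 1 = t + ((-(k : ℤ) : ℤ) : ℝ) by push_cast; ring]
      exact ih t p
  refine ⟨min ε₀ 1, lt_min hε₀ one_pos, fun s p => ?_⟩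
  by_cases hp : p ∈ K'
  · obtain ⟨γ, h0, h1⟩ := hu (Int.fract s, p)
      ⟨⟨Int.fract_nonneg s, (Int.fract_lt_one s).le⟩, hp⟩
    have h2 := (suspension_curve hε₀ h1).2
    rw [h0] at h2
    refine ⟨fun t => (γ (t + -(⌊s⌋ : ℝ) - Int.fract s)).2, ?_, fun t ht => ?_⟩
    · have : s + -(⌊s⌋ : ℝ) - Int.fract s = 0 := by rw [← Int.self_sub_floor]; ring
      simp only [this, h0]
    · have h3 := h2 (t + -(⌊s⌋ : ℝ)) (by
        have := Int.fract_add_floor s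
        constructor
        · linarith [ht.1, min_le_left ε₀ 1]
        · linarith [ht.2, min_le_left ε₀ 1])
      have h5 : ∀ q : M, X (t + -(⌊s⌋ : ℝ)) q = X t q := fun q => by
        rw [← hperZ ⌊s⌋, neg_add_cancel_right]
      rw [h5] at h3
      exact hasMFDerivAt_shift h3
  · refine ⟨fun t => ψ (t + -s) p, by simp [hψ0], fun t ht => ?_⟩
    have h1 := hasMFDerivAt_shift (hψ p (t + -s))
    have h2 : ψ (t + -s) p ∉ K := fun hmem => hp
      ⟨(-(t + -s), ψ (t + -s) p), ⟨⟨by linarith [ht.2, min_le_right ε₀ 1],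
        by linarith [ht.1, min_le_right ε₀ 1]⟩, hmem⟩, by
          change ψ (-(t + -s)) (ψ (t + -s) p) = p
          rw [← hgroup, neg_add_cancel, hψ0]⟩
    rw [hXR t _ h2]
    exact h1

end TimeDependent

/-! ### Pull-backs and exterior derivatives of one-forms -/

section Pullback

open Set

variable {m : ℕ} {M : Type*} [TopologicalSpace M] [ChartedSpace (EuclideanSpace ℝ (Fin m)) M]
  {W : Type*} [NormedAddCommGroup W] [NormedSpace ℝ W]

/-- The pull-back of a one-form by a map from a normed space, as a map into the dual space. -/
def OneForm.pull (α : OneForm m M) (F : W → M) (z : W) : W →L[ℝ] ℝ :=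
  (α (F z)).comp (mfderiv 𝓘(ℝ, W) (𝓡 m) F z)

theorem OneForm.pull_apply (α : OneForm m M) (F : W → M) (z a : W) :
    α.pull F z a = α (F z) (mfderiv 𝓘(ℝ, W) (𝓡 m) F z a) := rfl

/-- The exterior derivative of one-forms on a normed space commutes with pull-back: the second
derivatives of the map cancel by symmetry. -/
theorem fderiv_pullback_antisymm {E : Type*} [NormedAddCommGroup E] [NormedSpace ℝ E]
    {F : W → E} {z : W} (hF : ContDiffAt ℝ 2 F z) {β : E → E →L[ℝ] ℝ}
    (hβ : DifferentiableAt ℝ β (F z)) (a b : W) :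
    fderiv ℝ (fun z => (β (F z)).comp (fderiv ℝ F z)) z a b -
      fderiv ℝ (fun z => (β (F z)).comp (fderiv ℝ F z)) z b a =
    fderiv ℝ β (F z) (fderiv ℝ F z a) (fderiv ℝ F z b) -
      fderiv ℝ β (F z) (fderiv ℝ F z b) (fderiv ℝ F z a) := by
  have h1 : HasFDerivAt (fun z => β (F z)) ((fderiv ℝ β (F z)).comp (fderiv ℝ F z)) z :=
    hβ.hasFDerivAt.comp z (hF.differentiableAt (by norm_num)).hasFDerivAt
  have h2 : HasFDerivAt (fderiv ℝ F) (fderiv ℝ (fderiv ℝ F) z) z :=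
    ((hF.fderiv_right (m := 1) (by norm_num)).differentiableAt (by norm_num)).hasFDerivAt
  have h3 := (h1.clm_comp h2).fderiv
  rw [h3]
  have hs : fderiv ℝ (fderiv ℝ F) z a b = fderiv ℝ (fderiv ℝ F) z b a :=
    (hF.isSymmSndFDerivAt (by simp)) a b
  simp [hs]

variable [IsManifold (𝓡 m) ∞ M]

theorem OneForm.IsSmooth.contDiffOn_inChart {α : OneForm m M} (hα : α.IsSmooth) (p₀ : M) :
    ContDiffOn ℝ ∞ (α.inChart p₀) (extChartAt (𝓡 m) p₀).target := by
  set e := trivializationAt (EuclideanSpace ℝ (Fin m) →L[ℝ] ℝ)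
    (fun q : M => TangentSpace (𝓡 m) q →L[ℝ] Bundle.Trivial M ℝ q) p₀ with he
  have h1 := (e.contMDiffOn_section_baseSet_iff (IB := 𝓡 m) (n := ∞) (s := α)).1 hα.contMDiffOn
  have hbase : ∀ q ∈ (extChartAt (𝓡 m) p₀).source, q ∈ e.baseSet := by
    intro q hq
    rw [he, hom_trivializationAt_baseSet]
    simpa using hq
  have h2 : ContMDiffOn 𝓘(ℝ, EuclideanSpace ℝ (Fin m)) 𝓘(ℝ, EuclideanSpace ℝ (Fin m) →L[ℝ] ℝ) ∞
      (fun y => (e ⟨(extChartAt (𝓡 m) p₀).symm y, α ((extChartAt (𝓡 m) p₀).symm y)⟩).2)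
      (extChartAt (𝓡 m) p₀).target :=
    h1.comp (contMDiffOn_extChartAt_symm p₀) fun y hy =>
      hbase _ ((extChartAt (𝓡 m) p₀).map_target hy)
  refine (contMDiffOn_iff_contDiffOn.1 h2).congr fun y hy => ?_
  have hs : (extChartAt (𝓡 m) p₀).symm y ∈ (chartAt (EuclideanSpace ℝ (Fin m)) p₀).source := by
    simpa using (extChartAt (𝓡 m) p₀).map_target hy
  have h3 := TangentBundle.symmL_trivializationAt (I := 𝓡 m) hs
  rw [(𝓡 m).range_eq_univ, mfderivWithin_univ, (extChartAt (𝓡 m) p₀).right_inv hy] at h3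
  rw [he, hom_trivializationAt_apply]
  ext v
  have h4 := DFunLike.congr_fun h3 v
  change α _ (mfderiv 𝓘(ℝ, EuclideanSpace ℝ (Fin m)) (𝓡 m) (extChartAt (𝓡 m) p₀).symm y v) =
    (trivializationAt ℝ (Bundle.Trivial M ℝ) p₀).continuousLinearMapAt ℝ
      ((extChartAt (𝓡 m) p₀).symm y)
      (α _ ((trivializationAt (EuclideanSpace ℝ (Fin m)) (TangentSpace (𝓡 m)) p₀).symmL ℝ
        ((extChartAt (𝓡 m) p₀).symm y) v))
  have h5 : ∀ w : ℝ, (trivializationAt ℝ (Bundle.Trivial M ℝ) p₀).continuousLinearMapAt ℝ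
      ((extChartAt (𝓡 m) p₀).symm y) w = w := fun w =>
    DFunLike.congr_fun (Bundle.Trivial.continuousLinearMapAt_trivialization ℝ M ℝ _) w
  exact (congrArg (α ((extChartAt (𝓡 m) p₀).symm y)) h4.symm).trans (h5 _).symm

/-- A map into `M` and its expression in the preferred chart at `p₀` have corresponding
differentials. -/
theorem mfderiv_eq_symm_fderiv {F : W → M} {z : W} {p₀ : M}
    (hz : F z ∈ (extChartAt (𝓡 m) p₀).source) (hF : MDifferentiableAt 𝓘(ℝ, W) (𝓡 m) F z) (a : W) :
    (fderiv ℝ (fun w => extChartAt (𝓡 m) p₀ (F w)) z a : EuclideanSpace ℝ (Fin m)) =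
      mfderiv (𝓡 m) 𝓘(ℝ, EuclideanSpace ℝ (Fin m)) (extChartAt (𝓡 m) p₀) (F z)
        (mfderiv 𝓘(ℝ, W) (𝓡 m) F z a) := by
  have : IsManifold (𝓡 m) 1 M := IsManifold.of_le (n := ∞) (by simp)
  have h1 := (mdifferentiableAt_extChartAt (I := 𝓡 m) (x := p₀)
    (by simpa using hz)).hasMFDerivAt.comp z hF.hasMFDerivAt
  let D : W →L[ℝ] EuclideanSpace ℝ (Fin m) :=
    (mfderiv (𝓡 m) 𝓘(ℝ, EuclideanSpace ℝ (Fin m)) (extChartAt (𝓡 m) p₀) (F z)).comp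
      (mfderiv 𝓘(ℝ, W) (𝓡 m) F z)
  have h2 : HasFDerivAt (fun w => extChartAt (𝓡 m) p₀ (F w)) D z := h1.hasFDerivAt
  rw [h2.fderiv]
  rfl

theorem OneForm.pull_eq_inChart (α : OneForm m M) {F : W → M} {z : W} {p₀ : M}
    (hz : F z ∈ (extChartAt (𝓡 m) p₀).source) (hF : MDifferentiableAt 𝓘(ℝ, W) (𝓡 m) F z) :
    α.pull F z = (α.inChart p₀ (extChartAt (𝓡 m) p₀ (F z))).comp
      (fderiv ℝ (fun w => extChartAt (𝓡 m) p₀ (F w)) z) := by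
  have : IsManifold (𝓡 m) 1 M := IsManifold.of_le (n := ∞) (by simp)
  ext a
  have h1 := mfderiv_symm_mfderiv_extChartAt (I := 𝓡 m) hz (mfderiv 𝓘(ℝ, W) (𝓡 m) F z a)
  rw [ContinuousLinearMap.comp_apply, mfderiv_eq_symm_fderiv hz hF]
  change α (F z) _ = α ((extChartAt (𝓡 m) p₀).symm (extChartAt (𝓡 m) p₀ (F z)))
    (mfderiv 𝓘(ℝ, EuclideanSpace ℝ (Fin m)) (𝓡 m) (extChartAt (𝓡 m) p₀).symm
      (extChartAt (𝓡 m) p₀ (F z)) (mfderiv (𝓡 m) 𝓘(ℝ, EuclideanSpace ℝ (Fin m))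
        (extChartAt (𝓡 m) p₀) (F z) (mfderiv 𝓘(ℝ, W) (𝓡 m) F z a)))
  rw [h1, (extChartAt (𝓡 m) p₀).left_inv hz]
  rfl

theorem OneForm.pull_eventuallyEq_inChart (α : OneForm m M) {F : W → M} {z : W} {p₀ : M}
    (hz : F z ∈ (extChartAt (𝓡 m) p₀).source) (hF : ContMDiffAt 𝓘(ℝ, W) (𝓡 m) ∞ F z) :
    α.pull F =ᶠ[𝓝 z] fun z => (α.inChart p₀ (extChartAt (𝓡 m) p₀ (F z))).comp
      (fderiv ℝ (fun w => extChartAt (𝓡 m) p₀ (F w)) z) := by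
  have h1 : ∀ᶠ w in 𝓝 z, ContMDiffAt 𝓘(ℝ, W) (𝓡 m) 1 F w := by
    have : IsManifold (𝓡 m) 1 M := IsManifold.of_le (n := ∞) (by simp)
    exact (contMDiffAt_iff_contMDiffAt_nhds (by simp)).1 (hF.of_le (by simp))
  filter_upwards [h1, hF.continuousAt (extChartAt_source_mem_nhds' hz)] with w hw hws
  exact α.pull_eq_inChart hws (hw.mdifferentiableAt (by simp))

theorem contDiffAt_extChartAt_comp {F : W → M} {z : W} {p₀ : M}
    (hz : F z ∈ (extChartAt (𝓡 m) p₀).source) (hF : ContMDiffAt 𝓘(ℝ, W) (𝓡 m) ∞ F z) :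
    ContDiffAt ℝ ∞ (fun w => extChartAt (𝓡 m) p₀ (F w)) z :=
  ((contMDiffAt_extChartAt' (by simpa using hz)).comp z hF).contDiffAt

theorem OneForm.IsSmooth.contDiffAt_pull {α : OneForm m M} (hα : α.IsSmooth) {F : W → M} {z : W}
    (hF : ContMDiffAt 𝓘(ℝ, W) (𝓡 m) ∞ F z) : ContDiffAt ℝ ∞ (α.pull F) z := by
  have hz := mem_extChartAt_source (I := 𝓡 m) (F z)
  have h1 := contDiffAt_extChartAt_comp hz hF
  refine ContDiffAt.congr_of_eventuallyEq ?_ (α.pull_eventuallyEq_inChart hz hF)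
  refine ContDiffAt.clm_comp ?_ (h1.fderiv_right (by simp))
  exact ((hα.contDiffOn_inChart (F z)).contDiffAt
    (extChartAt_target_mem_nhds (I := 𝓡 m) (F z))).comp z h1

/-- The exterior derivative of `α`, evaluated on vectors tangent to a parametrization `F`, is the
exterior derivative of the pull-back by `F`. -/
theorem OneForm.IsSmooth.fderiv_pull_antisymm {α : OneForm m M} (hα : α.IsSmooth) {F : W → M}
    {z : W} (hF : ContMDiffAt 𝓘(ℝ, W) (𝓡 m) ∞ F z) (a b : W) :
    fderiv ℝ (α.pull F) z a b - fderiv ℝ (α.pull F) z b a =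
      α.d (F z) (mfderiv 𝓘(ℝ, W) (𝓡 m) F z a) (mfderiv 𝓘(ℝ, W) (𝓡 m) F z b) := by
  have hz := mem_extChartAt_source (I := 𝓡 m) (F z)
  have h1 := contDiffAt_extChartAt_comp hz hF
  rw [(α.pull_eventuallyEq_inChart hz hF).fderiv_eq]
  have hd := ((hα.contDiffOn_inChart (F z)).contDiffAt
    (extChartAt_target_mem_nhds (I := 𝓡 m) (F z))).differentiableAt (by simp)
  rw [fderiv_pullback_antisymm (F := fun w => extChartAt (𝓡 m) (F z) (F w))
    (h1.of_le ENat.LEInfty.out) hd a b]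
  have h2 := mfderiv_eq_symm_fderiv hz (hF.mdifferentiableAt (by simp))
  rw [h2, h2]
  rfl

end Pullback

/-! ### Smoothness of contact vector fields -/

section ContactFields

open Set

variable {m : ℕ} {M : Type*} [TopologicalSpace M] [ChartedSpace (EuclideanSpace ℝ (Fin m)) M]

/-- The operator `u ↦ ι_u dα + α(u) α` read in the preferred chart at `p₀`. For a contact form it
is an isomorphism onto the dual space, which sends the Reeb vector to `α` and the contact vector
field of `h` to `(dh(R) + h) α - dh`. -/
def contactOperator (α : OneForm m M) (p₀ : M) (y : EuclideanSpace ℝ (Fin m)) :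
    EuclideanSpace ℝ (Fin m) →L[ℝ] EuclideanSpace ℝ (Fin m) →L[ℝ] ℝ :=
  fderiv ℝ (α.inChart p₀) y - (fderiv ℝ (α.inChart p₀) y).flip +
    (α.inChart p₀ y).smulRight (α.inChart p₀ y)

/-- The Reeb vector field read in the preferred chart at `p₀`. -/
def reebInChart (α : OneForm m M) (p₀ : M) (y : EuclideanSpace ℝ (Fin m)) :
    EuclideanSpace ℝ (Fin m) :=
  (contactOperator α p₀ y).inverse (α.inChart p₀ y)

/-- The differential of the inverse of the preferred chart at `p₀`. -/
def fromChart (p₀ : M) (y : EuclideanSpace ℝ (Fin m)) :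
    EuclideanSpace ℝ (Fin m) →L[ℝ] TangentSpace (𝓡 m) ((extChartAt (𝓡 m) p₀).symm y) :=
  mfderiv 𝓘(ℝ, EuclideanSpace ℝ (Fin m)) (𝓡 m) (extChartAt (𝓡 m) p₀).symm y

/-- The differential of the preferred chart at `p₀`, at a point given by its coordinates. -/
def toChart (p₀ : M) (y : EuclideanSpace ℝ (Fin m)) :
    TangentSpace (𝓡 m) ((extChartAt (𝓡 m) p₀).symm y) →L[ℝ] EuclideanSpace ℝ (Fin m) :=
  mfderiv (𝓡 m) 𝓘(ℝ, EuclideanSpace ℝ (Fin m)) (extChartAt (𝓡 m) p₀)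
    ((extChartAt (𝓡 m) p₀).symm y)

theorem inChart_eq_fromChart (α : OneForm m M) (p₀ : M) (y v : EuclideanSpace ℝ (Fin m)) :
    α.inChart p₀ y v = α ((extChartAt (𝓡 m) p₀).symm y) (fromChart p₀ y v) := rfl

theorem fieldInChart_eq_toChart (X : ∀ q : M, TangentSpace (𝓡 m) q) (p₀ : M)
    (y : EuclideanSpace ℝ (Fin m)) :
    fieldInChart X p₀ y = toChart p₀ y (X ((extChartAt (𝓡 m) p₀).symm y)) := rfl

theorem fieldInChart_extChartAt (X : ∀ q : M, TangentSpace (𝓡 m) q) {p₀ q : M}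
    (hq : q ∈ (extChartAt (𝓡 m) p₀).source) :
    fieldInChart X p₀ (extChartAt (𝓡 m) p₀ q) =
      (mfderiv (𝓡 m) 𝓘(ℝ, EuclideanSpace ℝ (Fin m)) (extChartAt (𝓡 m) p₀) q (X q) :
        EuclideanSpace ℝ (Fin m)) := by
  have : ∀ q', q' = q →
      (mfderiv (𝓡 m) 𝓘(ℝ, EuclideanSpace ℝ (Fin m)) (extChartAt (𝓡 m) p₀) q' (X q') :
        EuclideanSpace ℝ (Fin m)) =
      (mfderiv (𝓡 m) 𝓘(ℝ, EuclideanSpace ℝ (Fin m)) (extChartAt (𝓡 m) p₀) q (X q) :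
        EuclideanSpace ℝ (Fin m)) := by
    rintro q' rfl; rfl
  exact this _ ((extChartAt (𝓡 m) p₀).left_inv hq)

variable [IsManifold (𝓡 m) ∞ M] {α : OneForm m M}

theorem toChart_fromChart {p₀ : M} {y : EuclideanSpace ℝ (Fin m)}
    (hy : y ∈ (extChartAt (𝓡 m) p₀).target) (v : EuclideanSpace ℝ (Fin m)) :
    toChart p₀ y (fromChart p₀ y v) = v := by
  have : IsManifold (𝓡 m) 1 M := IsManifold.of_le (n := ∞) (by simp)
  exact mfderiv_extChartAt_mfderiv_symm (I := 𝓡 m) hy v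

theorem fromChart_toChart {p₀ : M} {y : EuclideanSpace ℝ (Fin m)}
    (hy : y ∈ (extChartAt (𝓡 m) p₀).target)
    (w : TangentSpace (𝓡 m) ((extChartAt (𝓡 m) p₀).symm y)) :
    fromChart p₀ y (toChart p₀ y w) = w := by
  have : IsManifold (𝓡 m) 1 M := IsManifold.of_le (n := ∞) (by simp)
  have h := mfderiv_symm_mfderiv_extChartAt (I := 𝓡 m) ((extChartAt (𝓡 m) p₀).map_target hy) w
  rw [(extChartAt (𝓡 m) p₀).right_inv hy] at h
  exact h

theorem contactOperator_apply (hα : IsContactForm α) {p₀ : M} {y : EuclideanSpace ℝ (Fin m)}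
    (hy : y ∈ (extChartAt (𝓡 m) p₀).target) (u v : EuclideanSpace ℝ (Fin m)) :
    contactOperator α p₀ y u v =
      α.d ((extChartAt (𝓡 m) p₀).symm y) (fromChart p₀ y u) (fromChart p₀ y v) +
      α ((extChartAt (𝓡 m) p₀).symm y) (fromChart p₀ y u) * α.inChart p₀ y v := by
  have h := hα.smooth.fderiv_pull_antisymm (contMDiffAt_extChartAt_symm (I := 𝓡 m) hy) u v
  exact congrArg (· + α.inChart p₀ y u * α.inChart p₀ y v) h

theorem contactOperator_isInvertible (hα : IsContactForm α) {p₀ : M}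
    {y : EuclideanSpace ℝ (Fin m)} (hy : y ∈ (extChartAt (𝓡 m) p₀).target) :
    (contactOperator α p₀ y).IsInvertible := by
  set q := (extChartAt (𝓡 m) p₀).symm y with hq
  have hinj : Function.Injective (contactOperator α p₀ y).toLinearMap := by
    rw [injective_iff_map_eq_zero]
    intro u hu
    have hu' : ∀ v, contactOperator α p₀ y u v = 0 := fun v =>
      (DFunLike.congr_fun (show contactOperator α p₀ y u = 0 from hu) v).trans rfl
    obtain ⟨B, hB, hB0⟩ := α.d_bilin q
    obtain ⟨hR1, hR⟩ := hα.isReebVector_reebField q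
    have hflip : ∀ v, α.d q v (reebField α q) = 0 := fun v => by
      have h3 := hB0 (v + reebField α q)
      simp only [map_add, LinearMap.add_apply, hB0, hB (reebField α q), hR] at h3
      rw [← hB]
      simpa using h3
    have hall : ∀ w : TangentSpace (𝓡 m) q,
        α.d q (fromChart p₀ y u) w + α q (fromChart p₀ y u) * α q w = 0 := fun w => by
      have h := hu' (toChart p₀ y w)
      rw [contactOperator_apply hα hy, inChart_eq_fromChart, fromChart_toChart hy] at h
      exact h
    have h0 : α q (fromChart p₀ y u) = 0 := by
      have := hall (reebField α q)
      rwa [hflip, hR1, zero_add, mul_one] at this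
    have hU0 : fromChart p₀ y u = 0 := hα.nondegenerate q _ h0 fun w _ => by
      have := hall w
      rwa [h0, zero_mul, add_zero] at this
    rw [← toChart_fromChart hy u, hU0, map_zero]
  let e : EuclideanSpace ℝ (Fin m) ≃ₗ[ℝ] (EuclideanSpace ℝ (Fin m) →L[ℝ] ℝ) :=
    LinearEquiv.ofInjectiveOfFinrankEq (contactOperator α p₀ y).toLinearMap hinj (by
      rw [← (LinearMap.toContinuousLinearMap
        (𝕜 := ℝ) (E := EuclideanSpace ℝ (Fin m)) (F' := ℝ)).finrank_eq]
      exact (Subspace.dual_finrank_eq).symm)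
  exact ⟨e.toContinuousLinearEquiv, by ext u v; rfl⟩

theorem contDiffAt_flip {E F : Type*} [NormedAddCommGroup E] [NormedSpace ℝ E]
    [NormedAddCommGroup F] [NormedSpace ℝ F] {f : F → E →L[ℝ] E →L[ℝ] ℝ} {z : F}
    (hf : ContDiffAt ℝ ∞ f z) : ContDiffAt ℝ ∞ (fun z => (f z).flip) z := by
  have h : IsBoundedLinearMap ℝ (fun A : E →L[ℝ] E →L[ℝ] ℝ => A.flip) := by
    refine IsLinearMap.with_bound ⟨fun _ _ => rfl, fun _ _ => rfl⟩ 1 fun A => ?_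
    rw [ContinuousLinearMap.opNorm_flip, one_mul]
  exact (IsBoundedLinearMap.contDiff (E := E →L[ℝ] E →L[ℝ] ℝ) (F := E →L[ℝ] E →L[ℝ] ℝ)
    (𝕜 := ℝ) (n := ∞) h).contDiffAt.comp z hf

theorem contDiffAt_contactOperator_inverse (hα : IsContactForm α) {p₀ : M}
    {y : EuclideanSpace ℝ (Fin m)} (hy : y ∈ (extChartAt (𝓡 m) p₀).target) :
    ContDiffAt ℝ ∞ (fun z => (contactOperator α p₀ z).inverse) y := by
  have hβ : ContDiffAt ℝ ∞ (α.inChart p₀) y :=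
    (hα.smooth.contDiffOn_inChart p₀).contDiffAt
      ((isOpen_extChartAt_target (I := 𝓡 m) p₀).mem_nhds hy)
  have hD : ContDiffAt ℝ ∞ (fderiv ℝ (α.inChart p₀)) y := hβ.fderiv_right (by simp)
  have hA : ContDiffAt ℝ ∞ (contactOperator α p₀) y := by
    refine (hD.sub ?_).add (hβ.smulRight hβ)
    exact contDiffAt_flip hD
  obtain ⟨e, he⟩ := contactOperator_isInvertible hα hy
  have h1 := contDiffAt_map_inverse (𝕜 := ℝ) (n := ∞) e
  rw [he] at h1
  exact h1.comp y hA

theorem fieldInChart_reebField (hα : IsContactForm α) {p₀ : M} {y : EuclideanSpace ℝ (Fin m)}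
    (hy : y ∈ (extChartAt (𝓡 m) p₀).target) :
    fieldInChart (reebField α) p₀ y = reebInChart α p₀ y := by
  rw [reebInChart, eq_comm, fieldInChart_eq_toChart]
  refine ((contactOperator_isInvertible hα hy).inverse_apply_eq).2 ?_
  ext v
  obtain ⟨h1, h2⟩ := hα.isReebVector_reebField ((extChartAt (𝓡 m) p₀).symm y)
  rw [contactOperator_apply hα hy, fromChart_toChart hy, h1, h2, zero_add, one_mul]

theorem differential_fromChart {h : M → ℝ} {p₀ : M} {y : EuclideanSpace ℝ (Fin m)}
    (hy : y ∈ (extChartAt (𝓡 m) p₀).target)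
    (hh : MDifferentiableAt (𝓡 m) 𝓘(ℝ, ℝ) h ((extChartAt (𝓡 m) p₀).symm y))
    (v : EuclideanSpace ℝ (Fin m)) :
    differential h ((extChartAt (𝓡 m) p₀).symm y) (fromChart p₀ y v) =
    fderiv ℝ (fun z => h ((extChartAt (𝓡 m) p₀).symm z)) y v := by
  have : IsManifold (𝓡 m) 1 M := IsManifold.of_le (n := ∞) (by simp)
  have h1 := hh.hasMFDerivAt.comp y (mdifferentiableAt_extChartAt_symm (I := 𝓡 m) hy).hasMFDerivAt
  let D : EuclideanSpace ℝ (Fin m) →L[ℝ] ℝ :=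
    (differential h ((extChartAt (𝓡 m) p₀).symm y)).comp (fromChart p₀ y)
  have h2 : HasFDerivAt (fun z => h ((extChartAt (𝓡 m) p₀).symm z)) D y := h1.hasFDerivAt
  rw [h2.fderiv]
  rfl

theorem fieldInChart_contactHamiltonianField (hα : IsContactForm α) {h : M → ℝ} {p₀ : M}
    {y : EuclideanSpace ℝ (Fin m)} (hy : y ∈ (extChartAt (𝓡 m) p₀).target)
    (hh : MDifferentiable (𝓡 m) 𝓘(ℝ, ℝ) h) :
    fieldInChart (contactHamiltonianField α h) p₀ y =
    (contactOperator α p₀ y).inverse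
      ((fderiv ℝ (fun z => h ((extChartAt (𝓡 m) p₀).symm z)) y (reebInChart α p₀ y) +
        h ((extChartAt (𝓡 m) p₀).symm y)) • α.inChart p₀ y -
        fderiv ℝ (fun z => h ((extChartAt (𝓡 m) p₀).symm z)) y) := by
  rw [eq_comm, fieldInChart_eq_toChart]
  refine ((contactOperator_isInvertible hα hy).inverse_apply_eq).2 ?_
  ext v
  obtain ⟨h1, h2⟩ := hα.isContactHamiltonianVector_field h ((extChartAt (𝓡 m) p₀).symm y)
  rw [contactOperator_apply hα hy, fromChart_toChart hy, h1, h2, differential_fromChart hy (hh _),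
    ← fieldInChart_reebField hα hy, ← differential_fromChart hy (hh _), fieldInChart_eq_toChart,
    fromChart_toChart hy]
  simp only [sub_apply, smul_apply, smul_eq_mul, inChart_eq_fromChart]
  ring

/-- The contact vector fields of a smooth time-dependent contact Hamiltonian depend smoothly on
time and position. -/
theorem contMDiff_contactHamiltonianField (hα : IsContactForm α) {h : ℝ → M → ℝ}
    (hh : ContMDiff (𝓘(ℝ, ℝ).prod (𝓡 m)) 𝓘(ℝ, ℝ) ∞ (fun q : ℝ × M => h q.1 q.2)) :
    ContMDiff (𝓘(ℝ, ℝ).prod (𝓡 m)) (𝓡 m).tangent ∞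
      (fun q : ℝ × M =>
        (⟨q.2, contactHamiltonianField α (h q.1) q.2⟩ : TangentBundle (𝓡 m) M)) := by
  have : IsManifold (𝓡 m) 1 M := IsManifold.of_le (n := ∞) (by simp)
  rintro ⟨t₀, p₀⟩
  refine Bundle.contMDiffAt_totalSpace.2 ⟨contMDiffAt_snd, ?_⟩
  set κ := extChartAt (𝓡 m) p₀ with hκ
  have hmem : κ p₀ ∈ κ.target := mem_extChartAt_target (I := 𝓡 m) p₀
  have hslice : ∀ t, ContMDiff (𝓡 m) 𝓘(ℝ, ℝ) ∞ (h t) := fun t =>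
    hh.comp (contMDiff_const.prodMk contMDiff_id)
  let ĥ : ℝ → EuclideanSpace ℝ (Fin m) → ℝ := fun t z => h t (κ.symm z)
  have hĥ : ContDiffAt ℝ ∞ (fun x : ℝ × EuclideanSpace ℝ (Fin m) => ĥ x.1 x.2) (t₀, κ p₀) := by
    have h1 : ContMDiffAt 𝓘(ℝ, ℝ × EuclideanSpace ℝ (Fin m)) (𝓘(ℝ, ℝ).prod (𝓡 m)) ∞
        (fun x : ℝ × EuclideanSpace ℝ (Fin m) => (x.1, κ.symm x.2)) (t₀, κ p₀) :=
      contDiff_fst.contMDiff.contMDiffAt.prodMk ((contMDiffAt_extChartAt_symm hmem).comp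
        (t₀, κ p₀) contDiff_snd.contMDiff.contMDiffAt)
    exact ((hh.contMDiffAt (x := (t₀, κ.symm (κ p₀)))).comp (t₀, κ p₀) h1).contDiffAt
  have hD : ContDiffAt ℝ ∞ (fun x : ℝ × EuclideanSpace ℝ (Fin m) => fderiv ℝ (ĥ x.1) x.2)
      (t₀, κ p₀) := by
    have h1 : ContDiffAt ℝ ∞ (Function.uncurry fun (x : ℝ × EuclideanSpace ℝ (Fin m)) => ĥ x.1)
        ((t₀, κ p₀), κ p₀) :=
      ContDiffAt.comp ((t₀, κ p₀), κ p₀)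
        (f := fun z : (ℝ × EuclideanSpace ℝ (Fin m)) × EuclideanSpace ℝ (Fin m) => (z.1.1, z.2)) hĥ
        (((contDiff_fst.comp contDiff_fst).prodMk contDiff_snd).contDiffAt)
    exact h1.fderiv contDiffAt_snd (by simp)
  have hinv : ContDiffAt ℝ ∞ (fun x : ℝ × EuclideanSpace ℝ (Fin m) =>
      (contactOperator α p₀ x.2).inverse) (t₀, κ p₀) :=
    (contDiffAt_contactOperator_inverse hα hmem).comp (t₀, κ p₀) contDiffAt_snd
  have hβ : ContDiffAt ℝ ∞ (fun x : ℝ × EuclideanSpace ℝ (Fin m) => α.inChart p₀ x.2)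
      (t₀, κ p₀) :=
    ((hα.smooth.contDiffOn_inChart p₀).contDiffAt
      ((isOpen_extChartAt_target (I := 𝓡 m) p₀).mem_nhds hmem)).comp (t₀, κ p₀) contDiffAt_snd
  have hG : ContDiffAt ℝ ∞ (fun x : ℝ × EuclideanSpace ℝ (Fin m) =>
      (contactOperator α p₀ x.2).inverse ((fderiv ℝ (ĥ x.1) x.2 (reebInChart α p₀ x.2) +
        ĥ x.1 x.2) • α.inChart p₀ x.2 - fderiv ℝ (ĥ x.1) x.2)) (t₀, κ p₀) :=
    hinv.clm_apply ((((hD.clm_apply (hinv.clm_apply hβ)).add hĥ).smul hβ).sub hD)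
  have hρ : ContMDiffAt (𝓘(ℝ, ℝ).prod (𝓡 m)) 𝓘(ℝ, ℝ × EuclideanSpace ℝ (Fin m)) ∞
      (fun q : ℝ × M => (q.1, κ q.2)) (t₀, p₀) :=
    contMDiffAt_fst.prodMk_space
      ((contMDiffAt_extChartAt (n := ∞) (x := p₀)).comp (t₀, p₀) contMDiffAt_snd)
  refine (ContMDiffAt.comp (t₀, p₀) (f := fun q : ℝ × M => (q.1, κ q.2))
    hG.contMDiffAt hρ).congr_of_eventuallyEq ?_
  have hsrc : ∀ᶠ q : ℝ × M in 𝓝 (t₀, p₀), q.2 ∈ κ.source :=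
    continuousAt_snd (extChartAt_source_mem_nhds (I := 𝓡 m) p₀)
  filter_upwards [hsrc] with q hq
  refine (trivializationAt_tangent_apply hq _).trans ?_
  refine (fieldInChart_extChartAt (contactHamiltonianField α (h q.1)) hq).symm.trans ?_
  exact fieldInChart_contactHamiltonianField hα (κ.map_source hq)
    ((hslice q.1).mdifferentiable (by simp))

theorem contactHamiltonianField_eq_reebField (hα : IsContactForm α) {h : M → ℝ} {p : M}
    (hp : h =ᶠ[𝓝 p] fun _ => 1) : contactHamiltonianField α h p = reebField α p := by
  refine (hα.existsUnique_contactHamiltonianVector _ p).unique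
    (hα.isContactHamiltonianVector_field _ p) ?_
  have hR := hα.isReebVector_reebField p
  have hd : differential (m := m) h p = 0 := hp.mfderiv_eq.trans mfderiv_const
  refine ⟨hR.1.trans hp.eq_of_nhds.symm, fun v => ?_⟩
  rw [hR.2, hd]
  simp

theorem contactHamiltonianField_one (hα : IsContactForm α) :
    contactHamiltonianField α (fun _ => (1 : ℝ)) = reebField α :=
  funext fun _ => contactHamiltonianField_eq_reebField hα Filter.EventuallyEq.rfl

theorem contMDiff_reebField (hα : IsContactForm α) :
    ContMDiff (𝓡 m) (𝓡 m).tangent ∞ (fun p => (⟨p, reebField α p⟩ : TangentBundle (𝓡 m) M)) := by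
  have h1 := contMDiff_contactHamiltonianField hα (h := fun _ _ => (1 : ℝ)) contMDiff_const
  rw [contactHamiltonianField_one hα] at h1
  exact h1.comp (contMDiff_const (c := (0 : ℝ)).prodMk contMDiff_id)

end ContactFields

/-! ### Contact isotopies generated by contact Hamiltonians -/

section Slices

variable {E : Type*} [NormedAddCommGroup E] [NormedSpace ℝ E]
  {E' : Type*} [NormedAddCommGroup E'] [NormedSpace ℝ E'] {H : Type*} [TopologicalSpace H]
  {I : ModelWithCorners ℝ E' H} {M : Type*} [TopologicalSpace M] [ChartedSpace H M]

theorem hasMFDerivAt_slice_left {F : ℝ × E → M} {t : ℝ} {x : E}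
    (hF : MDifferentiableAt 𝓘(ℝ, ℝ × E) I F (t, x)) :
    HasMFDerivAt 𝓘(ℝ, ℝ) I (fun s => F (s, x)) t
      ((1 : ℝ →L[ℝ] ℝ).smulRight (mfderiv 𝓘(ℝ, ℝ × E) I F (t, x) ((1 : ℝ), (0 : E)))) := by
  have h1 : HasFDerivAt (fun s : ℝ => (s, x)) (ContinuousLinearMap.inl ℝ ℝ E) t :=
    hasFDerivAt_prodMk_left t x
  refine (HasMFDerivAt.comp (f := fun s : ℝ => (s, x)) t hF.hasMFDerivAt
    h1.hasMFDerivAt).congr_mfderiv ?_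
  refine ContinuousLinearMap.ext_ring ?_
  change mfderiv 𝓘(ℝ, ℝ × E) I F (t, x) ((1 : ℝ), (0 : E)) =
    (1 : ℝ) • mfderiv 𝓘(ℝ, ℝ × E) I F (t, x) ((1 : ℝ), (0 : E))
  rw [one_smul]

theorem hasMFDerivAt_slice_right {F : ℝ × E → M} {t : ℝ} {x : E}
    (hF : MDifferentiableAt 𝓘(ℝ, ℝ × E) I F (t, x)) :
    HasMFDerivAt 𝓘(ℝ, E) I (fun y => F (t, y)) x
      ((mfderiv 𝓘(ℝ, ℝ × E) I F (t, x)).comp (ContinuousLinearMap.inr ℝ ℝ E)) :=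
  HasMFDerivAt.comp (f := fun y : E => (t, y)) x hF.hasMFDerivAt
    (hasFDerivAt_prodMk_right t x).hasMFDerivAt

theorem mfderiv_slice_left {F : ℝ × E → M} {t : ℝ} {x : E}
    (hF : MDifferentiableAt 𝓘(ℝ, ℝ × E) I F (t, x)) {v : TangentSpace I (F (t, x))}
    (hv : HasMFDerivAt 𝓘(ℝ, ℝ) I (fun s => F (s, x)) t ((1 : ℝ →L[ℝ] ℝ).smulRight v)) :
    mfderiv 𝓘(ℝ, ℝ × E) I F (t, x) ((1 : ℝ), (0 : E)) = v := by
  have h := DFunLike.congr_fun (hasMFDerivAt_unique (hasMFDerivAt_slice_left hF) hv) (1 : ℝ)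
  have h2 : (1 : ℝ) • mfderiv 𝓘(ℝ, ℝ × E) I F (t, x) ((1 : ℝ), (0 : E)) = (1 : ℝ) • v := h
  rwa [one_smul, one_smul] at h2

theorem mfderiv_slice_right {F : ℝ × E → M} {t : ℝ} {x : E}
    (hF : MDifferentiableAt 𝓘(ℝ, ℝ × E) I F (t, x)) (w : E) :
    mfderiv 𝓘(ℝ, ℝ × E) I F (t, x) ((0 : ℝ), w) =
      mfderiv 𝓘(ℝ, E) I (fun y => F (t, y)) x w :=
  (DFunLike.congr_fun (hasMFDerivAt_slice_right hF).mfderiv w).symm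

end Slices

section ContactIsotopies

open Set

variable {m : ℕ} {M : Type*} [TopologicalSpace M] [ChartedSpace (EuclideanSpace ℝ (Fin m)) M]
  [IsManifold (𝓡 m) ∞ M] {α : OneForm m M}

theorem IsReebFlow.contMDiff [T2Space M] (hα : IsContactForm α) {ψ : ℝ → M → M}
    (hψ : IsReebFlow α ψ) :
    ContMDiff (𝓘(ℝ, ℝ).prod (𝓡 m)) (𝓡 m) ∞ (fun z : ℝ × M => ψ z.1 z.2) :=
  contMDiff_flow (contMDiff_reebField hα) hψ.zero hψ.integralCurve

theorem IsReebFlow.add [T2Space M] (hα : IsContactForm α) {ψ : ℝ → M → M}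
    (hψ : IsReebFlow α ψ) (s t : ℝ) (p : M) : ψ (t + s) p = ψ t (ψ s p) :=
  flow_add (contMDiff_reebField hα) hψ.zero hψ.integralCurve s t p

/-- The derivative of a time-dependent function along the Reeb field is continuous along curves:
it is a partial derivative of `(t, s) ↦ h t (ψ s (c t))`. -/
theorem continuous_differential_reebField [T2Space M] (hα : IsContactForm α) {ψ : ℝ → M → M}
    (hψ : IsReebFlow α ψ) {h : ℝ → M → ℝ}
    (hh : ContMDiff (𝓘(ℝ, ℝ).prod (𝓡 m)) 𝓘(ℝ, ℝ) ∞ (fun q : ℝ × M => h q.1 q.2)) {c : ℝ → M}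
    (hc : ContMDiff 𝓘(ℝ, ℝ) (𝓡 m) ∞ c) :
    Continuous (fun t => differential (h t) (c t) (reebField α (c t))) := by
  have h1 : ContDiff ℝ ∞ (fun z : ℝ × ℝ => h z.1 (ψ z.2 (c z.1))) := by
    have hfst : ContMDiff 𝓘(ℝ, ℝ × ℝ) 𝓘(ℝ, ℝ) ∞ (Prod.fst : ℝ × ℝ → ℝ) := contDiff_fst.contMDiff
    have hsnd : ContMDiff 𝓘(ℝ, ℝ × ℝ) 𝓘(ℝ, ℝ) ∞ (Prod.snd : ℝ × ℝ → ℝ) := contDiff_snd.contMDiff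
    exact (hh.comp (hfst.prodMk ((hψ.contMDiff hα).comp
      (hsnd.prodMk (hc.comp hfst))))).contDiff
  have h2 : ∀ t, differential (h t) (c t) (reebField α (c t)) =
      fderiv ℝ (fun z : ℝ × ℝ => h z.1 (ψ z.2 (c z.1))) (t, 0) (0, 1) := by
    intro t
    have hslice : MDifferentiableAt (𝓡 m) 𝓘(ℝ, ℝ) (h t) (ψ 0 (c t)) :=
      (hh.comp ((contMDiff_const (c := t)).prodMk contMDiff_id)).mdifferentiable (by simp) _
    have h3 := hslice.hasMFDerivAt.comp (0 : ℝ) (hψ.integralCurve (c t) 0)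
    have h4 : HasFDerivAt (fun s => h t (ψ s (c t))) ((1 : ℝ →L[ℝ] ℝ).smulRight
        (differential (h t) (ψ 0 (c t)) (reebField α (ψ 0 (c t))) : ℝ)) 0 :=
      (h3.congr_mfderiv (by
        refine ContinuousLinearMap.ext_ring ?_
        change differential (h t) (ψ 0 (c t)) ((1 : ℝ) • reebField α (ψ 0 (c t))) =
          (1 : ℝ) • (differential (h t) (ψ 0 (c t)) (reebField α (ψ 0 (c t))) : ℝ)
        rw [map_smul])).hasFDerivAt
    have h5 := (((h1.differentiable (by simp)) (t, 0)).hasFDerivAt.comp (0 : ℝ)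
      (hasFDerivAt_prodMk_right t (0 : ℝ)))
    have h6 := DFunLike.congr_fun (h4.unique h5) 1
    rw [hψ.zero] at h6
    simpa using h6
  simp_rw [h2]
  exact ((h1.continuous_fderiv (by simp)).comp (by fun_prop)).clm_apply continuous_const

/-- A smooth family of maps generated by a contact Hamiltonian preserves the contact structure:
for a tangent vector `v` the function `t ↦ α (Dφᵗ v)` satisfies the linear equation
`g' = dh(R) g`. -/
theorem Generates.contact [T2Space M] (hα : IsContactForm α) {ψ : ℝ → M → M}
    (hψ : IsReebFlow α ψ) {h : ℝ → M → ℝ}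
    (hh : ContMDiff (𝓘(ℝ, ℝ).prod (𝓡 m)) 𝓘(ℝ, ℝ) ∞ (fun q : ℝ × M => h q.1 q.2)) {φ : ℝ → M → M}
    (hφ : ContMDiff (𝓘(ℝ, ℝ).prod (𝓡 m)) (𝓡 m) ∞ (fun q : ℝ × M => φ q.1 q.2))
    (hφ0 : ∀ p, φ 0 p = p) (hgen : Generates α h φ) (t : ℝ) (p : M) :
    ∃ ρ : ℝ, 0 < ρ ∧ ∀ v : TangentSpace (𝓡 m) p,
      α (φ t p) (mfderiv (𝓡 m) (𝓡 m) (φ t) p v) = ρ * α p v := by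
  have : IsManifold (𝓡 m) 1 M := IsManifold.of_le (n := ∞) (by simp)
  set κ := extChartAt (𝓡 m) p with hκ
  set x₀ := κ p with hx₀
  have hmem : x₀ ∈ κ.target := mem_extChartAt_target (I := 𝓡 m) p
  have hκx : κ.symm x₀ = p := extChartAt_to_inv (I := 𝓡 m) p
  let F : ℝ × EuclideanSpace ℝ (Fin m) → M := fun z => φ z.1 (κ.symm z.2)
  have hF : ∀ s, ∀ y ∈ κ.target, ContMDiffAt 𝓘(ℝ, ℝ × EuclideanSpace ℝ (Fin m)) (𝓡 m) ∞ F (s, y) :=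
    fun s y hy => (hφ.contMDiffAt (x := (s, κ.symm y))).comp (s, y)
      (contDiff_fst.contMDiff.contMDiffAt.prodMk ((contMDiffAt_extChartAt_symm hy).comp
        (s, y) contDiff_snd.contMDiff.contMDiffAt))
  have hFd : ∀ s, ∀ y ∈ κ.target,
      MDifferentiableAt 𝓘(ℝ, ℝ × EuclideanSpace ℝ (Fin m)) (𝓡 m) F (s, y) :=
    fun s y hy => (hF s y hy).mdifferentiableAt (by simp)
  have hslice : ∀ s q, MDifferentiableAt (𝓡 m) 𝓘(ℝ, ℝ) (h s) q := fun s q =>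
    (hh.comp ((contMDiff_const (c := s)).prodMk contMDiff_id)).mdifferentiable (by simp) _
  -- the time derivative of the parametrized flow is the contact vector field
  have hFt : ∀ s, ∀ y ∈ κ.target, mfderiv 𝓘(ℝ, ℝ × EuclideanSpace ℝ (Fin m)) (𝓡 m) F (s, y)
      ((1 : ℝ), (0 : EuclideanSpace ℝ (Fin m))) = contactHamiltonianField α (h s) (F (s, y)) :=
    fun s y hy => mfderiv_slice_left (hFd s y hy) (hgen s (κ.symm y))
  let c : ℝ → ℝ := fun s => differential (h s) (φ s p) (reebField α (φ s p))
  have hc : Continuous c := continuous_differential_reebField hα hψ hh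
    (hφ.comp (contMDiff_id.prodMk contMDiff_const))
  let g : EuclideanSpace ℝ (Fin m) → ℝ → ℝ := fun w s => α.pull F (s, x₀) ((0 : ℝ), w)
  have hg : ∀ w s, HasDerivAt (g w) (c s * g w s) s := by
    intro w s
    have h1 : DifferentiableAt ℝ (α.pull F) (s, x₀) :=
      (hα.smooth.contDiffAt_pull (hF s x₀ hmem)).differentiableAt (by simp)
    have h2 : HasDerivAt (g w) (fderiv ℝ (α.pull F) (s, x₀) ((1 : ℝ), 0) ((0 : ℝ), w)) s := by
      have h3 : HasFDerivAt (fun τ : ℝ => α.pull F (τ, x₀))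
        ((fderiv ℝ (α.pull F) (s, x₀)).comp (ContinuousLinearMap.inl ℝ ℝ _)) s :=
        HasFDerivAt.comp (f := fun τ : ℝ => (τ, x₀)) (g := α.pull F) s h1.hasFDerivAt
          (hasFDerivAt_prodMk_left s x₀)
      simpa using h3.hasDerivAt.clm_apply (hasDerivAt_const s ((0 : ℝ), w))
    convert h2 using 1
    have h4 := hα.smooth.fderiv_pull_antisymm (hF s x₀ hmem) ((1 : ℝ), 0) ((0 : ℝ), w)
    rw [hFt s x₀ hmem, (hα.isContactHamiltonianVector_field (h s) _).2] at h4
    -- the derivative of `α (∂ₜ F) = h` in the direction `w`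
    have h5 : fderiv ℝ (α.pull F) (s, x₀) ((0 : ℝ), w) ((1 : ℝ), 0) =
        differential (h s) (F (s, x₀)) (mfderiv 𝓘(ℝ, ℝ × EuclideanSpace ℝ (Fin m)) (𝓡 m) F (s, x₀)
          ((0 : ℝ), w)) := by
      have h6 : HasFDerivAt (fun y => α.pull F (s, y) ((1 : ℝ), 0))
          ((ContinuousLinearMap.apply ℝ ℝ ((1 : ℝ), (0 : EuclideanSpace ℝ (Fin m)))).comp
            ((fderiv ℝ (α.pull F) (s, x₀)).comp (ContinuousLinearMap.inr ℝ ℝ _))) x₀ :=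
        HasFDerivAt.comp (f := fun y => α.pull F (s, y)) x₀ (ContinuousLinearMap.hasFDerivAt
          (ContinuousLinearMap.apply ℝ ℝ ((1 : ℝ), (0 : EuclideanSpace ℝ (Fin m)))))
          (HasFDerivAt.comp (f := fun y => (s, y)) (g := α.pull F) x₀ h1.hasFDerivAt
            (hasFDerivAt_prodMk_right s x₀))
      have h7 : (fun y => α.pull F (s, y) ((1 : ℝ), 0)) =ᶠ[𝓝 x₀] fun y => h s (F (s, y)) := by
        filter_upwards [(isOpen_extChartAt_target (I := 𝓡 m) p).mem_nhds hmem] with y hy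
        rw [OneForm.pull_apply, hFt s y hy, (hα.isContactHamiltonianVector_field (h s) _).1]
      let D : EuclideanSpace ℝ (Fin m) →L[ℝ] ℝ := (differential (h s) (F (s, x₀))).comp
        ((mfderiv 𝓘(ℝ, ℝ × EuclideanSpace ℝ (Fin m)) (𝓡 m) F (s, x₀)).comp
          (ContinuousLinearMap.inr ℝ ℝ (EuclideanSpace ℝ (Fin m))))
      have h8 : HasFDerivAt (fun y => h s (F (s, y))) D x₀ :=
        ((hslice s _).hasMFDerivAt.comp x₀ (hasMFDerivAt_slice_right (hFd s x₀ hmem))).hasFDerivAt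
      have h9 := DFunLike.congr_fun (h6.unique (h8.congr_of_eventuallyEq h7)) w
      exact h9
    have hFp : F (s, x₀) = φ s p := congrArg (φ s) hκx
    have hcs : c s = differential (h s) (F (s, x₀)) (reebField α (F (s, x₀))) := by rw [hFp]
    have hgs : g w s = α (F (s, x₀)) (mfderiv 𝓘(ℝ, ℝ × EuclideanSpace ℝ (Fin m)) (𝓡 m) F (s, x₀)
      ((0 : ℝ), w)) := rfl
    rw [h5] at h4
    rw [hcs, hgs]
    linarith
  -- the linear equation is solved by an exponential
  have hsol : ∀ w, g w t = Real.exp (∫ τ in (0 : ℝ)..t, c τ) * g w 0 := by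
    intro w
    have h1 : ∀ s, HasDerivAt (fun s => Real.exp (-∫ τ in (0 : ℝ)..s, c τ) * g w s) 0 s := by
      intro s
      have hC := (hc.integral_hasStrictDerivAt 0 s).hasDerivAt
      refine ((hC.neg.exp).mul (hg w s)).congr_deriv ?_
      simp
      ring
    have h2 := is_const_of_deriv_eq_zero (fun s => (h1 s).differentiableAt)
      (fun s => (h1 s).deriv) t 0
    simp only [intervalIntegral.integral_same, neg_zero, Real.exp_zero, one_mul] at h2
    rw [← h2, ← mul_assoc, ← Real.exp_add, add_neg_cancel, Real.exp_zero, one_mul]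
  refine ⟨Real.exp (∫ τ in (0 : ℝ)..t, c τ), Real.exp_pos _, fun v => ?_⟩
  -- identify the parametrized derivatives with the derivatives of the flow
  have hid : ∀ s, ∀ v : TangentSpace (𝓡 m) p, g (chartDeriv p v) s =
      α (φ s p) (mfderiv (𝓡 m) (𝓡 m) (φ s) p v) := by
    intro s v
    have hφs : MDifferentiableAt (𝓡 m) (𝓡 m) (φ s) (κ.symm x₀) :=
      (hφ.comp ((contMDiff_const (c := s)).prodMk contMDiff_id)).mdifferentiable (by simp) _
    have h1 := (hφs.hasMFDerivAt.comp x₀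
      (mdifferentiableAt_extChartAt_symm (I := 𝓡 m) hmem).hasMFDerivAt).mfderiv
    have h2 := mfderiv_slice_right (hFd s x₀ hmem) (chartDeriv p v)
    have h3 := h2.trans (DFunLike.congr_fun h1 (chartDeriv p v))
    have h4 := mfderiv_symm_mfderiv_extChartAt (I := 𝓡 m) (mem_extChartAt_source (I := 𝓡 m) p) v
    have h5 : g (chartDeriv p v) s = α (φ s (κ.symm x₀))
      (mfderiv (𝓡 m) (𝓡 m) (φ s) (κ.symm x₀) (mfderiv 𝓘(ℝ, EuclideanSpace ℝ (Fin m)) (𝓡 m) κ.symm x₀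
        (chartDeriv p v))) := congrArg (α (F (s, x₀))) h3
    refine h5.trans ?_
    have h6 : ∀ (q : M) (u : EuclideanSpace ℝ (Fin m)), q = p → u = v →
      α (φ s q) (mfderiv (𝓡 m) (𝓡 m) (φ s) q u) = α (φ s p) (mfderiv (𝓡 m) (𝓡 m) (φ s) p v) := by
      rintro q u rfl rfl
      rfl
    exact h6 _ _ hκx h4
  have h0 : α (φ 0 p) (mfderiv (𝓡 m) (𝓡 m) (φ 0) p v) = α p v := by
    have h1 : φ 0 = id := funext hφ0
    rw [h1, mfderiv_id]
    rfl
  rw [← hid, hsol, hid, h0]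

/-- A time-periodic contact Hamiltonian that equals one off a compact set
generates a twisted periodic contact isotopy, provided the Reeb flow is complete. -/
theorem exists_contactIsotopy [T2Space M] (hα : IsContactForm α) {ψ : ℝ → M → M}
    (hψ : IsReebFlow α ψ) {h : ℝ → M → ℝ}
    (hh : ContMDiff (𝓘(ℝ, ℝ).prod (𝓡 m)) 𝓘(ℝ, ℝ) ∞ (fun q : ℝ × M => h q.1 q.2))
    (hper : ∀ t p, h (t + 1) p = h t p) {K : Set M} (hK : IsCompact K)
    (hone : ∀ t, ∀ p ∉ K, h t p = 1) :
    ∃ φ : ℝ → M → M, IsContactIsotopy α φ ∧ Generates α h φ ∧ IsTwistedPeriodic φ := by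
  set X : ℝ → ∀ p : M, TangentSpace (𝓡 m) p := fun t => contactHamiltonianField α (h t) with hXdef
  have hX : ContMDiff (𝓘(ℝ, ℝ).prod (𝓡 m)) (𝓡 m).tangent ∞
      (fun q : ℝ × M => (⟨q.2, X q.1 q.2⟩ : TangentBundle (𝓡 m) M)) :=
    contMDiff_contactHamiltonianField hα hh
  have hper' : ∀ t, h (t + 1) = h t := fun t => funext (hper t)
  have hXper : ∀ t p, X (t + 1) p = X t p := fun t p => by simp only [hXdef, hper']
  obtain ⟨ε, hε, hex⟩ := exists_uniform_time_of_eq_off_compact hX hXper (contMDiff_reebField hα)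
    hψ.zero hψ.integralCurve hK fun t p hp => contactHamiltonianField_eq_reebField hα
      (Filter.eventually_of_mem (hK.isClosed.isOpen_compl.mem_nhds hp) fun q hq => hone t q hq)
  obtain ⟨Θ, hΘ, hΘ0, hΘX⟩ := exists_evolution hX hε hex
  have hΘinv : ∀ s t p, Θ t s (Θ s t p) = p := fun s t p => by
    have := IsTimeCurveOn.eq_univ hX (hΘX t (Θ s t p)) (hΘX s p) (t₀ := t) (hΘ0 _ _)
    exact (congrFun this s).trans (hΘ0 s p)
  have hsm : ContMDiff (𝓘(ℝ, ℝ).prod (𝓡 m)) (𝓡 m) ∞ (fun q : ℝ × M => Θ 0 q.1 q.2) :=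
    hΘ.comp (contMDiff_const (c := (0 : ℝ)) |>.prodMk (contMDiff_fst.prodMk contMDiff_snd))
  have hgen : Generates α h (Θ 0) := fun t p => hΘX 0 p t (mem_univ t)
  refine ⟨Θ 0, ⟨hsm, hΘ0 0, fun t => ?_, hgen.contact hα hψ hh hsm (hΘ0 0)⟩, hgen, ?_⟩
  · exact ⟨⟨⟨Θ 0 t, Θ t 0, hΘinv 0 t, hΘinv t 0⟩,
      hsm.comp (contMDiff_const (c := t) |>.prodMk contMDiff_id),
      hΘ.comp (contMDiff_const (c := t) |>.prodMk
        (contMDiff_const (c := (0 : ℝ)) |>.prodMk contMDiff_id))⟩, fun p => rfl⟩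
  · intro t k p
    have hXk : ∀ (k : ℤ) t, h (t + k) = h t := by
      intro k
      induction k using Int.induction_on with
      | zero => simp
      | succ k ih => intro t; push_cast; rw [← add_assoc, hper']; exact_mod_cast ih t
      | pred k ih =>
        intro t
        rw [← hper']; push_cast
        rw [show t + (-(k : ℝ) - 1) + 1 = t + ((-(k : ℤ) : ℤ) : ℝ) by push_cast; ring]
        exact ih t
    have hshift : IsTimeCurveOn X (fun s => Θ 0 (s - k) (Θ 0 k p)) univ := by
      intro s _
      have h1 := hgen (s + -k) (Θ 0 k p)
      have h2 : h (s + -k) = h s := by rw [← hXk k, neg_add_cancel_right]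
      rw [h2] at h1
      exact hasMFDerivAt_shift (c := fun τ => Θ 0 τ (Θ 0 k p)) h1
    exact congrFun (IsTimeCurveOn.eq_univ hX (t₀ := k) (hΘX 0 p) hshift (by
      simp only [sub_self]; exact (hΘ0 _ _).symm)) t

end ContactIsotopies

/-! ### Left inverses of immersions, and Legendrian subspaces -/

section LeftInverses

open Set

/-- An immersion has a smooth local left inverse: in suitable charts it is the inclusion of a
factor, and the left inverse is the projection. -/
theorem exists_leftInverse_of_isImmersionAt {E E' : Type*} [NormedAddCommGroup E] [NormedSpace ℝ E]
    [NormedAddCommGroup E'] [NormedSpace ℝ E'] {H H' : Type*} [TopologicalSpace H]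
    [TopologicalSpace H'] {I : ModelWithCorners ℝ E H} {J : ModelWithCorners ℝ E' H'}
    [I.Boundaryless] [J.Boundaryless]
    {L M : Type*} [TopologicalSpace L] [ChartedSpace H L] [TopologicalSpace M] [ChartedSpace H' M]
    {f : L → M} {x : L} (hf : Manifold.IsImmersionAt I J ∞ f x) :
    ∃ r : M → L, ContMDiffAt J I ∞ r (f x) ∧ ∀ᶠ y in 𝓝 x, r (f y) = y := by
  set a := hf.domChart.extend I with ha
  set b := hf.codChart.extend J with hb
  have hleft : ∀ y ∈ hf.domChart.source, (hf.equiv.symm (b (f y))).1 = a y := by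
    intro y hy
    have hya : y ∈ a.source := by rwa [ha, OpenPartialHomeomorph.extend_source]
    have h1 := hf.writtenInCharts (a.map_source hya)
    simp only [Function.comp_apply] at h1
    rw [← ha, a.left_inv hya] at h1
    rw [hb, h1]
    simp
  have hx := hf.mem_domChart_source
  have hxa : x ∈ a.source := by rwa [ha, OpenPartialHomeomorph.extend_source]
  refine ⟨fun q => a.symm (hf.equiv.symm (b q)).1, ?_, ?_⟩
  · have h1 : ContMDiffAt J 𝓘(ℝ, E') ∞ b (f x) :=
      OpenPartialHomeomorph.contMDiffAt_extend hf.codChart_mem_maximalAtlas hf.mem_codChart_source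
    have h2 : ContDiff ℝ ∞ (fun v : E' => (hf.equiv.symm v).1) :=
      contDiff_fst.comp hf.equiv.symm.contDiff
    have h3 : ContMDiffAt 𝓘(ℝ, E) I ∞ a.symm (hf.equiv.symm (b (f x))).1 := by
      rw [hleft x hx]
      refine (contMDiffOn_extend_symm hf.domChart_mem_maximalAtlas).contMDiffAt ?_
      rw [← hf.domChart.extend_target' (I := I)]
      exact hf.domChart.isOpen_extend_target.mem_nhds (a.map_source hxa)
    exact h3.comp (f x) (h2.contMDiff.contMDiffAt.comp (f x) h1)
  · filter_upwards [hf.domChart.open_source.mem_nhds hx] with y hy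
    have hya : y ∈ a.source := by rwa [ha, OpenPartialHomeomorph.extend_source]
    change a.symm (hf.equiv.symm (b (f y))).1 = y
    rw [hleft y hy, a.left_inv hya]

theorem mfderiv_injective_of_leftInverse {E E' : Type*} [NormedAddCommGroup E] [NormedSpace ℝ E]
    [NormedAddCommGroup E'] [NormedSpace ℝ E'] {H H' : Type*} [TopologicalSpace H]
    [TopologicalSpace H'] {I : ModelWithCorners ℝ E H} {J : ModelWithCorners ℝ E' H'}
    {L M : Type*} [TopologicalSpace L] [ChartedSpace H L] [TopologicalSpace M] [ChartedSpace H' M]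
    {f : L → M} {x : L} {r : M → L} (hf : MDifferentiableAt I J f x)
    (hr : MDifferentiableAt J I r (f x)) (h : ∀ᶠ y in 𝓝 x, r (f y) = y)
    {v : TangentSpace I x} (hv : mfderiv I J f x v = 0) : v = 0 := by
  have h1 := hr.hasMFDerivAt.comp x hf.hasMFDerivAt
  have h2 : HasMFDerivAt I I (r ∘ f) x (ContinuousLinearMap.id ℝ (TangentSpace I x)) :=
    (hasMFDerivAt_id x).congr_of_eventuallyEq h
  have h3 := DFunLike.congr_fun (hasMFDerivAt_unique h1 h2) v
  have h4 : mfderiv J I r (f x) (mfderiv I J f x v) = v := h3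
  rw [← h4, hv, map_zero]
  rfl

variable {m : ℕ} {M : Type*} [TopologicalSpace M] [ChartedSpace (EuclideanSpace ℝ (Fin m)) M]
  [IsManifold (𝓡 m) ∞ M] {W : Type*} [NormedAddCommGroup W] [NormedSpace ℝ W]
  [FiniteDimensional ℝ W]

/-- A smooth map from a vector space with injective differential has a smooth local left
inverse, by the inverse function theorem. The last clause is stated separately, since being
`C^∞` at a point does not entail being `C^∞` nearby. -/
theorem exists_leftInverse_of_mfderiv_injective {F : W → M} {z₀ : W}
    (hF : ∀ᶠ z in 𝓝 z₀, ContMDiffAt 𝓘(ℝ, W) (𝓡 m) ∞ F z)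
    (hinj : ∀ v : W, mfderiv 𝓘(ℝ, W) (𝓡 m) F z₀ v = 0 → v = 0) :
    ∃ g : M → W, (∀ᶠ z in 𝓝 z₀, g (F z) = z) ∧
      ∀ᶠ p in 𝓝 (F z₀), ContMDiffAt (𝓡 m) 𝓘(ℝ, W) ∞ g p := by
  have : IsManifold (𝓡 m) 1 M := IsManifold.of_le (n := ∞) (by simp)
  have : CompleteSpace W := FiniteDimensional.complete ℝ W
  have hF₀ := hF.self_of_nhds
  have hz := mem_extChartAt_source (I := 𝓡 m) (F z₀)
  set κ := extChartAt (𝓡 m) (F z₀) with hκ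
  have hsrc : κ.source ∈ 𝓝 (F z₀) := extChartAt_source_mem_nhds (F z₀)
  have h1 : ContDiffAt ℝ ∞ (fun w => κ (F w)) z₀ := contDiffAt_extChartAt_comp hz hF₀
  set A := fderiv ℝ (fun w => κ (F w)) z₀ with hA
  have hAinj : LinearMap.ker A.toLinearMap = ⊥ := by
    rw [LinearMap.ker_eq_bot']
    intro v hv
    refine hinj v ?_
    have h2 := mfderiv_eq_symm_fderiv hz (hF₀.mdifferentiableAt (by simp)) v
    have h3 : (A v : EuclideanSpace ℝ (Fin m)) = 0 := hv
    rw [← hκ, ← hA, h3] at h2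
    have h4 := mfderiv_symm_mfderiv_extChartAt (I := 𝓡 m) hz (mfderiv 𝓘(ℝ, W) (𝓡 m) F z₀ v)
    rw [← h4]
    exact (congrArg _ h2.symm).trans (map_zero _)
  obtain ⟨B, hB⟩ := LinearMap.exists_leftInverse_of_injective A.toLinearMap hAinj
  let B' : EuclideanSpace ℝ (Fin m) →L[ℝ] W := LinearMap.toContinuousLinearMap B
  let G : W → W := fun w => B' (κ (F w))
  have hG : ∀ᶠ z in 𝓝 z₀, ContDiffAt ℝ ∞ G z := by
    filter_upwards [hF, hF₀.continuousAt hsrc] with z hz hzs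
    exact B'.contDiff.contDiffAt.comp z (contDiffAt_extChartAt_comp hzs hz)
  have h2 : ContDiffAt ℝ ∞ G z₀ := hG.self_of_nhds
  have h3 : HasFDerivAt G ((ContinuousLinearEquiv.refl ℝ W : W ≃L[ℝ] W) : W →L[ℝ] W) z₀ := by
    have h4 := B'.hasFDerivAt.comp z₀ (h1.differentiableAt (by simp)).hasFDerivAt
    refine h4.congr_fderiv ?_
    ext v
    exact LinearMap.congr_fun hB v
  have hinv : ∀ᶠ z in 𝓝 z₀, ∃ e : W ≃L[ℝ] W, (e : W →L[ℝ] W) = fderiv ℝ G z := by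
    have h4 : ContinuousAt (fderiv ℝ G) z₀ :=
      (h2.fderiv_right (m := 0) (by simp)).continuousAt
    have h5 : range ((↑) : (W ≃L[ℝ] W) → W →L[ℝ] W) ∈ 𝓝 (fderiv ℝ G z₀) := by
      rw [h3.fderiv]
      exact ContinuousLinearEquiv.nhds (ContinuousLinearEquiv.refl ℝ W)
    exact h4 h5
  let e := h2.toOpenPartialHomeomorph G h3 (by simp)
  have hez : z₀ ∈ e.source := h2.mem_toOpenPartialHomeomorph_source h3 (by simp)
  have hsymm : ∀ᶠ y in 𝓝 (G z₀), ContDiffAt ℝ ∞ e.symm y := by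
    have h4 : ContinuousAt e.symm (e z₀) := e.continuousAt_symm (e.map_source hez)
    have h5 : Filter.Tendsto e.symm (𝓝 (e z₀)) (𝓝 z₀) := by
      have h6 := h4.tendsto
      rwa [e.left_inv hez] at h6
    filter_upwards [h5.eventually hG, h5.eventually hinv,
      e.open_target.mem_nhds (e.map_source hez)] with y hy hy' hyt
    obtain ⟨e', he'⟩ := hy'
    exact e.contDiffAt_symm hyt (f₀' := e')
      (by rw [he']; exact (hy.differentiableAt (by simp)).hasFDerivAt) hy
  refine ⟨fun q => e.symm (B' (κ q)), ?_, ?_⟩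
  · filter_upwards [e.open_source.mem_nhds hez] with z hz
    exact e.left_inv hz
  · have h4 : ContinuousAt (fun q => B' (κ q)) (F z₀) :=
      B'.continuous.continuousAt.comp (continuousAt_extChartAt (F z₀))
    filter_upwards [h4.eventually hsymm, hsrc] with q hq hqs
    exact hq.contMDiffAt.comp q (B'.contDiff.contMDiff.contMDiffAt.comp q
      (contMDiffAt_extChartAt' (by simpa [hκ] using hqs)))

end LeftInverses

section LinearAlgebra

variable {n : ℕ} {M : Type*} [TopologicalSpace M]
  [ChartedSpace (EuclideanSpace ℝ (Fin (2 * n + 1))) M] [IsManifold (𝓡 (2 * n + 1)) ∞ M]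

/-- A Legendrian subspace is its own `dα`-complement in the contact hyperplane. -/
theorem IsContactForm.mem_range_of_orthogonal {α : OneForm (2 * n + 1) M} (hα : IsContactForm α)
    {p : M} {V : Type*} [AddCommGroup V] [Module ℝ V] (hV : Module.finrank ℝ V = n)
    (D : V →ₗ[ℝ] TangentSpace (𝓡 (2 * n + 1)) p) (hD : Function.Injective D)
    (hker : ∀ v, α p (D v) = 0) (hiso : ∀ v v', α.d p (D v) (D v') = 0)
    {w : TangentSpace (𝓡 (2 * n + 1)) p} (hw : α p w = 0) (hort : ∀ v, α.d p w (D v) = 0) :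
    ∃ v, D v = w := by
  obtain ⟨B, hB, hB0⟩ := α.d_bilin p
  have hfd : FiniteDimensional ℝ (TangentSpace (𝓡 (2 * n + 1)) p) :=
    inferInstanceAs (FiniteDimensional ℝ (EuclideanSpace ℝ (Fin (2 * n + 1))))
  have hfr : Module.finrank ℝ (TangentSpace (𝓡 (2 * n + 1)) p) = 2 * n + 1 :=
    finrank_euclideanSpace_fin (𝕜 := ℝ) (n := 2 * n + 1)
  have hanti : ∀ u v, B u v = -B v u := fun u v => by
    have h := hB0 (u + v)
    simp only [map_add, LinearMap.add_apply, hB0] at h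
    linarith
  let K : Submodule ℝ (TangentSpace (𝓡 (2 * n + 1)) p) := LinearMap.ker (α p).toLinearMap
  have hK : Module.finrank ℝ K = 2 * n := by
    have h1 : (α p).toLinearMap ≠ 0 := fun h => hα.ne_zero p
      (ContinuousLinearMap.ext fun v => LinearMap.congr_fun h v)
    have h2 := Module.Dual.finrank_ker_add_one_of_ne_zero h1
    rw [hfr] at h2
    exact Nat.succ_injective h2
  let σ : LinearMap.BilinForm ℝ K := B.domRestrict₁₂ K K
  have hσ : σ.Nondegenerate := by
    have hl : σ.SeparatingLeft := fun u hu => Subtype.ext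
      (hα.nondegenerate p u u.2 fun v hv => (hB u v).symm.trans (hu ⟨v, hv⟩))
    refine ⟨hl, fun u hu => hl u fun v => ?_⟩
    exact (hanti u v).trans (by rw [show B v u = 0 from hu v, neg_zero])
  let T : V →ₗ[ℝ] K := D.codRestrict K hker
  have hT : Function.Injective T := fun u v h => hD (congrArg Subtype.val h)
  have hTfr : Module.finrank ℝ (LinearMap.range T) = n := by
    rw [LinearMap.finrank_range_of_inj hT, hV]
  have hle : LinearMap.range T ≤ σ.orthogonal (LinearMap.range T) := by
    rintro _ ⟨v, rfl⟩ _ ⟨v', rfl⟩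
    exact (hB _ _).trans (hiso v' v)
  have heq := Submodule.eq_of_le_of_finrank_eq hle (by
    rw [LinearMap.BilinForm.finrank_orthogonal hσ, hK, hTfr]; omega)
  have hmem : (⟨w, hw⟩ : K) ∈ LinearMap.range T := by
    rw [heq]
    rintro _ ⟨v, rfl⟩
    exact (hanti _ _).trans (neg_eq_zero.2 ((hB w (D v)).trans (hort v)))
  obtain ⟨v, hv⟩ := hmem
  exact ⟨v, congrArg Subtype.val hv⟩

end LinearAlgebra

/-! ### The velocity of a positive Legendrian isotopy -/

section Isotopies

open Set

variable {n : ℕ} {M : Type*} [TopologicalSpace M]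
  [ChartedSpace (EuclideanSpace ℝ (Fin (2 * n + 1))) M]
  {L : Type*} [TopologicalSpace L] [ChartedSpace (EuclideanSpace ℝ (Fin n)) L]

/-- The isotopy `(t, x) ↦ j t x` read in the preferred chart of `L` at `x₀`. -/
def isotopyParam (j : ℝ → L → M) (x₀ : L) (z : ℝ × EuclideanSpace ℝ (Fin n)) : M :=
  j z.1 ((extChartAt (𝓡 n) x₀).symm z.2)

/-- The value of `α` on the velocity `∂ₜ j` of the isotopy. The derivative is two-sided, so this is
meaningful only for `t` in the open interval `(0, 1)`. -/
def isotopySpeed (α : OneForm (2 * n + 1) M) (j : ℝ → L → M) (t : ℝ) (x : L) : ℝ :=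
  α (j t x) (mfderiv 𝓘(ℝ, ℝ) (𝓡 (2 * n + 1)) (fun s => j s x) t (1 : ℝ))

namespace IsPositiveLegendrianIsotopy

variable {α : OneForm (2 * n + 1) M} {j : ℝ → L → M}

theorem contMDiffAt (hj : IsPositiveLegendrianIsotopy α j) {t : ℝ} (ht : t ∈ Ioo (0 : ℝ) 1)
    (x : L) :
    ContMDiffAt (𝓘(ℝ, ℝ).prod (𝓡 n)) (𝓡 (2 * n + 1)) ∞ (fun q : ℝ × L => j q.1 q.2) (t, x) :=
  hj.smooth.contMDiffAt (prod_mem_nhds (Icc_mem_nhds ht.1 ht.2) Filter.univ_mem)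

theorem isotopySpeed_pos (hj : IsPositiveLegendrianIsotopy α j) {t : ℝ} (ht : t ∈ Ioo (0 : ℝ) 1)
    (x : L) : 0 < isotopySpeed α j t x := by
  have h := hj.positive t (Ioo_subset_Icc_self ht) x
  rwa [mfderivWithin_of_mem_nhds (Icc_mem_nhds ht.1 ht.2)] at h

theorem exists_leftInverse (hj : IsPositiveLegendrianIsotopy α j) {t : ℝ}
    (ht : t ∈ Icc (0 : ℝ) 1) (x : L) :
    ∃ r : M → L, ContMDiffAt (𝓡 (2 * n + 1)) (𝓡 n) ∞ r (j t x) ∧ ∀ᶠ y in 𝓝 x, r (j t y) = y :=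
  exists_leftInverse_of_isImmersionAt ((hj.embedding t ht).isImmersion.isImmersionAt x)

variable [IsManifold (𝓡 n) ∞ L]

theorem contMDiffAt_isotopyParam (hj : IsPositiveLegendrianIsotopy α j) {t : ℝ}
    (ht : t ∈ Ioo (0 : ℝ) 1) {x₀ : L} {y : EuclideanSpace ℝ (Fin n)}
    (hy : y ∈ (extChartAt (𝓡 n) x₀).target) :
    ContMDiffAt 𝓘(ℝ, ℝ × EuclideanSpace ℝ (Fin n)) (𝓡 (2 * n + 1)) ∞ (isotopyParam j x₀) (t, y) :=
  (hj.contMDiffAt ht ((extChartAt (𝓡 n) x₀).symm y)).comp (t, y)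
    (contDiff_fst.contMDiff.contMDiffAt.prodMk ((contMDiffAt_extChartAt_symm hy).comp
      (t, y) contDiff_snd.contMDiff.contMDiffAt))

theorem mdifferentiableAt_isotopyParam (hj : IsPositiveLegendrianIsotopy α j) {t : ℝ}
    (ht : t ∈ Ioo (0 : ℝ) 1) {x₀ : L} {y : EuclideanSpace ℝ (Fin n)}
    (hy : y ∈ (extChartAt (𝓡 n) x₀).target) :
    MDifferentiableAt 𝓘(ℝ, ℝ × EuclideanSpace ℝ (Fin n)) (𝓡 (2 * n + 1)) (isotopyParam j x₀)
      (t, y) :=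
  (hj.contMDiffAt_isotopyParam ht hy).mdifferentiableAt (by simp)

theorem mfderiv_isotopyParam_right (hj : IsPositiveLegendrianIsotopy α j) {t : ℝ}
    (ht : t ∈ Ioo (0 : ℝ) 1) {x₀ : L} {y : EuclideanSpace ℝ (Fin n)}
    (hy : y ∈ (extChartAt (𝓡 n) x₀).target) (v : EuclideanSpace ℝ (Fin n)) :
    mfderiv 𝓘(ℝ, ℝ × EuclideanSpace ℝ (Fin n)) (𝓡 (2 * n + 1)) (isotopyParam j x₀) (t, y)
      ((0 : ℝ), v) =
    mfderiv (𝓡 n) (𝓡 (2 * n + 1)) (j t) ((extChartAt (𝓡 n) x₀).symm y)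
      (fromChart x₀ y v) := by
  have : IsManifold (𝓡 n) 1 L := IsManifold.of_le (n := ∞) (by simp)
  refine (mfderiv_slice_right (hj.mdifferentiableAt_isotopyParam ht hy) v).trans ?_
  have h1 := ((hj.embedding t (Ioo_subset_Icc_self ht)).contMDiff.mdifferentiable (by simp)
    ((extChartAt (𝓡 n) x₀).symm y)).hasMFDerivAt.comp y
      (mdifferentiableAt_extChartAt_symm (I := 𝓡 n) hy).hasMFDerivAt
  exact DFunLike.congr_fun h1.mfderiv v

theorem pull_isotopyParam_right (hj : IsPositiveLegendrianIsotopy α j) {t : ℝ}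
    (ht : t ∈ Ioo (0 : ℝ) 1) {x₀ : L} {y : EuclideanSpace ℝ (Fin n)}
    (hy : y ∈ (extChartAt (𝓡 n) x₀).target) (v : EuclideanSpace ℝ (Fin n)) :
    α.pull (isotopyParam j x₀) (t, y) ((0 : ℝ), v) = 0 :=
  (congrArg (α (isotopyParam j x₀ (t, y))) (hj.mfderiv_isotopyParam_right ht hy v)).trans
    (hj.legendrian t (Ioo_subset_Icc_self ht) _ _)

theorem pull_isotopyParam_left (hj : IsPositiveLegendrianIsotopy α j) {t : ℝ}
    (ht : t ∈ Ioo (0 : ℝ) 1) {x₀ : L} {y : EuclideanSpace ℝ (Fin n)}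
    (hy : y ∈ (extChartAt (𝓡 n) x₀).target) :
    α.pull (isotopyParam j x₀) (t, y) ((1 : ℝ), 0) =
      isotopySpeed α j t ((extChartAt (𝓡 n) x₀).symm y) := by
  have h := (hasMFDerivAt_slice_left (hj.mdifferentiableAt_isotopyParam ht hy)).mfderiv
  refine congrArg (α (isotopyParam j x₀ (t, y))) ?_
  refine Eq.trans ?_ (DFunLike.congr_fun h (1 : ℝ)).symm
  change mfderiv 𝓘(ℝ, ℝ × EuclideanSpace ℝ (Fin n)) (𝓡 (2 * n + 1)) (isotopyParam j x₀) (t, y)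
      ((1 : ℝ), (0 : EuclideanSpace ℝ (Fin n))) =
    (1 : ℝ) • mfderiv 𝓘(ℝ, ℝ × EuclideanSpace ℝ (Fin n)) (𝓡 (2 * n + 1)) (isotopyParam j x₀) (t, y)
      ((1 : ℝ), (0 : EuclideanSpace ℝ (Fin n)))
  rw [one_smul]

/-- Since the velocity is transverse to the contact structure and the slices are Legendrian
immersions, the isotopy is an immersion in space and time. -/
theorem mfderiv_isotopyParam_injective (hj : IsPositiveLegendrianIsotopy α j) {t : ℝ}
    (ht : t ∈ Ioo (0 : ℝ) 1) {x₀ : L} {y : EuclideanSpace ℝ (Fin n)}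
    (hy : y ∈ (extChartAt (𝓡 n) x₀).target) (v : ℝ × EuclideanSpace ℝ (Fin n))
    (hv : mfderiv 𝓘(ℝ, ℝ × EuclideanSpace ℝ (Fin n)) (𝓡 (2 * n + 1)) (isotopyParam j x₀) (t, y)
      v = 0) : v = 0 := by
  have : IsManifold (𝓡 n) 1 L := IsManifold.of_le (n := ∞) (by simp)
  obtain ⟨a, v⟩ := v
  have h1 : α.pull (isotopyParam j x₀) (t, y) (a, v) = 0 :=
    (congrArg (α (isotopyParam j x₀ (t, y))) hv).trans (map_zero _)
  have h2 : ((a, v) : ℝ × EuclideanSpace ℝ (Fin n)) = a • ((1 : ℝ), 0) + ((0 : ℝ), v) := by simp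
  rw [h2, map_add, map_smul, hj.pull_isotopyParam_right ht hy, hj.pull_isotopyParam_left ht hy,
    add_zero, smul_eq_mul, mul_eq_zero, or_iff_left (hj.isotopySpeed_pos ht _).ne'] at h1
  subst h1
  have h3 := (hj.mfderiv_isotopyParam_right ht hy v).symm.trans hv
  obtain ⟨r, hr, hrj⟩ := hj.exists_leftInverse (Ioo_subset_Icc_self ht)
    ((extChartAt (𝓡 n) x₀).symm y)
  have h4 := mfderiv_injective_of_leftInverse
    ((hj.embedding t (Ioo_subset_Icc_self ht)).contMDiff.mdifferentiable (by simp) _)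
    (hr.mdifferentiableAt (by simp)) hrj h3
  have h5 : v = 0 := by rw [← toChart_fromChart hy v, h4, map_zero]
  rw [h5]
  rfl

/-- Near a point of its trace, the space-time coordinates of the isotopy are the restriction of
a smooth map on `M`. -/
theorem exists_leftInverse_isotopyParam [IsManifold (𝓡 (2 * n + 1)) ∞ M]
    (hj : IsPositiveLegendrianIsotopy α j) {t : ℝ} (ht : t ∈ Ioo (0 : ℝ) 1) (x : L) :
    ∃ g : M → ℝ × EuclideanSpace ℝ (Fin n),
      (∀ᶠ z in 𝓝 (t, extChartAt (𝓡 n) x x), g (isotopyParam j x z) = z) ∧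
      ∀ᶠ p in 𝓝 (j t x),
        ContMDiffAt (𝓡 (2 * n + 1)) 𝓘(ℝ, ℝ × EuclideanSpace ℝ (Fin n)) ∞ g p := by
  have hmem := mem_extChartAt_target (I := 𝓡 n) x
  have h1 : ∀ᶠ z in 𝓝 (t, extChartAt (𝓡 n) x x), ContMDiffAt
      𝓘(ℝ, ℝ × EuclideanSpace ℝ (Fin n)) (𝓡 (2 * n + 1)) ∞ (isotopyParam j x) z := by
    filter_upwards [prod_mem_nhds (isOpen_Ioo.mem_nhds ht)
      ((isOpen_extChartAt_target (I := 𝓡 n) x).mem_nhds hmem)] with z hz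
    exact hj.contMDiffAt_isotopyParam hz.1 hz.2
  obtain ⟨g, hg, hgs⟩ := exists_leftInverse_of_mfderiv_injective h1
    (hj.mfderiv_isotopyParam_injective ht hmem)
  refine ⟨g, hg, ?_⟩
  rwa [isotopyParam, extChartAt_to_inv] at hgs

omit [TopologicalSpace M] [ChartedSpace (EuclideanSpace ℝ (Fin (2 * n + 1))) M]
  [IsManifold (𝓡 n) ∞ L] in
theorem eventually_leftInverse_isotopyParam {t : ℝ} {x : L}
    {g : M → ℝ × EuclideanSpace ℝ (Fin n)}
    (hg : ∀ᶠ z in 𝓝 (t, extChartAt (𝓡 n) x x), g (isotopyParam j x z) = z) :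
    ∀ᶠ q in 𝓝 (t, x), q.2 ∈ (extChartAt (𝓡 n) x).source ∧
      g (j q.1 q.2) = (q.1, extChartAt (𝓡 n) x q.2) := by
  have h1 : ContinuousAt (fun q : ℝ × L => (q.1, extChartAt (𝓡 n) x q.2)) (t, x) :=
    continuousAt_fst.prodMk (ContinuousAt.comp (f := Prod.snd) (x := (t, x))
      (continuousAt_extChartAt (I := 𝓡 n) x) continuousAt_snd)
  have h2 : ∀ᶠ q : ℝ × L in 𝓝 (t, x), q.2 ∈ (extChartAt (𝓡 n) x).source :=
    continuousAt_snd (extChartAt_source_mem_nhds (I := 𝓡 n) x)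
  filter_upwards [h1.eventually hg, h2] with q hq hqs
  rw [isotopyParam, (extChartAt (𝓡 n) x).left_inv hqs] at hq
  exact ⟨hqs, hq⟩

/-- If the Legendrians are moved by the Reeb flow for times near `t₀`, then the velocity of the
isotopy is the Reeb field up to a vector tangent to the Legendrian. -/
theorem isotopySpeed_eq_one [T2Space M] [IsManifold (𝓡 (2 * n + 1)) ∞ M] (hα : IsContactForm α)
    {ψ : ℝ → M → M} (hψ : IsReebFlow α ψ)
    (hj : IsPositiveLegendrianIsotopy α j) {t₀ : ℝ} (ht₀ : t₀ ∈ Ioo (0 : ℝ) 1)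
    (hflow : ∀ᶠ t in 𝓝 t₀, range (j t) = ψ (t - t₀) '' range (j t₀)) (x : L) :
    isotopySpeed α j t₀ x = 1 := by
  have : IsManifold (𝓡 n) 1 L := IsManifold.of_le (n := ∞) (by simp)
  set κ := extChartAt (𝓡 n) x with hκ
  have hmem : κ x ∈ κ.target := mem_extChartAt_target (I := 𝓡 n) x
  have hκx : κ.symm (κ x) = x := extChartAt_to_inv (I := 𝓡 n) x
  have hemb := hj.embedding t₀ (Ioo_subset_Icc_self ht₀)
  have hψs := hψ.contMDiff hα
  obtain ⟨r, hr, hrj⟩ := hj.exists_leftInverse (Ioo_subset_Icc_self ht₀) x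
  -- the trajectory of `x`, moved back to the Legendrian at time `t₀` by the Reeb flow
  let k : ℝ → M := fun t => ψ (t₀ - t) (j t x)
  have hk₀ : k t₀ = j t₀ x := by simp [k, hψ.zero]
  have hcurve : ContMDiffAt 𝓘(ℝ, ℝ) (𝓡 (2 * n + 1)) ∞ (fun t => j t x) t₀ :=
    (hj.contMDiffAt ht₀ x).comp t₀ (contMDiffAt_id.prodMk contMDiffAt_const)
  have hk : ContMDiffAt 𝓘(ℝ, ℝ) (𝓡 (2 * n + 1)) ∞ k t₀ :=
    (hψs.contMDiffAt (x := (t₀ - t₀, j t₀ x))).comp t₀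
      ((contDiff_const.sub contDiff_id).contMDiff.contMDiffAt.prodMk hcurve)
  have hkL : ∀ᶠ t in 𝓝 t₀, j t₀ (r (k t)) = k t := by
    have h1 : ∀ᶠ t in 𝓝 t₀, ∀ y, j t₀ y = k t → r (j t₀ y) = y := by
      have h2 := hemb.isEmbedding.isInducing.nhds_eq_comap x
      rw [h2] at hrj
      obtain ⟨U, hU, hUr⟩ := Filter.mem_comap.1 hrj
      have h3 : ∀ᶠ t in 𝓝 t₀, k t ∈ U := hk.continuousAt (by rwa [hk₀])
      filter_upwards [h3] with t ht y hy
      exact hUr (show j t₀ y ∈ U by rwa [hy])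
    filter_upwards [h1, hflow] with t ht hft
    obtain ⟨q, ⟨y, rfl⟩, hq⟩ : j t x ∈ ψ (t - t₀) '' range (j t₀) := hft ▸ mem_range_self x
    have h2 : k t = j t₀ y := by
      change ψ (t₀ - t) (j t x) = _
      rw [← hq, ← hψ.add hα, show t₀ - t + (t - t₀) = 0 by ring, hψ.zero]
    rw [h2, ht y h2.symm]
  -- the trajectory is the composition of `F` with the curve `c`
  let F : ℝ × EuclideanSpace ℝ (Fin n) → M := fun z => ψ z.1 (j t₀ (κ.symm z.2))
  let c : ℝ → ℝ × EuclideanSpace ℝ (Fin n) := fun t => (t - t₀, κ (r (k t)))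
  have hrx : r (j t₀ x) = x := hrj.self_of_nhds
  have hc₀ : c t₀ = (0, κ x) := by simp only [c, hk₀, hrx, sub_self]
  have hFs : ContMDiffAt 𝓘(ℝ, ℝ × EuclideanSpace ℝ (Fin n)) (𝓡 (2 * n + 1)) ∞ F (0, κ x) :=
    (hψs.contMDiffAt (x := ((0 : ℝ), j t₀ (κ.symm (κ x))))).comp
      ((0 : ℝ), κ x) (contDiff_fst.contMDiff.contMDiffAt.prodMk ((hemb.contMDiff.contMDiffAt.comp
      (κ x) (contMDiffAt_extChartAt_symm hmem)).comp ((0 : ℝ), κ x)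
        contDiff_snd.contMDiff.contMDiffAt))
  have hFd := hFs.mdifferentiableAt (by simp)
  have hcd : DifferentiableAt ℝ c t₀ := by
    have h1 : ContMDiffAt 𝓘(ℝ, ℝ) 𝓘(ℝ, EuclideanSpace ℝ (Fin n)) ∞ (fun t => κ (r (k t))) t₀ := by
      have h2 : ContMDiffAt (𝓡 n) 𝓘(ℝ, EuclideanSpace ℝ (Fin n)) ∞ κ (r (k t₀)) := by
        rw [hk₀, hrx]
        exact contMDiffAt_extChartAt (n := ∞)
      refine h2.comp t₀ (ContMDiffAt.comp t₀ ?_ hk)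
      rwa [hk₀]
    exact (differentiableAt_id.sub_const t₀).prodMk (h1.contDiffAt.differentiableAt (by simp))
  have hFc : (fun t => j t x) =ᶠ[𝓝 t₀] F ∘ c := by
    have h1 : ∀ᶠ t in 𝓝 t₀, r (k t) ∈ κ.source := by
      have h2 : ContinuousAt (fun t => r (k t)) t₀ :=
        ContinuousAt.comp (by rw [hk₀]; exact hr.continuousAt) hk.continuousAt
      refine h2 ?_
      change κ.source ∈ 𝓝 (r (k t₀))
      rw [hk₀, hrx]
      exact extChartAt_source_mem_nhds x
    filter_upwards [h1, hkL] with t ht hkt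
    change j t x = ψ (t - t₀) (j t₀ (κ.symm (κ (r (k t)))))
    rw [κ.left_inv ht, hkt]
    change _ = ψ (t - t₀) (ψ (t₀ - t) (j t x))
    rw [← hψ.add hα, show t - t₀ + (t₀ - t) = 0 by ring, hψ.zero]
  have hF1 : mfderiv 𝓘(ℝ, ℝ × EuclideanSpace ℝ (Fin n)) (𝓡 (2 * n + 1)) F (0, κ x)
      ((1 : ℝ), (0 : EuclideanSpace ℝ (Fin n))) = reebField α (F (0, κ x)) :=
    mfderiv_slice_left hFd (hψ.integralCurve _ 0)
  have hF2 : ∀ v : EuclideanSpace ℝ (Fin n), α.pull F (0, κ x) ((0 : ℝ), v) = 0 := by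
    intro v
    have h1 : (fun y => F (0, y)) = fun y => j t₀ (κ.symm y) := funext fun y => hψ.zero _
    have h2 := (hemb.contMDiff.mdifferentiable (by simp) (κ.symm (κ x))).hasMFDerivAt.comp (κ x)
      (mdifferentiableAt_extChartAt_symm (I := 𝓡 n) hmem).hasMFDerivAt
    have h3 := mfderiv_slice_right hFd v
    have h4 : ∀ (G : EuclideanSpace ℝ (Fin n) → M), G = (fun y => j t₀ (κ.symm y)) →
        α (G (κ x)) (mfderiv 𝓘(ℝ, EuclideanSpace ℝ (Fin n)) (𝓡 (2 * n + 1)) G (κ x) v) = 0 := by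
      rintro G rfl
      refine (congrArg (α (j t₀ (κ.symm (κ x)))) (DFunLike.congr_fun h2.mfderiv v)).trans ?_
      exact hj.legendrian t₀ (Ioo_subset_Icc_self ht₀) _ _
    exact (congrArg (α (F (0, κ x))) h3).trans (h4 _ h1)
  have h1 : ∀ a : ℝ, ∀ v : EuclideanSpace ℝ (Fin n), α.pull F (0, κ x) (a, v) = a := by
    intro a v
    have h2 : ((a, v) : ℝ × EuclideanSpace ℝ (Fin n)) = a • ((1 : ℝ), 0) + ((0 : ℝ), v) := by simp
    rw [h2, map_add, map_smul, hF2, OneForm.pull_apply, hF1,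
      (hα.isReebVector_reebField _).1, add_zero, smul_eq_mul, mul_one]
  have hc1 : (deriv c t₀).1 = 1 := by
    have h2 := hasFDerivAt_fst.comp_hasDerivAt t₀ hcd.hasDerivAt
    have h3 : HasDerivAt (fun t : ℝ => t - t₀) 1 t₀ := (hasDerivAt_id t₀).sub_const t₀
    exact h2.unique h3
  have hspeed : ∀ k : ℝ → M, k =ᶠ[𝓝 t₀] F ∘ c → α (k t₀) (mfderiv 𝓘(ℝ, ℝ) (𝓡 (2 * n + 1)) k t₀
      (1 : ℝ)) = α.pull F (c t₀) (deriv c t₀) := by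
    intro k hk
    have h2 : MDifferentiableAt 𝓘(ℝ, ℝ × EuclideanSpace ℝ (Fin n)) (𝓡 (2 * n + 1)) F (c t₀) := by
      rw [hc₀]; exact hFd
    have h3 := h2.hasMFDerivAt.comp t₀ hcd.hasDerivAt.hasFDerivAt.hasMFDerivAt
    have h4 := (h3.congr_of_eventuallyEq hk).mfderiv
    have h5 := DFunLike.congr_fun h4 (1 : ℝ)
    have h6 : ∀ p : M, p = F (c t₀) → ∀ w w' : EuclideanSpace ℝ (Fin (2 * n + 1)), w = w' →
      α p w = α (F (c t₀)) w' := by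
      rintro p rfl w w' rfl
      rfl
    refine h6 _ hk.eq_of_nhds _ _ (h5.trans ?_)
    change mfderiv 𝓘(ℝ, ℝ × EuclideanSpace ℝ (Fin n)) (𝓡 (2 * n + 1)) F (c t₀)
      ((1 : ℝ) • deriv c t₀) = mfderiv 𝓘(ℝ, ℝ × EuclideanSpace ℝ (Fin n)) (𝓡 (2 * n + 1)) F (c t₀)
      (deriv c t₀)
    rw [one_smul]
    rfl
  have h2 := hspeed _ hFc
  rw [hc₀, show deriv c t₀ = ((1 : ℝ), (deriv c t₀).2) from Prod.ext hc1 rfl, h1] at h2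
  exact h2

end IsPositiveLegendrianIsotopy

end Isotopies

/-! ### The contact Hamiltonian of a Legendrian isotopy -/

section Hamiltonians

open Set

variable {n : ℕ} {M : Type*} [TopologicalSpace M] [T2Space M]
  [ChartedSpace (EuclideanSpace ℝ (Fin (2 * n + 1))) M] [IsManifold (𝓡 (2 * n + 1)) ∞ M]
  {L : Type*} [TopologicalSpace L] [ChartedSpace (EuclideanSpace ℝ (Fin n)) L]
  [IsManifold (𝓡 n) ∞ L] [CompactSpace L] {α : OneForm (2 * n + 1) M} {j : ℝ → L → M}

namespace IsPositiveLegendrianIsotopy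

/-- Legendrians of the isotopy at nearby different times are disjoint: the isotopy is locally
injective in space and time, and each `j t` is injective. -/
theorem exists_separation (hj : IsPositiveLegendrianIsotopy α j) {a b : ℝ}
    (hab : Icc a b ⊆ Ioo 0 1) :
    ∃ δ > 0, ∀ t ∈ Icc a b, ∀ t' ∈ Icc a b, ∀ x x', |t - t'| < δ → j t x = j t' x' →
      ((t, x) : ℝ × L) = (t', x') := by
  have hT2 : T2Space L := (hj.embedding 0 (by simp)).isEmbedding.t2Space
  let J : ℝ × L → M := fun q => j q.1 q.2
  set C : Set (ℝ × L) := Icc a b ×ˢ univ with hC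
  have hCc : IsCompact C := isCompact_Icc.prod isCompact_univ
  have hJ : ContinuousOn J C := fun q hq =>
    (hj.contMDiffAt (hab hq.1) q.2).continuousAt.continuousWithinAt
  let O : Set ((ℝ × L) × (ℝ × L)) :=
    ⋃ (U : Set (ℝ × L)) (_ : IsOpen U ∧ InjOn J U), U ×ˢ U
  have hO : IsOpen O := isOpen_biUnion fun U hU => hU.1.prod hU.1
  have hdiag : ∀ q ∈ C, (q, q) ∈ O := by
    rintro ⟨t, x⟩ hq
    obtain ⟨g, hg, -⟩ := hj.exists_leftInverse_isotopyParam (hab hq.1) x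
    obtain ⟨U, hUsub, hU, hqU⟩ := mem_nhds_iff.1 (eventually_leftInverse_isotopyParam hg)
    refine mem_biUnion (x := U) ⟨hU, fun p hp p' hp' hpp => ?_⟩ ⟨hqU, hqU⟩
    obtain ⟨h1, h2⟩ := hUsub hp
    obtain ⟨h1', h2'⟩ := hUsub hp'
    have h3 : (p.1, extChartAt (𝓡 n) x p.2) = (p'.1, extChartAt (𝓡 n) x p'.2) :=
      h2.symm.trans ((congrArg g hpp).trans h2')
    obtain ⟨h4, h5⟩ := Prod.mk.inj h3
    exact Prod.ext h4 ((extChartAt (𝓡 n) x).injOn h1 h1' h5)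
  have hS : IsCompact ((C ×ˢ C ∩ (fun z => (J z.1, J z.2)) ⁻¹' diagonal M) ∩ Oᶜ) := by
    have h1 : ContinuousOn (fun z : (ℝ × L) × (ℝ × L) => (J z.1, J z.2)) (C ×ˢ C) :=
      (hJ.comp continuousOn_fst fun z hz => hz.1).prodMk
        (hJ.comp continuousOn_snd fun z hz => hz.2)
    have h2 := h1.preimage_isClosed_of_isClosed (hCc.prod hCc).isClosed isClosed_diagonal
    exact ((hCc.prod hCc).of_isClosed_subset h2 inter_subset_left).inter_right hO.isClosed_compl
  obtain ⟨δ, hδ, hle⟩ := hS.exists_forall_le' (f := fun z => |z.1.1 - z.2.1|) (a := 0)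
    (by fun_prop) (by
      rintro ⟨⟨t, x⟩, t', x'⟩ ⟨⟨⟨h1, h2⟩, h3⟩, h4⟩
      refine abs_pos.2 (sub_ne_zero.2 fun htt => h4 ?_)
      change t = t' at htt
      subst htt
      have hxx : x = x' :=
        (hj.embedding t (Ioo_subset_Icc_self (hab h1.1))).isEmbedding.injective h3
      subst hxx
      exact hdiag _ h1)
  refine ⟨δ, hδ, fun t ht t' ht' x x' hlt heq => ?_⟩
  have hmem : (((t, x), (t', x')) : (ℝ × L) × (ℝ × L)) ∈ O := by
    by_contra hcon
    exact absurd (hle ((t, x), (t', x'))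
      ⟨⟨⟨⟨ht, mem_univ _⟩, ⟨ht', mem_univ _⟩⟩, heq⟩, hcon⟩) (not_le.2 hlt)
  obtain ⟨U, ⟨-, hinj⟩, hU1, hU2⟩ := mem_iUnion₂.1 hmem
  exact hinj hU1 hU2 heq

omit [T2Space M] [CompactSpace L] in
/-- Near a point of its trace, the speed of the isotopy is the restriction of a smooth function
on `M`, which does not depend on time. -/
theorem exists_local_extension_isotopySpeed (hα : IsContactForm α)
    (hj : IsPositiveLegendrianIsotopy α j) {t : ℝ} (ht : t ∈ Ioo (0 : ℝ) 1) (x : L) :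
    ∃ f : M → ℝ, (∀ᶠ p in 𝓝 (j t x), ContMDiffAt (𝓡 (2 * n + 1)) 𝓘(ℝ, ℝ) ∞ f p ∧ 0 < f p) ∧
      ∀ᶠ q in 𝓝 (t, x), f (j q.1 q.2) = isotopySpeed α j q.1 q.2 := by
  obtain ⟨g, hg, hgs⟩ := hj.exists_leftInverse_isotopyParam ht x
  have hgx := eventually_leftInverse_isotopyParam hg
  have hgx₀ : g (j t x) = (t, extChartAt (𝓡 n) x x) := hgx.self_of_nhds.2
  have hmem := mem_extChartAt_target (I := 𝓡 n) x
  let f : M → ℝ := fun p => α.pull (isotopyParam j x) (g p)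
    ((1 : ℝ), (0 : EuclideanSpace ℝ (Fin n)))
  have hsm : ∀ᶠ p in 𝓝 (j t x), ContMDiffAt (𝓡 (2 * n + 1)) 𝓘(ℝ, ℝ) ∞ f p := by
    have h1 : ∀ᶠ p in 𝓝 (j t x), g p ∈ Ioo (0 : ℝ) 1 ×ˢ (extChartAt (𝓡 n) x).target := by
      refine hgs.self_of_nhds.continuousAt ?_
      rw [hgx₀]
      exact prod_mem_nhds (isOpen_Ioo.mem_nhds ht)
        ((isOpen_extChartAt_target (I := 𝓡 n) x).mem_nhds hmem)
    filter_upwards [h1, hgs] with p hp hps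
    have h2 : ContDiffAt ℝ ∞ (fun z => α.pull (isotopyParam j x) z
        ((1 : ℝ), (0 : EuclideanSpace ℝ (Fin n)))) (g p) :=
      (hα.smooth.contDiffAt_pull (hj.contMDiffAt_isotopyParam (t := (g p).1) (y := (g p).2)
        hp.1 hp.2)).clm_apply contDiffAt_const
    exact h2.contMDiffAt.comp p hps
  have hval : ∀ᶠ q in 𝓝 (t, x), f (j q.1 q.2) = isotopySpeed α j q.1 q.2 := by
    have h1 : ∀ᶠ q : ℝ × L in 𝓝 (t, x), q.1 ∈ Ioo (0 : ℝ) 1 :=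
      continuousAt_fst (isOpen_Ioo.mem_nhds ht)
    filter_upwards [hgx, h1] with q hq hq1
    change α.pull (isotopyParam j x) (g (j q.1 q.2)) ((1 : ℝ), (0 : EuclideanSpace ℝ (Fin n))) = _
    rw [hq.2, hj.pull_isotopyParam_left hq1 ((extChartAt (𝓡 n) x).map_source hq.1),
      (extChartAt (𝓡 n) x).left_inv hq.1]
  refine ⟨f, hsm.and ?_, hval⟩
  refine hsm.self_of_nhds.continuousAt (isOpen_Ioi.mem_nhds (?_ : 0 < f (j t x)))
  rw [show f (j t x) = _ from hval.self_of_nhds]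
  exact hj.isotopySpeed_pos ht x

/-- The speed of the isotopy extends to a positive smooth function of time and space that is
locally independent of time along the trace of the isotopy, and equal to one for times near the
ends and off a compact set. -/
theorem exists_extension_isotopySpeed [SigmaCompactSpace M] (hα : IsContactForm α)
    (hj : IsPositiveLegendrianIsotopy α j) {ε : ℝ} (hε : 0 < ε)
    (hone : ∀ t ∈ Ioo (0 : ℝ) 1, t < ε ∨ 1 - ε < t → ∀ x, isotopySpeed α j t x = 1) :
    ∃ (H : ℝ → M → ℝ) (K : Set M) (δ : ℝ),
      ContMDiff (𝓘(ℝ, ℝ).prod (𝓡 (2 * n + 1))) 𝓘(ℝ, ℝ) ∞ (fun q : ℝ × M => H q.1 q.2) ∧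
      IsCompact K ∧ 0 < δ ∧ (∀ s p, 0 < H s p) ∧
      (∀ s p, s ≤ ε / 2 ∨ 1 - ε / 2 ≤ s ∨ p ∉ K → H s p = 1) ∧
      ∀ t ∈ Icc (ε / 4) (1 - ε / 4), ∀ x s, |s - t| < δ → H s (j t x) = isotopySpeed α j t x := by
  have hab : Icc (ε / 4) (1 - ε / 4) ⊆ Ioo (0 : ℝ) 1 := fun t ht =>
    ⟨by linarith [ht.1], by linarith [ht.2]⟩
  obtain ⟨δ₀, hδ₀, hsep⟩ := hj.exists_separation hab
  obtain ⟨δ, hδ, hδε, hδδ⟩ : ∃ δ > 0, δ ≤ ε / 4 ∧ 2 * δ < δ₀ :=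
    ⟨min (ε / 4) (δ₀ / 3), by positivity, min_le_left _ _, by
      linarith [min_le_right (ε / 4) (δ₀ / 3)]⟩
  let J : ℝ × L → M := fun q => j q.1 q.2
  set C : Set (ℝ × L) := Icc (ε / 4) (1 - ε / 4) ×ˢ univ with hC
  have hCc : IsCompact C := isCompact_Icc.prod isCompact_univ
  have hJ : ContinuousOn J C := fun q hq =>
    (hj.contMDiffAt (hab hq.1) q.2).continuousAt.continuousWithinAt
  have hN : IsCompact (J '' C) := hCc.image_of_continuousOn hJ
  have : LocallyCompactSpace M :=
    ChartedSpace.locallyCompactSpace (EuclideanSpace ℝ (Fin (2 * n + 1))) M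
  obtain ⟨K, hK, hNK⟩ := exists_compact_superset hN
  -- the points of space-time within time `δ` of the trace of `D`
  let V : Set (ℝ × L) → Set (ℝ × M) := fun D =>
    (fun w : (ℝ × L) × ℝ => (w.1.1 + w.2, J w.1)) '' (D ×ˢ Icc (-δ) δ)
  have hV : ∀ D, IsCompact D → D ⊆ C → IsClosed (V D) := fun D hD hDC =>
    ((hD.prod isCompact_Icc).image_of_continuousOn (ContinuousOn.prodMk (by fun_prop)
      ((hJ.mono hDC).comp continuousOn_fst fun w hw => hw.1))).isClosed
  have hmemV : ∀ {D : Set (ℝ × L)} {s t : ℝ} {x : L}, (t, x) ∈ D → |s - t| < δ →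
      (s, j t x) ∈ V D := fun {D s t x} hD hst =>
    ⟨((t, x), s - t), ⟨hD, abs_le.1 hst.le⟩, by simp [J]⟩
  -- the conditions imposed on the value of the extension at a point
  let T : ℝ × M → Set ℝ := fun q => {c | 0 < c ∧
    (∀ t ∈ Icc (ε / 4) (1 - ε / 4), ∀ x, |q.1 - t| < δ → j t x = q.2 → c = isotopySpeed α j t x) ∧
    (q.1 ≤ ε / 2 ∨ 1 - ε / 2 ≤ q.1 ∨ q.2 ∉ K → c = 1)}
  have hT : ∀ q, Convex ℝ (T q) := by
    intro q c hc c' hc' u v hu hv huv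
    have hcomb : ∀ k : ℝ, c = k → c' = k → u • c + v • c' = k := by
      rintro k rfl rfl
      rw [← add_smul, huv, one_smul]
    refine ⟨(convex_Ioi (0 : ℝ)) hc.1 hc'.1 hu hv huv, fun t ht x hq hx => ?_, fun hq => ?_⟩
    · exact hcomb _ (hc.2.1 t ht x hq hx) (hc'.2.1 t ht x hq hx)
    · exact hcomb _ (hc.2.2 hq) (hc'.2.2 hq)
  have hloc : ∀ q₀ : ℝ × M, ∃ U ∈ 𝓝 q₀, ∃ g : ℝ × M → ℝ,
      ContMDiffOn (𝓘(ℝ, ℝ).prod (𝓡 (2 * n + 1))) 𝓘(ℝ, ℝ) ∞ g U ∧ ∀ q ∈ U, g q ∈ T q := by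
    rintro ⟨s₀, p₀⟩
    -- it suffices that one is an admissible value near the given point
    have hconst : (∀ᶠ q : ℝ × M in 𝓝 (s₀, p₀), ∀ t ∈ Icc (ε / 4) (1 - ε / 4), ∀ x,
        |q.1 - t| < δ → j t x = q.2 → isotopySpeed α j t x = 1) →
        ∃ U ∈ 𝓝 (s₀, p₀), ∃ g : ℝ × M → ℝ,
        ContMDiffOn (𝓘(ℝ, ℝ).prod (𝓡 (2 * n + 1))) 𝓘(ℝ, ℝ) ∞ g U ∧ ∀ q ∈ U, g q ∈ T q :=
      fun h => ⟨_, h, fun _ => 1, contMDiffOn_const, fun q hq =>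
        ⟨one_pos, fun t ht x h1 h2 => (hq t ht x h1 h2).symm, fun _ => rfl⟩⟩
    by_cases hs₁ : s₀ < 3 * ε / 4
    · refine hconst ?_
      have h1 : ∀ᶠ q : ℝ × M in 𝓝 (s₀, p₀), q.1 < 3 * ε / 4 :=
        (isOpen_Iio.preimage continuous_fst).mem_nhds hs₁
      filter_upwards [h1] with q hq t ht x hqt _
      exact hone t (hab ht) (Or.inl (by linarith [(abs_lt.1 hqt).1])) x
    by_cases hs₂ : 1 - 3 * ε / 4 < s₀
    · refine hconst ?_
      have h1 : ∀ᶠ q : ℝ × M in 𝓝 (s₀, p₀), 1 - 3 * ε / 4 < q.1 :=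
        (isOpen_Ioi.preimage continuous_fst).mem_nhds hs₂
      filter_upwards [h1] with q hq t ht x hqt _
      exact hone t (hab ht) (Or.inr (by linarith [(abs_lt.1 hqt).2])) x
    by_cases hV₀ : (s₀, p₀) ∈ V C
    swap
    · refine hconst ?_
      filter_upwards [(hV C hCc subset_rfl).isOpen_compl.mem_nhds hV₀] with q hq t ht x hqt hx
      exact absurd (by
        have := hmemV (D := C) (s := q.1) (t := t) (x := x) ⟨ht, mem_univ _⟩ hqt
        rwa [hx] at this) hq
    obtain ⟨⟨⟨t₀, x₀⟩, r⟩, ⟨hq₀, hr⟩, hqr⟩ := hV₀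
    obtain ⟨hsr, hpr⟩ := Prod.mk.inj hqr
    change j t₀ x₀ = p₀ at hpr
    change t₀ + r = s₀ at hsr
    obtain ⟨f, hf, hfval⟩ := hj.exists_local_extension_isotopySpeed hα (hab hq₀.1) x₀
    obtain ⟨O, hOsub, hO, hmemO⟩ := mem_nhds_iff.1 hfval
    have hVO : (s₀, p₀) ∉ V (C \ O) := by
      rintro ⟨⟨⟨t, x⟩, r'⟩, ⟨⟨hqC, hqO⟩, hr'⟩, hqr'⟩
      obtain ⟨hsr', hpr'⟩ := Prod.mk.inj hqr'
      change j t x = p₀ at hpr'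
      change t + r' = s₀ at hsr'
      refine hqO ?_
      rw [hsep t hqC.1 t₀ hq₀.1 x x₀ ?_ (hpr'.trans hpr.symm)]
      · exact hmemO
      · rw [abs_lt]
        constructor <;> linarith [hr.1, hr.2, hr'.1, hr'.2]
    have h1 : ∀ᶠ q : ℝ × M in 𝓝 (s₀, p₀), q.1 ∈ Ioo (ε / 2) (1 - ε / 2) :=
      continuousAt_fst (isOpen_Ioo.mem_nhds ⟨by linarith, by linarith⟩)
    have h2 : ∀ᶠ q : ℝ × M in 𝓝 (s₀, p₀), q.2 ∈ K := by
      refine continuousAt_snd (Filter.mem_of_superset (isOpen_interior.mem_nhds (hNK ?_))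
        interior_subset)
      exact ⟨(t₀, x₀), hq₀, hpr⟩
    have h3 : ∀ᶠ q : ℝ × M in 𝓝 (s₀, p₀),
        ContMDiffAt (𝓡 (2 * n + 1)) 𝓘(ℝ, ℝ) ∞ f q.2 ∧ 0 < f q.2 := by
      rw [hpr] at hf
      exact (continuous_snd.tendsto (s₀, p₀)).eventually hf
    have h4 := (hV (C \ O) (hCc.diff hO) sdiff_subset).isOpen_compl.mem_nhds hVO
    refine ⟨_, (h1.and (h2.and (h3.and h4))), fun q => f q.2, fun q hq => ?_, fun q hq => ?_⟩
    · exact (hq.2.2.1.1.comp q contMDiffAt_snd).contMDiffWithinAt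
    · obtain ⟨hq1, hq2, ⟨-, hq3⟩, hq4⟩ := hq
      refine ⟨hq3, fun t ht x hqt hx => ?_, fun hcon => ?_⟩
      · have hO' : (t, x) ∈ O := by
          by_contra hcon
          refine hq4 ?_
          have := hmemV (D := C \ O) (s := q.1) ⟨⟨ht, mem_univ x⟩, hcon⟩ hqt
          rwa [hx] at this
        change f q.2 = _
        rw [← hx]
        exact hOsub hO'
      · rcases hcon with h | h | h
        · exact absurd hq1.1 (not_lt.2 h)
        · exact absurd hq1.2 (not_lt.2 h)
        · exact absurd hq2 h
  obtain ⟨g, hg⟩ := exists_contMDiffMap_forall_mem_convex_of_local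
    (𝓘(ℝ, ℝ).prod (𝓡 (2 * n + 1))) hT hloc
  exact ⟨fun s p => g (s, p), K, δ, g.contMDiff, hK, hδ, fun s p => (hg (s, p)).1,
    fun s p => (hg (s, p)).2.2, fun t ht x s hst => (hg (s, j t x)).2.1 t ht x hst rfl⟩

/-- There is a time-periodic positive contact Hamiltonian that restricts to the speed of the
isotopy along its trace, is locally constant in time there, and equals one near integer times and
off a compact set. -/
theorem exists_contactHamiltonian [SigmaCompactSpace M] (hα : IsContactForm α)
    (hj : IsPositiveLegendrianIsotopy α j) {ε : ℝ} (hε : 0 < ε) (hε1 : ε ≤ 1)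
    (hone : ∀ t ∈ Ioo (0 : ℝ) 1, t < ε ∨ 1 - ε < t → ∀ x, isotopySpeed α j t x = 1) :
    ∃ (h : ℝ → M → ℝ) (K : Set M),
      ContMDiff (𝓘(ℝ, ℝ).prod (𝓡 (2 * n + 1))) 𝓘(ℝ, ℝ) ∞ (fun q : ℝ × M => h q.1 q.2) ∧
      IsCompact K ∧ (∀ t p, 0 < h t p) ∧ (∀ t p, h (t + 1) p = h t p) ∧
      (∀ t, ∀ p ∉ K, h t p = 1) ∧ (∀ t, |t| < ε / 2 → ∀ p, h t p = 1) ∧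
      ∀ t ∈ Ioo (0 : ℝ) 1, ∀ x, ∀ᶠ s in 𝓝 t, h s (j t x) = isotopySpeed α j t x := by
  obtain ⟨H, K, δ, hH, hK, hδ, hpos, hH1, hHj⟩ := hj.exists_extension_isotopySpeed hα hε hone
  -- near each period the periodic extension is a translate of `H`
  have hfract : ∀ (k : ℤ) (t : ℝ) (p : M), t ∈ Ioo ((k : ℝ) - ε / 2) (k + 1) →
      H (Int.fract t) p = H (t - k) p := by
    intro k t p ht
    rcases le_or_gt (k : ℝ) t with h | h
    · have : Int.fract t = t - k := Int.fract_eq_iff.2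
        ⟨by linarith, by linarith [ht.2], k, by ring⟩
      rw [this]
    · have : Int.fract t = t - k + 1 := Int.fract_eq_iff.2
        ⟨by linarith [ht.1], by linarith, k - 1, by push_cast; ring⟩
      rw [this, hH1 _ _ (Or.inr (Or.inl (by linarith [ht.1]))),
        hH1 _ _ (Or.inl (by linarith))]
  have hnear : ∀ t, |t| < ε / 2 → ∀ p, H (Int.fract t) p = 1 := by
    intro t ht p
    obtain ⟨h1, h2⟩ := abs_lt.1 ht
    rw [hfract 0 t p ⟨by simpa using h1, by push_cast; linarith⟩]
    exact hH1 _ _ (Or.inl (by push_cast; linarith))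
  refine ⟨fun t p => H (Int.fract t) p, K, ?_, hK, fun t p => hpos _ _, fun t p => ?_,
    fun t p hp => hH1 _ _ (Or.inr (Or.inr hp)), hnear, fun t ht x => ?_⟩
  · rintro ⟨t₀, p₀⟩
    have h1 : ContMDiff (𝓘(ℝ, ℝ).prod (𝓡 (2 * n + 1))) 𝓘(ℝ, ℝ) ∞
        (fun q : ℝ × M => H (q.1 - ⌊t₀⌋) q.2) :=
      hH.comp ((contMDiff_fst.sub contMDiff_const).prodMk contMDiff_snd)
    refine h1.contMDiffAt.congr_of_eventuallyEq ?_
    have h2 : ∀ᶠ q : ℝ × M in 𝓝 (t₀, p₀), q.1 ∈ Ioo ((⌊t₀⌋ : ℝ) - ε / 2) (⌊t₀⌋ + 1) :=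
      continuousAt_fst (isOpen_Ioo.mem_nhds
        ⟨by linarith [Int.floor_le t₀], Int.lt_floor_add_one t₀⟩)
    filter_upwards [h2] with q hq
    exact hfract _ _ _ hq
  · simp only [Int.fract_add_one]
  · by_cases h1 : t < ε / 2
    · filter_upwards [Ioo_mem_nhds (a := -(ε / 2)) (by linarith [ht.1]) h1] with s hs
      rw [hone t ht (Or.inl (by linarith))]
      exact hnear s (abs_lt.2 hs) _
    by_cases h2 : 1 - ε / 2 < t
    · filter_upwards [Ioo_mem_nhds h2 ht.2] with s hs
      rw [hone t ht (Or.inr (by linarith))]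
      have : Int.fract s = s := Int.fract_eq_self.2 ⟨by linarith [hs.1], hs.2⟩
      exact hH1 _ _ (Or.inr (Or.inl (by rw [this]; exact hs.1.le)))
    filter_upwards [Ioo_mem_nhds ht.1 ht.2, Metric.ball_mem_nhds t hδ] with s hs hst
    have : Int.fract s = s := Int.fract_eq_self.2 ⟨hs.1.le, hs.2⟩
    change H (Int.fract s) (j t x) = _
    rw [this]
    exact hHj t ⟨by linarith, by linarith⟩ x s (by rwa [← Real.dist_eq])

end IsPositiveLegendrianIsotopy

end Hamiltonians

/-! ### Invariance of the Legendrians under the contact isotopy -/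

section Invariance

open Set

variable {n : ℕ} {M : Type*} [TopologicalSpace M]
  [ChartedSpace (EuclideanSpace ℝ (Fin (2 * n + 1))) M] [IsManifold (𝓡 (2 * n + 1)) ∞ M]
  {L : Type*} [TopologicalSpace L] [ChartedSpace (EuclideanSpace ℝ (Fin n)) L]
  [IsManifold (𝓡 n) ∞ L] {α : OneForm (2 * n + 1) M} {j : ℝ → L → M}

namespace IsPositiveLegendrianIsotopy

/-- If the contact Hamiltonian restricts to the speed of the isotopy, then its contact vector
field is the velocity of the isotopy up to a vector tangent to the Legendrian: the difference lies
in the contact hyperplane and is `dα`-orthogonal to the Legendrian. -/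
theorem exists_contactHamiltonianField_eq (hα : IsContactForm α)
    (hj : IsPositiveLegendrianIsotopy α j) {h : ℝ → M → ℝ}
    (hh : ContMDiff (𝓘(ℝ, ℝ).prod (𝓡 (2 * n + 1))) 𝓘(ℝ, ℝ) ∞ (fun q : ℝ × M => h q.1 q.2))
    (hval : ∀ t ∈ Ioo (0 : ℝ) 1, ∀ x, h t (j t x) = isotopySpeed α j t x)
    {t : ℝ} (ht : t ∈ Ioo (0 : ℝ) 1) {x₀ : L} {y : EuclideanSpace ℝ (Fin n)}
    (hy : y ∈ (extChartAt (𝓡 n) x₀).target) :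
    ∃ u : EuclideanSpace ℝ (Fin n),
      mfderiv 𝓘(ℝ, ℝ × EuclideanSpace ℝ (Fin n)) (𝓡 (2 * n + 1)) (isotopyParam j x₀) (t, y)
        ((1 : ℝ), u) = contactHamiltonianField α (h t) (isotopyParam j x₀ (t, y)) := by
  set F : ℝ × EuclideanSpace ℝ (Fin n) → M := isotopyParam j x₀ with hF
  set p := F (t, y) with hp
  let D : ℝ × EuclideanSpace ℝ (Fin n) →L[ℝ] TangentSpace (𝓡 (2 * n + 1)) p :=
    mfderiv 𝓘(ℝ, ℝ × EuclideanSpace ℝ (Fin n)) (𝓡 (2 * n + 1)) F (t, y)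
  have hFs := hj.contMDiffAt_isotopyParam ht hy
  have hFd := hj.mdifferentiableAt_isotopyParam ht hy
  obtain ⟨B, hB, hB0⟩ := α.d_bilin p
  set X := contactHamiltonianField α (h t) p with hX
  obtain ⟨hX1, hX2⟩ := hα.isContactHamiltonianVector_field (h t) p
  rw [← hX] at hX1 hX2
  have hnear : ∀ᶠ z in 𝓝 (t, y), z ∈ Ioo (0 : ℝ) 1 ×ˢ (extChartAt (𝓡 n) x₀).target :=
    prod_mem_nhds (isOpen_Ioo.mem_nhds ht) ((isOpen_extChartAt_target (I := 𝓡 n) x₀).mem_nhds hy)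
  have hP : DifferentiableAt ℝ (α.pull F) (t, y) :=
    (hα.smooth.contDiffAt_pull hFs).differentiableAt (by simp)
  have happ : ∀ a b : ℝ × EuclideanSpace ℝ (Fin n),
      fderiv ℝ (α.pull F) (t, y) a b = fderiv ℝ (fun z => α.pull F z b) (t, y) a := fun a b => by
    rw [fderiv_clm_apply hP (differentiableAt_const b)]
    simp
  have hright : ∀ v : EuclideanSpace ℝ (Fin n), α p (D ((0 : ℝ), v)) = 0 := fun v =>
    hj.pull_isotopyParam_right ht hy v
  have hd1 : ∀ (a : ℝ × EuclideanSpace ℝ (Fin n)) (v : EuclideanSpace ℝ (Fin n)),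
      fderiv ℝ (α.pull F) (t, y) a ((0 : ℝ), v) = 0 := by
    intro a v
    have h1 : (fun z => α.pull F z ((0 : ℝ), v)) =ᶠ[𝓝 (t, y)] fun _ => (0 : ℝ) := by
      filter_upwards [hnear] with z hz
      exact hj.pull_isotopyParam_right hz.1 hz.2 v
    rw [happ, h1.fderiv_eq]
    simp
  have hd2 : ∀ v : EuclideanSpace ℝ (Fin n),
      fderiv ℝ (α.pull F) (t, y) ((0 : ℝ), v) ((1 : ℝ), 0) =
        differential (h t) p (D ((0 : ℝ), v)) := by
    intro v
    have h1 : (fun z => α.pull F z ((1 : ℝ), (0 : EuclideanSpace ℝ (Fin n)))) =ᶠ[𝓝 (t, y)]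
        fun z => h z.1 (F z) := by
      filter_upwards [hnear] with z hz
      exact (hj.pull_isotopyParam_left hz.1 hz.2).trans (hval z.1 hz.1 _).symm
    have h2 : ContDiffAt ℝ ∞ (fun z : ℝ × EuclideanSpace ℝ (Fin n) => h z.1 (F z)) (t, y) :=
      (ContMDiffAt.comp (t, y) (g := fun q : ℝ × M => h q.1 q.2) (hh.contMDiffAt (x := (t, p)))
        (contDiff_fst.contMDiff.contMDiffAt.prodMk hFs)).contDiffAt
    have h3 : HasFDerivAt (fun z : EuclideanSpace ℝ (Fin n) => h t (F (t, z)))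
        ((fderiv ℝ (fun z : ℝ × EuclideanSpace ℝ (Fin n) => h z.1 (F z)) (t, y)).comp
          (ContinuousLinearMap.inr ℝ ℝ _)) y :=
      HasFDerivAt.comp (f := fun z => (t, z)) y (h2.differentiableAt (by simp)).hasFDerivAt
        (hasFDerivAt_prodMk_right t y)
    have hslice : MDifferentiableAt (𝓡 (2 * n + 1)) 𝓘(ℝ, ℝ) (h t) p :=
      (hh.comp ((contMDiff_const (c := t)).prodMk contMDiff_id)).mdifferentiable (by simp) _
    let D' : EuclideanSpace ℝ (Fin n) →L[ℝ] ℝ :=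
      (differential (h t) p).comp (D.comp (ContinuousLinearMap.inr ℝ ℝ (EuclideanSpace ℝ (Fin n))))
    have h4 : HasFDerivAt (fun z : EuclideanSpace ℝ (Fin n) => h t (F (t, z))) D' y :=
      (hslice.hasMFDerivAt.comp y (hasMFDerivAt_slice_right hFd)).hasFDerivAt
    rw [happ, h1.fderiv_eq]
    exact DFunLike.congr_fun (h3.unique h4) v
  have hnat : ∀ a b : ℝ × EuclideanSpace ℝ (Fin n), fderiv ℝ (α.pull F) (t, y) a b -
      fderiv ℝ (α.pull F) (t, y) b a = B (D a) (D b) := fun a b =>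
    (hα.smooth.fderiv_pull_antisymm hFs a b).trans (hB _ _).symm
  let S : EuclideanSpace ℝ (Fin n) →ₗ[ℝ] TangentSpace (𝓡 (2 * n + 1)) p :=
    (D.comp (ContinuousLinearMap.inr ℝ ℝ (EuclideanSpace ℝ (Fin n)))).toLinearMap
  have hS : ∀ v, S v = D ((0 : ℝ), v) := fun v => rfl
  have hSinj : Function.Injective S := by
    rw [injective_iff_map_eq_zero]
    intro v hv
    have h1 := hj.mfderiv_isotopyParam_injective ht hy ((0 : ℝ), v) hv
    exact congrArg Prod.snd h1
  obtain ⟨v, hv⟩ := hα.mem_range_of_orthogonal (p := p) (finrank_euclideanSpace_fin (𝕜 := ℝ)) S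
    hSinj hright (fun v v' => by rw [← hB, hS, hS, ← hnat, hd1, hd1, sub_zero])
    (w := D ((1 : ℝ), 0) - X) (by
      rw [map_sub, hX1, sub_eq_zero]
      exact (hj.pull_isotopyParam_left ht hy).trans (hval t ht _).symm)
    (fun v => by
      rw [← hB, map_sub, LinearMap.sub_apply, hS, ← hnat, hd1, hd2, hB, hX2, hright]
      ring)
  refine ⟨-v, ?_⟩
  have h1 : ((1 : ℝ), -v) = ((1 : ℝ), (0 : EuclideanSpace ℝ (Fin n))) - ((0 : ℝ), v) := by simp
  change D ((1 : ℝ), -v) = X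
  rw [h1, map_sub, ← hS, hv, sub_sub_cancel]

/-- A solution of the contact vector field that meets the Legendrian at one time stays on the
Legendrians for nearby times: it is obtained by solving an equation in the parameter space. -/
theorem eventually_mem_range (hα : IsContactForm α)
    (hj : IsPositiveLegendrianIsotopy α j) {h : ℝ → M → ℝ}
    (hh : ContMDiff (𝓘(ℝ, ℝ).prod (𝓡 (2 * n + 1))) 𝓘(ℝ, ℝ) ∞ (fun q : ℝ × M => h q.1 q.2))
    (hval : ∀ t ∈ Ioo (0 : ℝ) 1, ∀ x, h t (j t x) = isotopySpeed α j t x) {c : ℝ → M}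
    (hc : IsTimeCurveOn (fun t => contactHamiltonianField α (h t)) c univ)
    {t₀ : ℝ} (ht₀ : t₀ ∈ Ioo (0 : ℝ) 1) (hct : c t₀ ∈ range (j t₀)) :
    ∀ᶠ t in 𝓝 t₀, c t ∈ range (j t) := by
  have : IsManifold (𝓡 (2 * n + 1)) 1 M := IsManifold.of_le (n := ∞) (by simp)
  obtain ⟨x₀, hx₀⟩ := hct
  have hXs := contMDiff_contactHamiltonianField hα hh
  obtain ⟨g, hg, hgs⟩ := hj.exists_leftInverse_isotopyParam ht₀ x₀
  set F : ℝ × EuclideanSpace ℝ (Fin n) → M := isotopyParam j x₀ with hF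
  set y₀ := extChartAt (𝓡 n) x₀ x₀ with hy₀
  have hF₀ : F (t₀, y₀) = j t₀ x₀ := congrArg (j t₀) (extChartAt_to_inv (I := 𝓡 n) x₀)
  rw [← hF₀] at hgs
  set p₀ := F (t₀, y₀) with hp₀
  set κ := extChartAt (𝓡 (2 * n + 1)) p₀ with hκ
  have hmem : y₀ ∈ (extChartAt (𝓡 n) x₀).target := mem_extChartAt_target (I := 𝓡 n) x₀
  have hFs := hj.contMDiffAt_isotopyParam ht₀ hmem
  have hp₀s : p₀ ∈ κ.source := mem_extChartAt_source (I := 𝓡 (2 * n + 1)) p₀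
  -- the coordinate expressions of `F`, of its left inverse and of the contact vector field
  let G : ℝ × EuclideanSpace ℝ (Fin n) → EuclideanSpace ℝ (Fin (2 * n + 1)) := fun z => κ (F z)
  let ĝ : EuclideanSpace ℝ (Fin (2 * n + 1)) → ℝ × EuclideanSpace ℝ (Fin n) :=
    fun y => g (κ.symm y)
  let V : ℝ × M → EuclideanSpace ℝ (Fin (2 * n + 1)) := fun q =>
    (trivializationAt (EuclideanSpace ℝ (Fin (2 * n + 1))) (TangentSpace (𝓡 (2 * n + 1))) p₀
      ⟨q.2, contactHamiltonianField α (h q.1) q.2⟩).2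
  have hV : ContMDiffAt (𝓘(ℝ, ℝ).prod (𝓡 (2 * n + 1)))
      𝓘(ℝ, EuclideanSpace ℝ (Fin (2 * n + 1))) ∞ V (t₀, p₀) :=
    (Bundle.contMDiffAt_totalSpace.1 (hXs.contMDiffAt (x := (t₀, p₀)))).2
  have hG : ContDiffAt ℝ ∞ G (t₀, y₀) := contDiffAt_extChartAt_comp hp₀s hFs
  have hĝ : ContDiffAt ℝ ∞ ĝ (κ p₀) := by
    have h1 := contMDiffAt_extChartAt_symm (mem_extChartAt_target (I := 𝓡 (2 * n + 1)) p₀)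
    refine (ContMDiffAt.comp (κ p₀) ?_ h1).contDiffAt
    rw [← hκ, κ.left_inv hp₀s]
    exact hgs.self_of_nhds
  let Z : ℝ × EuclideanSpace ℝ (Fin n) → ℝ × EuclideanSpace ℝ (Fin n) := fun z =>
    fderiv ℝ ĝ (G z) (V (z.1, F z))
  have hZ : ContDiffAt ℝ ∞ Z (t₀, y₀) := by
    have h1 : ContDiffAt ℝ ∞ (fun z => fderiv ℝ ĝ (G z)) (t₀, y₀) :=
      ContDiffAt.comp (t₀, y₀) (g := fderiv ℝ ĝ) (hĝ.fderiv_right (by simp)) hG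
    have h2 : ContDiffAt ℝ ∞ (fun z : ℝ × EuclideanSpace ℝ (Fin n) => V (z.1, F z)) (t₀, y₀) :=
      (ContMDiffAt.comp (t₀, y₀) (g := V) hV
        (contDiff_fst.contMDiff.contMDiffAt.prodMk hFs)).contDiffAt
    exact h1.clm_apply h2
  have hnear : ∀ᶠ z in 𝓝 (t₀, y₀), z ∈ Ioo (0 : ℝ) 1 ×ˢ (extChartAt (𝓡 n) x₀).target :=
    prod_mem_nhds (isOpen_Ioo.mem_nhds ht₀)
      ((isOpen_extChartAt_target (I := 𝓡 n) x₀).mem_nhds hmem)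
  have hFsrc : ∀ᶠ z in 𝓝 (t₀, y₀), F z ∈ κ.source :=
    hFs.continuousAt (extChartAt_source_mem_nhds (I := 𝓡 (2 * n + 1)) p₀)
  have hĝd : ∀ᶠ z in 𝓝 (t₀, y₀), DifferentiableAt ℝ ĝ (G z) := by
    refine hG.continuousAt.eventually (((hĝ.of_le (m := 1) (by simp)).eventually
      (by simp)).mono fun y hy => hy.differentiableAt (by simp))
  -- `Z` is the lift of the contact vector field to the parameter space
  have hlift : ∀ᶠ z in 𝓝 (t₀, y₀), (Z z).1 = 1 ∧
      MDifferentiableAt 𝓘(ℝ, ℝ × EuclideanSpace ℝ (Fin n)) (𝓡 (2 * n + 1)) F z ∧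
      mfderiv 𝓘(ℝ, ℝ × EuclideanSpace ℝ (Fin n)) (𝓡 (2 * n + 1)) F z (Z z) =
        contactHamiltonianField α (h z.1) (F z) := by
    filter_upwards [hnear, hFsrc, hĝd, hg.eventually_nhds, hFsrc.eventually_nhds]
      with z hz hzs hzd hgz hzs'
    obtain ⟨u, hu⟩ := hj.exists_contactHamiltonianField_eq hα hh hval hz.1 hz.2
    have hFd : MDifferentiableAt 𝓘(ℝ, ℝ × EuclideanSpace ℝ (Fin n)) (𝓡 (2 * n + 1)) F z :=
      hj.mdifferentiableAt_isotopyParam hz.1 hz.2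
    have hGd : DifferentiableAt ℝ G z :=
      (contDiffAt_extChartAt_comp hzs (hj.contMDiffAt_isotopyParam hz.1 hz.2)).differentiableAt
        (by simp)
    have h1 : V (z.1, F z) = fderiv ℝ G z ((1 : ℝ), u) := by
      refine (trivializationAt_tangent_apply hzs _).trans ?_
      refine Eq.trans ?_ (mfderiv_eq_symm_fderiv hzs hFd ((1 : ℝ), u)).symm
      exact congrArg (mfderiv (𝓡 (2 * n + 1)) 𝓘(ℝ, EuclideanSpace ℝ (Fin (2 * n + 1))) κ (F z))
        hu.symm
    have h2 : HasFDerivAt (fun z => ĝ (G z)) ((fderiv ℝ ĝ (G z)).comp (fderiv ℝ G z)) z :=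
      hzd.hasFDerivAt.comp z hGd.hasFDerivAt
    have h3 : (fun z => ĝ (G z)) =ᶠ[𝓝 z] fun z => z := by
      filter_upwards [hgz, hzs'] with w hw hws
      change g (κ.symm (κ (F w))) = w
      rw [κ.left_inv hws, hw]
    have h4 : Z z = ((1 : ℝ), u) := by
      have h5 := DFunLike.congr_fun (h2.unique ((hasFDerivAt_id z).congr_of_eventuallyEq h3))
        ((1 : ℝ), u)
      change fderiv ℝ ĝ (G z) (V (z.1, F z)) = _
      rw [h1]
      exact h5
    rw [h4]
    exact ⟨rfl, hFd, hu⟩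
  obtain ⟨γ, hγ₀, ε, hε, hγ⟩ :=
    (hZ.of_le (by simp)).exists_forall_mem_closedBall_exists_eq_forall_mem_Ioo_hasDerivAt₀ t₀
  have hγc : ContinuousAt γ t₀ := (hγ t₀ ⟨by linarith, by linarith⟩).continuousAt
  have hev : ∀ᶠ s in 𝓝 t₀, (Z (γ s)).1 = 1 ∧
      MDifferentiableAt 𝓘(ℝ, ℝ × EuclideanSpace ℝ (Fin n)) (𝓡 (2 * n + 1)) F (γ s) ∧
      mfderiv 𝓘(ℝ, ℝ × EuclideanSpace ℝ (Fin n)) (𝓡 (2 * n + 1)) F (γ s) (Z (γ s)) =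
        contactHamiltonianField α (h (γ s).1) (F (γ s)) := by
    rw [← hγ₀] at hlift
    exact hγc hlift
  obtain ⟨r, hr, hball⟩ := Metric.eventually_nhds_iff_ball.1
    (hev.and (Ioo_mem_nhds (show t₀ - ε < t₀ by linarith) (show t₀ < t₀ + ε by linarith)))
  rw [Real.ball_eq_Ioo] at hball
  have htime : ∀ s ∈ Ioo (t₀ - r) (t₀ + r), (γ s).1 = s := by
    have h1 : ∀ s ∈ Ioo (t₀ - r) (t₀ + r), HasDerivAt (fun s => (γ s).1) 1 s := fun s hs => by
      have h2 := hasFDerivAt_fst.comp_hasDerivAt s (hγ s (hball s hs).2)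
      rw [← (hball s hs).1.1]
      exact h2
    exact isOpen_Ioo.eqOn_of_deriv_eq (f := fun s => (γ s).1) (g := fun s => s)
      isPreconnected_Ioo (fun s hs => (h1 s hs).differentiableAt.differentiableWithinAt)
      (fun s _ => by fun_prop) (fun s hs => by rw [(h1 s hs).deriv]; simp)
      (show t₀ ∈ Ioo (t₀ - r) (t₀ + r) from ⟨by linarith, by linarith⟩)
      (by simp only [hγ₀])
  have hcurve : IsTimeCurveOn (fun t => contactHamiltonianField α (h t)) (fun s => F (γ s))
      (Ioo (t₀ - r) (t₀ + r)) := by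
    intro s hs
    obtain ⟨⟨-, h2, h3⟩, h4⟩ := hball s hs
    rw [htime s hs] at h3
    refine (h2.hasMFDerivAt.comp s (hγ s h4).hasFDerivAt.hasMFDerivAt).congr_mfderiv ?_
    refine ContinuousLinearMap.ext_ring ?_
    change mfderiv 𝓘(ℝ, ℝ × EuclideanSpace ℝ (Fin n)) (𝓡 (2 * n + 1)) F (γ s)
      ((1 : ℝ) • Z (γ s)) = (1 : ℝ) • contactHamiltonianField α (h s) (F (γ s))
    rw [one_smul, one_smul]
    exact h3
  have hnhds : Ioo (t₀ - r) (t₀ + r) ∈ 𝓝 t₀ := Ioo_mem_nhds (by linarith) (by linarith)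
  have heq := IsTimeCurveOn.eventuallyEq hXs hnhds (hc.mono (subset_univ _)) hcurve
    (by simp only [hγ₀]; rw [← hx₀, ← hF₀])
  filter_upwards [heq, hnhds] with s hs hs'
  rw [hs]
  refine ⟨(extChartAt (𝓡 n) x₀).symm (γ s).2, ?_⟩
  change _ = j (γ s).1 _
  rw [htime s hs']

/-- A solution of the contact vector field that meets the Legendrian at one time stays on the
Legendrians. -/
theorem mem_range_of_mem_range [T2Space M] [CompactSpace L] (hα : IsContactForm α)
    (hj : IsPositiveLegendrianIsotopy α j) {h : ℝ → M → ℝ}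
    (hh : ContMDiff (𝓘(ℝ, ℝ).prod (𝓡 (2 * n + 1))) 𝓘(ℝ, ℝ) ∞ (fun q : ℝ × M => h q.1 q.2))
    (hval : ∀ t ∈ Ioo (0 : ℝ) 1, ∀ x, h t (j t x) = isotopySpeed α j t x) {c : ℝ → M}
    (hc : IsTimeCurveOn (fun t => contactHamiltonianField α (h t)) c univ)
    {t₀ : ℝ} (ht₀ : t₀ ∈ Ioo (0 : ℝ) 1) (hct : c t₀ ∈ range (j t₀)) {t : ℝ}
    (ht : t ∈ Ioo (0 : ℝ) 1) : c t ∈ range (j t) := by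
  have hcont : Continuous c :=
    continuous_iff_continuousAt.2 fun s => (hc s (mem_univ s)).continuousAt
  let S : Set ℝ := {s | ∀ᶠ s' in 𝓝 s, c s' ∈ range (j s')}
  have hS : IsOpen S := isOpen_setOfPred_eventually_nhds
  have hclosed : IsClosed {s : ℝ | ∃ q ∈ Icc (0 : ℝ) 1 ×ˢ (univ : Set L), (q.1, j q.1 q.2) =
      (s, c s)} := by
    have h1 : IsCompact ((fun q : ℝ × L => (q.1, j q.1 q.2)) '' (Icc (0 : ℝ) 1 ×ˢ univ)) :=
      (isCompact_Icc.prod isCompact_univ).image_of_continuousOn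
        (continuousOn_fst.prodMk hj.smooth.continuousOn)
    exact h1.isClosed.preimage (continuous_id.prodMk hcont)
  have hsub : Ioo (0 : ℝ) 1 ⊆ S := by
    refine isPreconnected_Ioo.subset_of_closure_inter_subset hS
      ⟨t₀, ht₀, hj.eventually_mem_range hα hh hval hc ht₀ hct⟩ ?_
    rintro s ⟨hs, hs01⟩
    refine hj.eventually_mem_range hα hh hval hc hs01 ?_
    have h1 : s ∈ closure (S ∩ Ioo 0 1) :=
      mem_closure_iff_nhds.2 fun U hU => by
        obtain ⟨w, hw, hwS⟩ := mem_closure_iff_nhds.1 hs _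
          (Filter.inter_mem hU (isOpen_Ioo.mem_nhds hs01))
        exact ⟨w, hw.1, hwS, hw.2⟩
    have h2 := closure_minimal (fun s' hs' => ?_) hclosed h1
    · obtain ⟨q, -, hq⟩ := h2
      obtain ⟨h3, h4⟩ := Prod.mk.inj hq
      rw [← h4, ← h3]
      exact mem_range_self q.2
    · obtain ⟨x, hx⟩ := hs'.1.self_of_nhds
      exact ⟨(s', x), ⟨Ioo_subset_Icc_self hs'.2, mem_univ _⟩, Prod.ext rfl hx⟩
  exact (hsub ht).self_of_nhds

end IsPositiveLegendrianIsotopy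

end Invariance

/-! ### The isotopy and the Reeb flow near the ends -/

section Ends

open Set

/-- The speed of the isotopy is one on a time interval on which the Legendrians are the images of
a fixed set under the Reeb flow. -/
theorem IsReebFlow.isotopySpeed_eq_one_of_Ioo {n : ℕ} {M : Type*} [TopologicalSpace M] [T2Space M]
    [ChartedSpace (EuclideanSpace ℝ (Fin (2 * n + 1))) M] [IsManifold (𝓡 (2 * n + 1)) ∞ M]
    {L : Type*} [TopologicalSpace L] [ChartedSpace (EuclideanSpace ℝ (Fin n)) L]
    [IsManifold (𝓡 n) ∞ L] {α : OneForm (2 * n + 1) M} (hα : IsContactForm α) {ψ : ℝ → M → M}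
    (hψ : IsReebFlow α ψ) {j : ℝ → L → M} (hj : IsPositiveLegendrianIsotopy α j) {a b c : ℝ}
    {A : Set M} (hab : Ioo a b ⊆ Ioo 0 1) (hflow : ∀ t ∈ Ioo a b, range (j t) = ψ (t - c) '' A)
    {t : ℝ} (ht : t ∈ Ioo a b) (x : L) : isotopySpeed α j t x = 1 := by
  refine hj.isotopySpeed_eq_one hα hψ (hab ht) ?_ x
  filter_upwards [isOpen_Ioo.mem_nhds ht] with s hs
  rw [hflow s hs, hflow t ht, image_image]
  refine image_congr fun p _ => ?_
  rw [← hψ.add hα]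
  congr 1
  ring

theorem IsTwistedPeriodic.image_int {M : Type*} {φ : ℝ → M → M} (hφ : IsTwistedPeriodic φ)
    (hinj : Function.Injective (φ 1)) {A : Set M} (h0 : φ 0 '' A = A) (h1 : φ 1 '' A = A) (k : ℤ) :
    φ k '' A = A := by
  have hstep : ∀ k : ℤ, φ 1 '' (φ k '' A) = φ (k + 1) '' A := fun k => by
    rw [image_image]
    refine image_congr fun p _ => ?_
    rw [hφ (k + 1) k p, add_sub_cancel_left]
  induction k using Int.induction_on with
  | zero => simpa using h0
  | succ k ih =>
    push_cast at ih ⊢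
    have := hstep k
    push_cast at this
    rw [← this, ih, h1]
  | pred k ih =>
    have := hstep (-(k : ℤ) - 1)
    push_cast at this ih ⊢
    rw [sub_add_cancel, ih] at this
    exact hinj.image_injective (this.trans h1.symm)

end Ends

end ContactGeom

end

open ContactGeom in
theorem lemma2p1 {n : ℕ}
    {M : Type*} [TopologicalSpace M] [T2Space M] [SigmaCompactSpace M]
    [ChartedSpace (EuclideanSpace ℝ (Fin (2 * n + 1))) M] [IsManifold (𝓡 (2 * n + 1)) ∞ M]
    {L : Type*} [TopologicalSpace L] [CompactSpace L]
    [ChartedSpace (EuclideanSpace ℝ (Fin n)) L] [IsManifold (𝓡 n) ∞ L]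
    (α : OneForm (2 * n + 1) M) (hα : IsContactForm α)
    (ψ : ℝ → M → M) (hψ : IsReebFlow α ψ)
    (j : ℝ → L → M) (hj : IsPositiveLegendrianIsotopy α j)
    (hper : Set.range (j 1) = Set.range (j 0))
    (hreeb0 : ∀ᶠ t in 𝓝[≥] (0 : ℝ), Set.range (j t) = ψ t '' Set.range (j 0))
    (hreeb1 : ∀ᶠ t in 𝓝[≤] (1 : ℝ), Set.range (j t) = ψ (t - 1) '' Set.range (j 1)) :
    ∃ (φ : ℝ → M → M) (h : ℝ → M → ℝ),
      IsContactIsotopy α φ ∧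
      IsTwistedPeriodic φ ∧
      ContMDiff (𝓘(ℝ, ℝ).prod (𝓡 (2 * n + 1))) 𝓘(ℝ, ℝ) ∞ (fun q : ℝ × M => h q.1 q.2) ∧
      Generates α h φ ∧
      (∀ t p, 0 < h t p) ∧
      (∀ t p, h (t + 1) p = h t p) ∧
      (∀ᶠ t in 𝓝 (0 : ℝ), ∀ p, h t p = 1) ∧
      (∀ t ∈ Set.Icc (0 : ℝ) 1, φ t '' Set.range (j 0) = Set.range (j t)) ∧
      (∀ k : ℤ, φ k '' Set.range (j 0) = Set.range (j 0)) ∧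
      (∀ t ∈ Set.Icc (0 : ℝ) 1, ∀ x : L, deriv (fun s => h s (j t x)) t = 0) := by
  obtain ⟨ε₀, hε₀, h₀⟩ := mem_nhdsGE_iff_exists_Ico_subset.1 hreeb0
  obtain ⟨ε₁, hε₁, h₁⟩ := mem_nhdsLE_iff_exists_Ioc_subset.1 hreeb1
  obtain ⟨ε, hε, hεε₀, hεε₁, hε1⟩ : ∃ ε > 0, ε ≤ ε₀ ∧ ε ≤ 1 - ε₁ ∧ ε ≤ 1 := by
    have h1 : 0 < 1 - ε₁ := sub_pos.2 hε₁
    have h2 : 0 < ε₀ := hε₀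
    exact ⟨min (min ε₀ (1 - ε₁)) 1, by positivity, (min_le_left _ _).trans (min_le_left _ _),
      (min_le_left _ _).trans (min_le_right _ _), min_le_right _ _⟩
  have hflow0 : ∀ t ∈ Set.Ioo 0 ε, Set.range (j t) = ψ t '' Set.range (j 0) := fun t ht =>
    h₀ ⟨ht.1.le, ht.2.trans_le hεε₀⟩
  have hflow1 : ∀ t ∈ Set.Ioo (1 - ε) 1, Set.range (j t) = ψ (t - 1) '' Set.range (j 1) :=
    fun t ht => h₁ ⟨by linarith [ht.1], ht.2.le⟩
  obtain ⟨h, K, hh, hK, hpos, hhper, hoff, hnear, hval⟩ := hj.exists_contactHamiltonian hα hε hε1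
    (by
      rintro t ht (h | h) x
      · exact hψ.isotopySpeed_eq_one_of_Ioo hα hj (c := 0) (A := Set.range (j 0))
          (fun s hs => ⟨hs.1, hs.2.trans_le hε1⟩) (fun s hs => by rw [sub_zero, hflow0 s hs])
          ⟨ht.1, h⟩ x
      · exact hψ.isotopySpeed_eq_one_of_Ioo hα hj (A := Set.range (j 1))
          (fun s hs => ⟨by linarith [hs.1], hs.2⟩) hflow1 ⟨h, ht.2⟩ x)
  obtain ⟨φ, hφ, hgen, htw⟩ := exists_contactIsotopy hα hψ hh hhper hK hoff
  have hXs := contMDiff_contactHamiltonianField hα hh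
  have hcurve : ∀ p, IsTimeCurveOn (fun t => contactHamiltonianField α (h t)) (fun t => φ t p)
      Set.univ := fun p t _ => hgen t p
  have hbij : ∀ t, Function.Bijective (φ t) := fun t => by
    obtain ⟨Φ, hΦ⟩ := hφ.diffeomorph t
    rw [← funext hΦ]
    exact Φ.bijective
  -- while `h = 1` the contact isotopy is the Reeb flow
  have hreeb : ∀ k : ℤ, ∀ t ∈ Set.Ioo ((k : ℝ) - ε / 2) (k + ε / 2),
      ∀ s ∈ Set.Ioo ((k : ℝ) - ε / 2) (k + ε / 2), ∀ p, φ t p = ψ (t - s) (φ s p) := by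
    intro k t ht s hs p
    have hhk : ∀ τ ∈ Set.Ioo ((k : ℝ) - ε / 2) (k + ε / 2), h τ = fun _ => 1 := by
      intro τ hτ
      have hp : Function.Periodic h 1 := fun t => funext (hhper t)
      rw [← hp.sub_int_mul_eq k, mul_one]
      exact funext (hnear _ (abs_lt.2 ⟨by linarith [hτ.1], by linarith [hτ.2]⟩))
    refine IsTimeCurveOn.eqOn_Ioo hXs hs ((hcurve p).mono (Set.subset_univ _))
      (c' := fun τ => ψ (τ - s) (φ s p)) (fun τ hτ => ?_) (by simp [hψ.zero]) ht
    simp only [hhk τ hτ, contactHamiltonianField_one hα]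
    exact hasMFDerivAt_shift (a := -s) (hψ.integralCurve (φ s p) (τ + -s))
  have hφ0 : φ 0 '' Set.range (j 0) = Set.range (j 0) := by
    rw [show φ 0 = id from funext hφ.zero, Set.image_id]
  have himage_near : φ (ε / 4) '' Set.range (j 0) = Set.range (j (ε / 4)) := by
    rw [hflow0 (ε / 4) ⟨by linarith, by linarith⟩]
    refine Set.image_congr fun p _ => ?_
    rw [hreeb 0 (ε / 4) ⟨by push_cast; linarith, by push_cast; linarith⟩ 0
      ⟨by push_cast; linarith, by push_cast; linarith⟩, sub_zero, hφ.zero]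
  have hmem : ∀ t ∈ Set.Ioo (0 : ℝ) 1, ∀ s ∈ Set.Ioo (0 : ℝ) 1, ∀ p, φ t p ∈ Set.range (j t) →
      φ s p ∈ Set.range (j s) := fun t ht s hs p hp =>
    hj.mem_range_of_mem_range hα hh (fun t ht x => (hval t ht x).self_of_nhds) (hcurve p) ht hp hs
  have himage : ∀ t ∈ Set.Ioo (0 : ℝ) 1, φ t '' Set.range (j 0) = Set.range (j t) := by
    intro t ht
    have ha : ε / 4 ∈ Set.Ioo (0 : ℝ) 1 := ⟨by linarith, by linarith⟩
    refine Set.Subset.antisymm ?_ fun q hq => ?_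
    · rintro _ ⟨p, hp, rfl⟩
      exact hmem _ ha t ht p (himage_near ▸ Set.mem_image_of_mem _ hp)
    · obtain ⟨p, rfl⟩ := (hbij t).2 q
      have h1 := hmem t ht _ ha p hq
      rw [← himage_near] at h1
      exact Set.mem_image_of_mem _ (((hbij _).1.mem_set_image).1 h1)
  have himage_one : φ 1 '' Set.range (j 0) = Set.range (j 1) := by
    have hb : 1 - ε / 4 ∈ Set.Ioo (1 - ε) 1 := ⟨by linarith, by linarith⟩
    have h1 : φ 1 '' Set.range (j 0) = ψ (ε / 4) '' (φ (1 - ε / 4) '' Set.range (j 0)) := by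
      rw [Set.image_image]
      refine Set.image_congr fun p _ => ?_
      rw [hreeb 1 1 ⟨by push_cast; linarith, by push_cast; linarith⟩ (1 - ε / 4)
        ⟨by push_cast; linarith, by push_cast; linarith⟩, sub_sub_cancel]
    rw [h1, himage _ ⟨by linarith, by linarith⟩, hflow1 _ hb, Set.image_image]
    have h2 : ∀ p, ψ (ε / 4) (ψ (1 - ε / 4 - 1) p) = p := fun p => by
      rw [← hψ.add hα, show ε / 4 + (1 - ε / 4 - 1) = 0 by ring, hψ.zero]
    simp only [h2, Set.image_id']
  have hone_near : ∀ᶠ t in 𝓝 (0 : ℝ), ∀ p, h t p = 1 := by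
    filter_upwards [Metric.ball_mem_nhds (0 : ℝ) (half_pos hε)] with t ht
    exact hnear t (by simpa using ht)
  refine ⟨φ, h, hφ, htw, hh, hgen, hpos, hhper, hone_near, fun t ht => ?_,
    htw.image_int (hbij 1).1 hφ0 (himage_one.trans hper), fun t ht x => ?_⟩
  · rcases ht.1.eq_or_lt with rfl | h0
    · exact hφ0
    rcases ht.2.eq_or_lt with rfl | h1
    · exact himage_one
    exact himage t ⟨h0, h1⟩
  · have hconst : ∀ c : ℝ, (∀ᶠ s in 𝓝 t, h s (j t x) = c) → deriv (fun s => h s (j t x)) t = 0 :=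
      fun c hc => by
        rw [Filter.EventuallyEq.deriv_eq (f := fun _ => c) hc, deriv_const]
    rcases ht.1.eq_or_lt with rfl | h0
    · exact hconst 1 (hone_near.mono fun s hs => hs _)
    rcases ht.2.eq_or_lt with rfl | h1
    · refine hconst 1 ?_
      have h2 : Filter.Tendsto (fun s : ℝ => s - 1) (𝓝 1) (𝓝 0) := by
        simpa using (continuous_sub_right (1 : ℝ)).tendsto 1
      filter_upwards [h2.eventually hone_near] with s hs
      have h3 := hhper (s - 1) (j 1 x)
      rw [sub_add_cancel] at h3
      exact h3.trans (hs _)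
    exact hconst _ (hval t ⟨h0, h1⟩ x)
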